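/- Let $k$ be a field of characteristic zero. Complexes of $k$-vector spaces are $\mathbb{Z}$-graded with differentials of degree $+1$, and the Koszul sign rule is used throughout. For a complex $V$ let $sV$ be its suspension, $(sV)^p=V^{p+1}$ with differential $-d$, and let $Sym^*_c(sV)=\bigoplus_{n\ge 0}Sym^n(sV)$ be the coaugmented DG coalgebra of graded symmetric tensors $Sym^n(sV)=((sV)^{\otimes n})^{\Sigma_n}$, with the deconcatenation coproduct. Let $\Omega\, Sym^*_c(sV)$ be its reduced cobar construction, i.e. the tensor algebra on $s^{-1}\bigoplus_{n\ge1}Sym^n(sV)$ with the derivation differential $s^{-1}c\mapsto -s^{-1}(dc)+\sum(-1)^{\deg c'}s^{-1}c'\otimes s^{-1}c''$, where $\sum c'\otimes c''$ is the reduced coproduct of $c$. Let $\lambda$ be a partition of $n\ge 1$ and $T$ a standard $\lambda$-tableau (a bijection from the cells of $\lambda$ to $\{1,\dots,n\}$ increasing along rows and down columns). (a) Let $c_T\in k[\Sigma_n]$ be the sum of the permutations preserving the columns of $T$, $r_T^-$ the alternating sum $\sum(-1)^\sigma\sigma$ over the permutations preserving the rows of $T$, and $e_T=c_Tr_T^-$.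 Let $\Sigma_n$ act on $V^{\otimes n}$ on the right through the graded permutation action on $(sV)^{\otimes n}$ and the identification $V^{\otimes n}\cong (sV)^{\otimes n}$, $v_1\otimes\dots\otimes v_n\mapsto \pm\, sv_1\otimes\dots\otimes sv_n$ (Koszul sign); that is, $\sigma$ acts by $(-1)^{\sigma}$ times the graded permutation action on $V^{\otimes n}$. The Schur complex is the subcomplex $S^T(V)=V^{\otimes n}e_T\subseteq V^{\otimes n}$. (b) Let $J_T$ be the set of $i\in\{1,\dots,n-1\}$ such that the cell of $i$ in $T$ lies in a row strictly above the row of the cell of $i+1$. For $J\subseteq J_T$ with $p$ elements let $\zeta_J:\{1,\dots,n\}\to\{1,\dots,n-p\}$ be the weakly increasing surjection with $J=\{i\mid\zeta_J(i)=\zeta_J(i+1)\}$, and let $T_J=\zeta_J\circ T$ (a column-semistandard tableau). The complex $C_T$ has in degree $-p$ the basis of all $T_J$ with $J\subseteq J_T$, $\#J=p$, and differential $$\partial(T_J)=\sum_{j\in J}(-1)^{\#X(J,j)}\,T_{J\setminus j},\qquad X(J,j)=\{i\mid 1\le i\le j-1,\ i\notin J\}.$$ Then there is an isomorphism of complexes,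 natural in $V$, $$\Omega\, Sym^*_c(sV)\;\simeq\; k\oplus\bigoplus_{\lambda}\ \bigoplus_{T\ \text{a standard}\ \lambda\text{-tableau}} C_T\otimes S^T(V),$$ where $\lambda$ runs over the partitions of all $n\ge1$ and $k$ is placed in degree $0$. -/

import Mathlib

open CategoryTheory
open scoped DirectSum TensorProduct

universe u v

noncomputable section

namespace TableauDecomposition

/-! ### The total space of a complex -/

lemma zmod_two_cases (a : ZMod 2) : a = 0 ∨ a = 1 := by
  revert a
  decide

section Total

variable {k : Type u} [Field k]

/-- The total space `⨁ p, V^p` of a complex of vector spaces. -/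
abbrev Tot (V : CochainComplex (ModuleCat.{v} k) ℤ) : Type v := ⨁ p : ℤ, V.X p

variable (V W : CochainComplex (ModuleCat.{v} k) ℤ)

/-- The differential of `V` on the total space. -/
def totD : Tot V →ₗ[k] Tot V :=
  DirectSum.toModule k ℤ (Tot V) fun p =>
    DirectSum.lof k ℤ (fun q => V.X q) (p + 1) ∘ₗ (V.d p (p + 1)).hom

/-- The projection of `V` onto the sum of the components of even degree (`a = 0`) or of odd
degree (`a = 1`). -/
def parityProj (a : ZMod 2) : Tot V →ₗ[k] Tot V :=
  DirectSum.lmap fun p : ℤ => if (p : ZMod 2) = a then LinearMap.id else 0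

/-- The sign operator `v ↦ (-1)^(deg v) v`. -/
def signOp : Tot V →ₗ[k] Tot V := parityProj V 0 - parityProj V 1

variable {V W} in
/-- The map of total spaces induced by a morphism of complexes. -/
def totMap (f : V ⟶ W) : Tot V →ₗ[k] Tot W :=
  DirectSum.lmap fun p : ℤ => (f.f p).hom

/-- The elements of degree `p`. -/
def totDeg (p : ℤ) : Submodule k (Tot V) :=
  LinearMap.range (DirectSum.lof k ℤ (fun q => V.X q) p)

lemma parityProj_add : parityProj V 0 + parityProj V 1 = LinearMap.id := by
  refine DirectSum.linearMap_ext k fun p => ?_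
  ext x : 1
  simp only [parityProj, LinearMap.comp_apply, LinearMap.add_apply, DirectSum.lmap_lof,
    LinearMap.id_apply]
  rcases zmod_two_cases p with h | h <;> simp [h]

lemma parityProj_comp (a b : ZMod 2) :
    parityProj V a ∘ₗ parityProj V b = if a = b then parityProj V a else 0 := by
  refine DirectSum.linearMap_ext k fun p => ?_
  ext x : 1
  by_cases hab : a = b
  · subst hab
    by_cases h : (p : ZMod 2) = a <;> simp [parityProj, DirectSum.lmap_lof, h]
  · by_cases h : (p : ZMod 2) = b
    · have : (p : ZMod 2) ≠ a := fun h' => hab (h'.symm.trans h)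
      simp [parityProj, DirectSum.lmap_lof, h, hab, Ne.symm hab]
    · simp [parityProj, DirectSum.lmap_lof, h, hab]

lemma parityProj_totD (a : ZMod 2) :
    parityProj V (a + 1) ∘ₗ totD V = totD V ∘ₗ parityProj V a := by
  refine DirectSum.linearMap_ext k fun p => ?_
  ext x : 1
  by_cases h : (p : ZMod 2) = a <;> simp [parityProj, totD, DirectSum.lmap_lof, h]

variable {V W} in
lemma parityProj_totMap (f : V ⟶ W) (a : ZMod 2) :
    parityProj W a ∘ₗ totMap f = totMap f ∘ₗ parityProj V a := by
  refine DirectSum.linearMap_ext k fun p => ?_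
  ext x : 1
  by_cases h : (p : ZMod 2) = a <;> simp [parityProj, totMap, DirectSum.lmap_lof, h]

lemma parityProj_signOp (a : ZMod 2) :
    parityProj V a ∘ₗ signOp V = signOp V ∘ₗ parityProj V a := by
  simp only [signOp, LinearMap.comp_sub, LinearMap.sub_comp, parityProj_comp]
  rcases zmod_two_cases a with rfl | rfl <;> simp

lemma signOp_of_parity {a : ZMod 2} {x : Tot V} (hx : parityProj V a x = x) :
    signOp V x = (if a = 1 then (-1 : k) else 1) • x := by
  have h0 := LinearMap.congr_fun (parityProj_comp V 0 a) x
  have h1 := LinearMap.congr_fun (parityProj_comp V 1 a) x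
  simp only [LinearMap.comp_apply, hx] at h0 h1
  rw [signOp, LinearMap.sub_apply, h0, h1]
  rcases zmod_two_cases a with rfl | rfl
  · simp [hx]
  · simp [hx]

end Total

/-! ### Tensor powers and the graded action of the symmetric group -/

section Powers

variable {k : Type u} [Field k]

/-- The tensor power `V^{⊗n}` (its total space). -/
abbrev TPow (V : CochainComplex (ModuleCat.{v} k) ℤ) (n : ℕ) : Type (max u v) := ⨂[k]^n (Tot V)

variable (V W : CochainComplex (ModuleCat.{v} k) ℤ)

/-- The elements of degree `p` of `V^{⊗n}`: the span of the `v_1 ⊗ ... ⊗ v_n` with `v_i`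
homogeneous of degree `g_i` and `∑ g_i = p`. -/
def tpowDeg (n : ℕ) (p : ℤ) : Submodule k (TPow V n) :=
  Submodule.span k {x | ∃ (g : Fin n → ℤ) (w : Fin n → Tot V),
    (∀ i, w i ∈ totDeg V (g i)) ∧ ∑ i, g i = p ∧ x = PiTensorProduct.tprod k w}

/-- The differential of `V^{⊗n}`: the sum over `i` of `1 ⊗ ... ⊗ d ⊗ ... ⊗ 1` (with `d` in place
`i`), with the Koszul sign `(-1)^(deg v_j)` for each `j < i`. -/
def tpowD (n : ℕ) : TPow V n →ₗ[k] TPow V n :=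
  ∑ i : Fin n, PiTensorProduct.map fun j =>
    if j < i then signOp V else if j = i then totD V else LinearMap.id

/-- The Koszul sign of `v_1 ⊗ ... ⊗ v_n ↦ v_{σ 1} ⊗ ... ⊗ v_{σ n}`, where `p i` is the parity of
`v_i`: a factor `-1` for each pair of odd vectors which are interchanged. -/
def koszulSign {n : ℕ} (σ : Equiv.Perm (Fin n)) (p : Fin n → ZMod 2) : ℤ :=
  ∏ i, ∏ j, if i < j ∧ σ j < σ i ∧ p (σ i) = 1 ∧ p (σ j) = 1 then -1 else 1

/-- The graded right action of `Σ_n` on `V^{⊗n}`: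
`(v_1 ⊗ ... ⊗ v_n) · σ = ± v_{σ 1} ⊗ ... ⊗ v_{σ n}` with the Koszul sign. The sum over `p`
decomposes the `v_i` into even and odd parts, see `act_tprod`. -/
def act {n : ℕ} (σ : Equiv.Perm (Fin n)) : TPow V n →ₗ[k] TPow V n :=
  ∑ p : Fin n → ZMod 2, (koszulSign σ p : k) •
    ((PiTensorProduct.reindex k (fun _ : Fin n => Tot V) σ⁻¹).toLinearMap ∘ₗ
      PiTensorProduct.map fun i => parityProj V (p i))

variable {V W} in
/-- The map of tensor powers induced by a morphism of complexes. -/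
def tpowMap (f : V ⟶ W) (n : ℕ) : TPow V n →ₗ[k] TPow W n :=
  PiTensorProduct.map fun _ => totMap f

lemma tpow_ext {n : ℕ} {M : Type*} [AddCommGroup M] [Module k M] {f g : TPow V n →ₗ[k] M}
    (h : ∀ (p : Fin n → ZMod 2) (w : Fin n → Tot V), (∀ i, parityProj V (p i) (w i) = w i) →
      f (PiTensorProduct.tprod k w) = g (PiTensorProduct.tprod k w)) : f = g := by
  refine PiTensorProduct.ext (MultilinearMap.ext fun w => ?_)
  have hw : w = fun i => ∑ a : ZMod 2, parityProj V a (w i) := by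
    funext i
    have := LinearMap.congr_fun (parityProj_add V) (w i)
    exact this.symm.trans (Fin.sum_univ_two fun a : ZMod 2 => parityProj V a (w i)).symm
  simp only [LinearMap.compMultilinearMap_apply]
  rw [hw, MultilinearMap.map_sum, map_sum, map_sum]
  refine Finset.sum_congr rfl fun p _ => h p _ fun i => ?_
  have := LinearMap.congr_fun (parityProj_comp V (p i) (p i)) (w i)
  simpa using this

lemma act_tprod {n : ℕ} (σ : Equiv.Perm (Fin n)) (p : Fin n → ZMod 2) (w : Fin n → Tot V)
    (hw : ∀ i, parityProj V (p i) (w i) = w i) :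
    act V σ (PiTensorProduct.tprod k w) =
      (koszulSign σ p : k) • PiTensorProduct.tprod k fun i => w (σ i) := by
  rw [act, LinearMap.sum_apply, Finset.sum_eq_single p]
  · simp only [LinearMap.smul_apply, LinearMap.comp_apply, PiTensorProduct.map_tprod, hw,
      LinearEquiv.coe_coe]
    rw [PiTensorProduct.reindex_tprod]
    rfl
  · intro q _ hq
    obtain ⟨i, hi⟩ := Function.ne_iff.mp hq
    have h0 : parityProj V (q i) (w i) = 0 := by
      have := LinearMap.congr_fun (parityProj_comp V (q i) (p i)) (w i)
      simpa [hw i, hi] using this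
    simp only [LinearMap.smul_apply, LinearMap.comp_apply, PiTensorProduct.map_tprod]
    rw [(PiTensorProduct.tprod k).map_coord_zero i h0]
    simp
  · simp

lemma prod_pairs_comp {n : ℕ} (τ : Equiv.Perm (Fin n)) (h : Fin n → Fin n → ℤ)
    (hs : ∀ i j, h i j = h j i) :
    ∏ i, ∏ j, (if i < j then h (τ i) (τ j) else 1) = ∏ i, ∏ j, (if i < j then h i j else 1) := by
  simp only [← Finset.prod_product']
  rw [← Finset.prod_filter, ← Finset.prod_filter]
  refine Finset.prod_bij' (fun x _ => (τ x.1 ⊓ τ x.2, τ x.1 ⊔ τ x.2))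
    (fun x _ => (τ.symm x.1 ⊓ τ.symm x.2, τ.symm x.1 ⊔ τ.symm x.2)) ?_ ?_ ?_ ?_ ?_
  · rintro ⟨i, j⟩ hij
    have hij' : i < j := by simpa using hij
    have : τ i ≠ τ j := fun e => hij'.ne (τ.injective e)
    simpa [eq_comm] using this
  · rintro ⟨i, j⟩ hij
    have hij' : i < j := by simpa using hij
    have : τ.symm i ≠ τ.symm j := fun e => hij'.ne (τ.symm.injective e)
    simpa [eq_comm] using this
  · rintro ⟨i, j⟩ hij
    have hij' : i < j := by simpa using hij
    rcases le_total (τ i) (τ j) with hle | hle <;> simp [hle, hij'.le]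
  · rintro ⟨i, j⟩ hij
    have hij' : i < j := by simpa using hij
    rcases le_total (τ.symm i) (τ.symm j) with hle | hle <;> simp [hle, hij'.le]
  · rintro ⟨i, j⟩ hij
    rcases le_total (τ i) (τ j) with hle | hle
    · simp [hle]
    · simp [hle, hs (τ i) (τ j)]

lemma koszulSign_mul {n : ℕ} (σ τ : Equiv.Perm (Fin n)) (p : Fin n → ZMod 2) :
    koszulSign (σ * τ) p = koszulSign σ p * koszulSign τ (fun i => p (σ i)) := by
  have key : koszulSign σ p = ∏ i, ∏ j, (if i < j then
      (if ((τ i < τ j ∧ σ (τ j) < σ (τ i)) ∨ (τ j < τ i ∧ σ (τ i) < σ (τ j))) ∧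
        p (σ (τ i)) = 1 ∧ p (σ (τ j)) = 1 then (-1 : ℤ) else 1) else 1) := by
    rw [prod_pairs_comp τ (fun i j => if ((i < j ∧ σ j < σ i) ∨ (j < i ∧ σ i < σ j)) ∧
        p (σ i) = 1 ∧ p (σ j) = 1 then (-1 : ℤ) else 1)]
    · refine Finset.prod_congr rfl fun i _ => Finset.prod_congr rfl fun j _ => ?_
      by_cases hij : i < j
      · simp [hij, hij.not_gt]
      · simp [hij]
    · intro i j
      refine if_congr ?_ rfl rfl
      tauto
  rw [key, koszulSign, koszulSign, ← Finset.prod_mul_distrib]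
  refine Finset.prod_congr rfl fun i _ => ?_
  rw [← Finset.prod_mul_distrib]
  refine Finset.prod_congr rfl fun j _ => ?_
  by_cases hij : i < j
  · have h1 : τ i ≠ τ j := fun e => hij.ne (τ.injective e)
    have h2 : σ (τ i) ≠ σ (τ j) := fun e => h1 (σ.injective e)
    by_cases hp : p (σ (τ i)) = 1 ∧ p (σ (τ j)) = 1
    · rcases lt_or_gt_of_ne h1 with h1 | h1 <;> rcases lt_or_gt_of_ne h2 with h2 | h2 <;>
        simp [hij, h1, h2, h1.not_gt, h2.not_gt, hp.1, hp.2]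
    · have e2 : ∀ P : Prop, ¬ (P ∧ p (σ (τ i)) = 1 ∧ p (σ (τ j)) = 1) := by tauto
      simp [Equiv.Perm.mul_apply, e2]
  · simp [hij]

/-- `act` is a right action. -/
lemma act_mul {n : ℕ} (σ τ : Equiv.Perm (Fin n)) : act V (σ * τ) = act V τ ∘ₗ act V σ := by
  refine tpow_ext V fun p w hw => ?_
  rw [LinearMap.comp_apply, act_tprod V _ p w hw, act_tprod V _ p w hw, map_smul,
    act_tprod V τ (fun i => p (σ i)) _ fun i => hw (σ i), smul_smul, koszulSign_mul]
  push_cast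
  rfl

lemma act_one {n : ℕ} : act V (1 : Equiv.Perm (Fin n)) = LinearMap.id := by
  refine tpow_ext V fun p w hw => ?_
  rw [act_tprod V _ p w hw]
  have : koszulSign (1 : Equiv.Perm (Fin n)) p = 1 := by
    refine Finset.prod_eq_one fun i _ => Finset.prod_eq_one fun j _ => if_neg ?_
    rintro ⟨h, h', -⟩
    exact lt_asymm h h'
  simp [this]

variable {V W} in
/-- Parity-preserving maps commute with the action. -/
lemma map_comp_act {f : Tot V →ₗ[k] Tot W}
    (hf : ∀ a, parityProj W a ∘ₗ f = f ∘ₗ parityProj V a) {n : ℕ} (σ : Equiv.Perm (Fin n)) :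
    PiTensorProduct.map (fun _ => f) ∘ₗ act V σ = act W σ ∘ₗ PiTensorProduct.map (fun _ => f) := by
  refine tpow_ext V fun p w hw => ?_
  have hw' : ∀ i, parityProj W (p i) (f (w i)) = f (w i) := fun i => by
    have := LinearMap.congr_fun (hf (p i)) (w i)
    simpa [hw i] using this
  rw [LinearMap.comp_apply, LinearMap.comp_apply, act_tprod V _ p w hw, map_smul,
    PiTensorProduct.map_tprod, PiTensorProduct.map_tprod, act_tprod W _ p _ hw']

lemma tpowD_tprod {n : ℕ} (p : Fin n → ZMod 2) (w : Fin n → Tot V)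
    (hw : ∀ i, parityProj V (p i) (w i) = w i) :
    tpowD V n (PiTensorProduct.tprod k w) =
      ∑ i, (((∏ j, if j < i ∧ p j = 1 then -1 else 1 : ℤ)) : k) •
        PiTensorProduct.tprod k (Function.update w i (totD V (w i))) := by
  rw [tpowD, LinearMap.sum_apply]
  refine Finset.sum_congr rfl fun i _ => ?_
  rw [PiTensorProduct.map_tprod]
  have : (fun j => (if j < i then signOp V else if j = i then totD V else LinearMap.id) (w j)) =
      fun j => (if j < i ∧ p j = 1 then (-1 : k) else 1) •
        Function.update w i (totD V (w i)) j := by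
    funext j
    rcases lt_trichotomy j i with h | h | h
    · simp [h, h.ne, signOp_of_parity V (hw j)]
    · subst h
      simp
    · simp [h.not_gt, h.ne']
  rw [this, MultilinearMap.map_smul_univ]
  push_cast
  rfl

lemma prod_prod_split {n : ℕ} (i : Fin n) (F : Fin n → Fin n → ℤ) (hF : F i i = 1) :
    ∏ a, ∏ b, F a b =
      (∏ a ∈ Finset.univ.erase i, ∏ b ∈ Finset.univ.erase i, F a b) * ∏ j, (F i j * F j i) := by
  rw [← Finset.mul_prod_erase _ _ (Finset.mem_univ i),
    ← Finset.mul_prod_erase _ (fun j => F i j * F j i) (Finset.mem_univ i)]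
  have h1 : ∀ a, ∏ b, F a b = F a i * ∏ b ∈ Finset.univ.erase i, F a b := fun a =>
    (Finset.mul_prod_erase _ _ (Finset.mem_univ i)).symm
  simp only [h1, hF, Finset.prod_mul_distrib]
  ring

lemma koszulSign_update {n : ℕ} (σ : Equiv.Perm (Fin n)) (p : Fin n → ZMod 2) (i : Fin n) :
    (∏ j, if j < σ i ∧ p j = 1 then -1 else 1 : ℤ) *
        koszulSign σ (Function.update p (σ i) (p (σ i) + 1)) =
      koszulSign σ p * (∏ j, if j < i ∧ p (σ j) = 1 then -1 else 1 : ℤ) := by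
  rw [← Equiv.prod_comp σ fun j => if j < σ i ∧ p j = 1 then (-1 : ℤ) else 1, koszulSign,
    koszulSign, prod_prod_split i _ (by simp), prod_prod_split i (fun a b =>
      if a < b ∧ σ b < σ a ∧ p (σ a) = 1 ∧ p (σ b) = 1 then (-1 : ℤ) else 1) (by simp)]
  have hR : (∏ a ∈ Finset.univ.erase i, ∏ b ∈ Finset.univ.erase i,
      if a < b ∧ σ b < σ a ∧ Function.update p (σ i) (p (σ i) + 1) (σ a) = 1 ∧
        Function.update p (σ i) (p (σ i) + 1) (σ b) = 1 then (-1 : ℤ) else 1) =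
      ∏ a ∈ Finset.univ.erase i, ∏ b ∈ Finset.univ.erase i,
        if a < b ∧ σ b < σ a ∧ p (σ a) = 1 ∧ p (σ b) = 1 then (-1 : ℤ) else 1 := by
    refine Finset.prod_congr rfl fun a ha => Finset.prod_congr rfl fun b hb => ?_
    have ha' : a ≠ i := Finset.ne_of_mem_erase ha
    have hb' : b ≠ i := Finset.ne_of_mem_erase hb
    simp [ha', hb']
  rw [hR, mul_left_comm, mul_assoc, ← Finset.prod_mul_distrib, ← Finset.prod_mul_distrib]
  congr 1
  refine Finset.prod_congr rfl fun j _ => ?_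
  by_cases hji : j = i
  · subst hji
    simp
  have hs : σ j ≠ σ i := fun e => hji (σ.injective e)
  have hz : ∀ a : ZMod 2, a + 1 = 1 ↔ ¬ a = 1 := by decide
  by_cases hq : p (σ j) = 1 <;> by_cases hq' : p (σ i) = 1 <;>
    rcases lt_or_gt_of_ne hji with h1 | h1 <;> rcases lt_or_gt_of_ne hs with h2 | h2 <;>
    simp [hji, hz, hq, hq', h1, h2, h1.not_gt, h2.not_gt]

/-- The differential of `V^{⊗n}` commutes with the action. -/
lemma tpowD_comp_act {n : ℕ} (σ : Equiv.Perm (Fin n)) :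
    tpowD V n ∘ₗ act V σ = act V σ ∘ₗ tpowD V n := by
  refine tpow_ext V fun p w hw => ?_
  rw [LinearMap.comp_apply, LinearMap.comp_apply, act_tprod V _ p w hw, map_smul,
    tpowD_tprod V (fun i => p (σ i)) _ (fun i => hw (σ i)), tpowD_tprod V p w hw, map_sum,
    Finset.smul_sum,
    ← Equiv.sum_comp σ fun i => act V σ ((((∏ j, if j < i ∧ p j = 1 then -1 else 1 : ℤ)) : k) •
        PiTensorProduct.tprod k (Function.update w i (totD V (w i))))]
  refine Finset.sum_congr rfl fun i _ => ?_
  rw [map_smul, act_tprod V σ (Function.update p (σ i) (p (σ i) + 1)), smul_smul, smul_smul,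
    ← Int.cast_mul, ← Int.cast_mul, koszulSign_update]
  · congr 2
    funext j
    by_cases h : j = i
    · subst h
      simp
    · simp [h]
  · intro j
    by_cases h : j = σ i
    · subst h
      have := LinearMap.congr_fun (parityProj_totD V (p (σ i))) (w (σ i))
      simpa [hw (σ i)] using this
    · simp [h, hw j]

end Powers

/-! ### Graded symmetric tensors and their coalgebra structure -/

section Symmetric

variable {k : Type u} [Field k] (V W : CochainComplex (ModuleCat.{v} k) ℤ)

/-- `Sym^n(V)`: the graded symmetric tensors, i.e. the vectors of `V^{⊗n}` which are invariant
under the graded action of the symmetric group. -/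
def symPow (n : ℕ) : Submodule k (TPow V n) where
  carrier := {x | ∀ σ : Equiv.Perm (Fin n), act V σ x = x}
  add_mem' hx hy σ := by rw [map_add, hx σ, hy σ]
  zero_mem' σ := map_zero _
  smul_mem' c x hx σ := by rw [map_smul, hx σ]

/-- The differential of `Sym^n(V)`, restricted from `V^{⊗n}`. -/
def symD (n : ℕ) : symPow V n →ₗ[k] symPow V n :=
  (tpowD V n).restrict fun x hx σ => by
    rw [← LinearMap.comp_apply, ← tpowD_comp_act, LinearMap.comp_apply, hx σ]

/-- The sign operator `x ↦ (-1)^(deg x) x` on `Sym^n(V)`. -/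
def symSign (n : ℕ) : symPow V n →ₗ[k] symPow V n :=
  (PiTensorProduct.map fun _ : Fin n => signOp V).restrict fun x hx σ => by
    rw [← LinearMap.comp_apply, ← map_comp_act (parityProj_signOp V), LinearMap.comp_apply, hx σ]

variable {V W} in
/-- The map of symmetric powers induced by a morphism of complexes. -/
def symMap (f : V ⟶ W) (n : ℕ) : symPow V n →ₗ[k] symPow W n :=
  (tpowMap f n).restrict fun x hx σ => by
    rw [tpowMap, ← LinearMap.comp_apply, ← map_comp_act (parityProj_totMap f),
      LinearMap.comp_apply, hx σ]

/-- The averaging map `V^{⊗n} → Sym^n(V)` (a projection in characteristic zero). -/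
def symProj (n : ℕ) : TPow V n →ₗ[k] symPow V n :=
  LinearMap.codRestrict (symPow V n)
    ((n.factorial : k)⁻¹ • ∑ σ : Equiv.Perm (Fin n), act V σ) fun x τ => by
      rw [LinearMap.smul_apply, map_smul, LinearMap.sum_apply, map_sum]
      congr 1
      rw [← Equiv.sum_comp (Equiv.mulRight τ) fun σ => act V σ x]
      refine Finset.sum_congr rfl fun σ _ => ?_
      simp [act_mul]

/-- The component `Sym^n(V) → Sym^a(V) ⊗ Sym^b(V)`, `n = a + b`, of the coproduct of the
symmetric coalgebra. It is the deconcatenation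
`v_1 ⊗ ... ⊗ v_n ↦ (v_1 ⊗ ... ⊗ v_a) ⊗ (v_{a+1} ⊗ ... ⊗ v_n)`, which takes symmetric tensors
to `Sym^a(V) ⊗ Sym^b(V) ⊆ V^{⊗a} ⊗ V^{⊗b}`, see `map_subtype_symComul`. -/
def symComul (a b n : ℕ) (h : n = a + b) : symPow V n →ₗ[k] symPow V a ⊗[k] symPow V b :=
  TensorProduct.map (symProj V a) (symProj V b) ∘ₗ
    (TensorPower.mulEquiv (R := k) (M := Tot V) (n := a) (m := b)).symm.toLinearMap ∘ₗ
      (TensorPower.cast k (Tot V) h).toLinearMap ∘ₗ (symPow V n).subtype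

/-- The permutation of `Fin (a + b)` which acts by `σ` and `τ` on the two blocks. -/
def blockPerm {a b : ℕ} (σ : Equiv.Perm (Fin a)) (τ : Equiv.Perm (Fin b)) :
    Equiv.Perm (Fin (a + b)) :=
  finSumFinEquiv.permCongr (Equiv.Perm.sumCongr σ τ)

lemma blockPerm_castAdd {a b : ℕ} (σ : Equiv.Perm (Fin a)) (τ : Equiv.Perm (Fin b)) (i : Fin a) :
    blockPerm σ τ (Fin.castAdd b i) = Fin.castAdd b (σ i) := by
  simp [blockPerm, Equiv.permCongr_apply]

lemma blockPerm_natAdd {a b : ℕ} (σ : Equiv.Perm (Fin a)) (τ : Equiv.Perm (Fin b)) (i : Fin b) :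
    blockPerm σ τ (Fin.natAdd a i) = Fin.natAdd a (τ i) := by
  simp [blockPerm, Equiv.permCongr_apply]

lemma koszulSign_blockPerm {a b : ℕ} (σ : Equiv.Perm (Fin a)) (τ : Equiv.Perm (Fin b))
    (p : Fin (a + b) → ZMod 2) :
    koszulSign (blockPerm σ τ) p =
      koszulSign σ (fun i => p (Fin.castAdd b i)) * koszulSign τ (fun i => p (Fin.natAdd a i)) := by
  have h1 : ∀ (i : Fin a) (j : Fin b), ¬ Fin.natAdd a j < Fin.castAdd b i := fun i j => by
    simp only [Fin.lt_def, Fin.val_natAdd, Fin.val_castAdd]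
    omega
  have h2 : ∀ i j : Fin a, Fin.castAdd b i < Fin.castAdd b j ↔ i < j := fun i j => by
    simp only [Fin.lt_def, Fin.val_castAdd]
  have h3 : ∀ i j : Fin b, Fin.natAdd a i < Fin.natAdd a j ↔ i < j := fun i j => by
    simp only [Fin.lt_def, Fin.val_natAdd]
    omega
  simp only [koszulSign, Fin.prod_univ_add, blockPerm_castAdd, blockPerm_natAdd, h1, h2, h3,
    false_and, and_false, if_false, Finset.prod_const_one, mul_one, one_mul]

lemma mulEquiv_symm_tprod {M : Type*} [AddCommGroup M] [Module k M] {a b : ℕ}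
    (w : Fin (a + b) → M) :
    (TensorPower.mulEquiv (R := k) (M := M)).symm (PiTensorProduct.tprod k w) =
      PiTensorProduct.tprod k (fun i => w (Fin.castAdd b i)) ⊗ₜ[k]
        PiTensorProduct.tprod k (fun i => w (Fin.natAdd a i)) := by
  rw [LinearEquiv.symm_apply_eq]
  simp only [TensorPower.mulEquiv, LinearEquiv.trans_apply, PiTensorProduct.tmulEquiv_apply]
  rw [PiTensorProduct.reindex_tprod]
  congr 1
  funext i
  refine Fin.addCases (fun i => ?_) (fun i => ?_) i <;> simp

lemma map_act_mulEquiv_symm {a b : ℕ} (σ : Equiv.Perm (Fin a)) (τ : Equiv.Perm (Fin b))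
    (x : TPow V (a + b)) :
    TensorProduct.map (act V σ) (act V τ)
        ((TensorPower.mulEquiv (R := k) (M := Tot V)).symm x) =
      (TensorPower.mulEquiv (R := k) (M := Tot V)).symm (act V (blockPerm σ τ) x) := by
  suffices h : TensorProduct.map (act V σ) (act V τ) ∘ₗ
      (TensorPower.mulEquiv (R := k) (M := Tot V)).symm.toLinearMap =
      (TensorPower.mulEquiv (R := k) (M := Tot V)).symm.toLinearMap ∘ₗ
        act V (blockPerm σ τ) from LinearMap.congr_fun h x
  refine tpow_ext V (M := TPow V a ⊗[k] TPow V b) fun p w hw => ?_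
  simp only [LinearMap.comp_apply, LinearEquiv.coe_coe]
  rw [act_tprod V _ p w hw, map_smul, mulEquiv_symm_tprod, mulEquiv_symm_tprod,
    TensorProduct.map_tmul, act_tprod V σ _ _ fun i => hw (Fin.castAdd b i),
    act_tprod V τ _ _ fun i => hw (Fin.natAdd a i), koszulSign_blockPerm,
    TensorProduct.smul_tmul_smul]
  simp only [blockPerm_castAdd, blockPerm_natAdd]
  push_cast
  rfl

/-- The coproduct of a symmetric tensor is its deconcatenation. -/
lemma map_subtype_symComul [CharZero k] (a b n : ℕ) (h : n = a + b) (x : symPow V n) :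
    TensorProduct.map (symPow V a).subtype (symPow V b).subtype (symComul V a b n h x) =
      TensorPower.mulEquiv.symm (TensorPower.cast k (Tot V) h x.1) := by
  subst h
  have hx := x.2
  have hP : ∀ m, (symPow V m).subtype ∘ₗ symProj V m =
      (m.factorial : k)⁻¹ • ∑ σ : Equiv.Perm (Fin m), act V σ := fun m =>
    LinearMap.subtype_comp_codRestrict _ _ _
  have hf : ∀ m : ℕ, (m.factorial : k) ≠ 0 := fun m => Nat.cast_ne_zero.mpr m.factorial_ne_zero
  simp only [symComul, LinearMap.comp_apply, LinearEquiv.coe_coe, TensorPower.cast_refl,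
    LinearEquiv.refl_apply, Submodule.subtype_apply]
  rw [← LinearMap.comp_apply, ← TensorProduct.map_comp, hP, hP, TensorProduct.map_smul_left,
    TensorProduct.map_smul_right, LinearMap.smul_apply, LinearMap.smul_apply]
  have hs : TensorProduct.map (∑ σ : Equiv.Perm (Fin a), act V σ)
      (∑ τ : Equiv.Perm (Fin b), act V τ) (TensorPower.mulEquiv.symm x.1) =
      ∑ _τ : Equiv.Perm (Fin b), ∑ _σ : Equiv.Perm (Fin a),
        (TensorPower.mulEquiv (R := k) (M := Tot V)).symm x.1 := by
    rw [← TensorProduct.mapBilinear_apply, map_sum, LinearMap.sum_apply]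
    refine Finset.sum_congr rfl fun τ _ => ?_
    rw [map_sum, LinearMap.sum_apply, LinearMap.sum_apply]
    refine Finset.sum_congr rfl fun σ _ => ?_
    rw [TensorProduct.mapBilinear_apply, map_act_mulEquiv_symm, hx]
  rw [hs]
  simp only [Finset.sum_const, Finset.card_univ, Fintype.card_perm, Fintype.card_fin,
    ← Nat.cast_smul_eq_nsmul k, smul_smul]
  rw [show ((a.factorial : k)⁻¹ * ((b.factorial : k)⁻¹ * ((b.factorial : k) * (a.factorial : k))))
    = 1 by field_simp [hf a, hf b], one_smul]

/-- The coaugmentation coideal `⨁_{n ≥ 1} Sym^n(V)` of the symmetric coalgebra `Sym_c^*(V)`. -/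
abbrev SymBar : Type (max u v) := ⨁ n : ℕ, symPow V (n + 1)

/-- The differential of the symmetric coalgebra. -/
def symBarD : SymBar V →ₗ[k] SymBar V := DirectSum.lmap fun n => symD V (n + 1)

/-- The sign operator `c ↦ (-1)^(deg c) c` of the symmetric coalgebra. -/
def symBarSign : SymBar V →ₗ[k] SymBar V := DirectSum.lmap fun n => symSign V (n + 1)

/-- The reduced coproduct of the symmetric coalgebra: on `Sym^{n+1}(V)` the sum of the components
in `Sym^{i+1}(V) ⊗ Sym^{n-i}(V)` for `0 ≤ i < n`. -/
def symBarComul : SymBar V →ₗ[k] SymBar V ⊗[k] SymBar V :=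
  DirectSum.toModule k ℕ _ fun n => ∑ i : Fin n,
    TensorProduct.map (DirectSum.lof k ℕ (fun m => symPow V (m + 1)) i)
      (DirectSum.lof k ℕ (fun m => symPow V (m + 1)) (n - 1 - i)) ∘ₗ
        symComul V (i + 1) (n - 1 - i + 1) (n + 1) (by omega)

/-- The elements of degree `p` of the coideal. -/
def symBarDeg (p : ℤ) : Submodule k (SymBar V) :=
  ⨅ n : ℕ, (tpowDeg V (n + 1) p).comap
    ((symPow V (n + 1)).subtype ∘ₗ DirectSum.component k ℕ (fun m => symPow V (m + 1)) n)

variable {V W} in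
/-- The map of coideals induced by a morphism of complexes. -/
def symBarMap (f : V ⟶ W) : SymBar V →ₗ[k] SymBar W := DirectSum.lmap fun n => symMap f (n + 1)

end Symmetric

/-! ### The reduced cobar construction -/

section Cobar

variable {k : Type u} [Field k] {C : Type v} [AddCommMonoid C] [Module k C]

/-- The differential of the reduced cobar construction `Ω(C) = T(s⁻¹ C)` on the generators.
Here `C` is the coaugmentation coideal, with sign operator `ε`, differential `d` and reduced
coproduct `Δ`; the generator `s⁻¹ c` is `TensorAlgebra.ι k c`. The formula is
`s⁻¹ c ↦ - s⁻¹ (d c) + ∑ (-1)^(deg c') s⁻¹ c' ⊗ s⁻¹ c''` where `Δ c = ∑ c' ⊗ c''`. -/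
def cobarGen (ε d : C →ₗ[k] C) (Δ : C →ₗ[k] C ⊗[k] C) : C →ₗ[k] TensorAlgebra k C :=
  LinearMap.mul' k (TensorAlgebra k C) ∘ₗ
      TensorProduct.map (TensorAlgebra.ι k ∘ₗ ε) (TensorAlgebra.ι k) ∘ₗ Δ -
    TensorAlgebra.ι k ∘ₗ d

/-- The sign operator of `Ω(C)`: the algebra map with `s⁻¹ c ↦ (-1)^(deg c + 1) s⁻¹ c`. -/
def cobarSign (ε : C →ₗ[k] C) : TensorAlgebra k C →ₐ[k] TensorAlgebra k C :=
  TensorAlgebra.lift k (-(TensorAlgebra.ι k ∘ₗ ε))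

/-- The algebra map `x ↦ !![± x, δ x; 0, x]` whose corner is the differential `δ`. -/
def cobarMatrix (ε d : C →ₗ[k] C) (Δ : C →ₗ[k] C ⊗[k] C) :
    TensorAlgebra k C →ₐ[k] Matrix (Fin 2) (Fin 2) (TensorAlgebra k C) :=
  TensorAlgebra.lift k
    { toFun := fun c => !![-TensorAlgebra.ι k (ε c), cobarGen ε d Δ c; 0, TensorAlgebra.ι k c]
      map_add' := fun x y => by
        ext i j
        fin_cases i <;> fin_cases j <;> simp [add_comm]
      map_smul' := fun r x => by
        ext i j
        fin_cases i <;> fin_cases j <;> simp }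

/-- The differential of the reduced cobar construction: the graded derivation which extends
`cobarGen`, see `cobarD_ι` and `cobarD_mul`. -/
def cobarD (ε d : C →ₗ[k] C) (Δ : C →ₗ[k] C ⊗[k] C) : TensorAlgebra k C →ₗ[k] TensorAlgebra k C :=
  Matrix.entryLinearMap k (TensorAlgebra k C) (0 : Fin 2) (1 : Fin 2) ∘ₗ
    (cobarMatrix ε d Δ).toLinearMap

lemma cobarD_ι (ε d : C →ₗ[k] C) (Δ : C →ₗ[k] C ⊗[k] C) (c : C) :
    cobarD ε d Δ (TensorAlgebra.ι k c) = cobarGen ε d Δ c := by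
  simp [cobarD, cobarMatrix]

lemma cobarMatrix_diag (ε d : C →ₗ[k] C) (Δ : C →ₗ[k] C ⊗[k] C) (x : TensorAlgebra k C) :
    cobarMatrix ε d Δ x 0 0 = cobarSign ε x ∧ cobarMatrix ε d Δ x 1 0 = 0 ∧
      cobarMatrix ε d Δ x 1 1 = x := by
  induction x using TensorAlgebra.induction with
  | algebraMap r => simp [Matrix.algebraMap_matrix_apply]
  | ι c => simp [cobarMatrix, cobarSign]
  | mul x y hx hy => simp [Matrix.mul_apply, Fin.sum_univ_two, hx, hy]
  | add x y hx hy => simp [hx, hy]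

/-- The graded Leibniz rule. -/
lemma cobarD_mul (ε d : C →ₗ[k] C) (Δ : C →ₗ[k] C ⊗[k] C) (x y : TensorAlgebra k C) :
    cobarD ε d Δ (x * y) = cobarD ε d Δ x * y + cobarSign ε x * cobarD ε d Δ y := by
  simp [cobarD, Matrix.mul_apply, Fin.sum_univ_two, cobarMatrix_diag, add_comm]

/-- The elements of degree `p` of `Ω(C)`: the span of the products `s⁻¹ c_1 ... s⁻¹ c_r` with
`c_i` of degree `q_i` in `C`, hence `s⁻¹ c_i` of degree `q_i + 1`, and `∑ (q_i + 1) = p`. -/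
def cobarDeg (deg : ℤ → Submodule k C) (p : ℤ) : Submodule k (TensorAlgebra k C) :=
  Submodule.span k {x | ∃ (r : ℕ) (q : Fin r → ℤ) (c : Fin r → C),
    (∀ i, c i ∈ deg (q i)) ∧ ∑ i, (q i + 1) = p ∧
      x = (List.ofFn fun i => TensorAlgebra.ι k (c i)).prod}

/-- The map of cobar constructions induced by a linear map. -/
def cobarMap {C' : Type v} [AddCommMonoid C'] [Module k C'] (f : C →ₗ[k] C') :
    TensorAlgebra k C →ₗ[k] TensorAlgebra k C' :=
  (TensorAlgebra.lift k (TensorAlgebra.ι k ∘ₗ f)).toLinearMap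

end Cobar

/-! ### The complex `Ω Sym_c^*(sV)` -/

section CobarSym

variable {k : Type u} [Field k] (V W : CochainComplex (ModuleCat.{v} k) ℤ)

/-- The suspension: `(sV)^p = V^{p+1}` with differential `-d`. -/
abbrev susp : CochainComplex (ModuleCat.{v} k) ℤ := V⟦(1 : ℤ)⟧

/-- The vector space `Ω Sym_c^*(sV)`. -/
abbrev CobarSym : Type (max u v) := TensorAlgebra k (SymBar (susp V))

/-- The differential of `Ω Sym_c^*(sV)`. -/
def cobarSymD : CobarSym V →ₗ[k] CobarSym V :=
  cobarD (symBarSign (susp V)) (symBarD (susp V)) (symBarComul (susp V))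

/-- The elements of degree `p` of `Ω Sym_c^*(sV)`. -/
def cobarSymDeg (p : ℤ) : Submodule k (CobarSym V) := cobarDeg (symBarDeg (susp V)) p

variable {V W} in
/-- The map `Ω Sym_c^*(sV) → Ω Sym_c^*(sW)` induced by a morphism of complexes. -/
def cobarSymMap (f : V ⟶ W) : CobarSym V →ₗ[k] CobarSym W :=
  cobarMap (symBarMap (f⟦(1 : ℤ)⟧'))

end CobarSym

/-! ### Standard tableaux -/

/-- A standard tableau of shape `μ`: a bijection from the cells to `{1, ..., n}` (represented by
`Fin n`, so that the entry `i : Fin n` stands for `i + 1`) which increases along the rows and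
down the columns. The cell `(r, c)` lies in row `r` (counted downwards) and column `c`. -/
structure StdTableau (μ : YoungDiagram) where
  /-- the entries -/
  entry : {c : ℕ × ℕ // c ∈ μ} ≃ Fin μ.card
  row_lt : ∀ x y, x.1.1 = y.1.1 → x.1.2 < y.1.2 → entry x < entry y
  col_lt : ∀ x y, x.1.2 = y.1.2 → x.1.1 < y.1.1 → entry x < entry y

namespace StdTableau

variable {μ : YoungDiagram} (T : StdTableau μ)

/-- The row of the entry `i`. -/
def row (i : Fin μ.card) : ℕ := (T.entry.symm i).1.1

/-- The column of the entry `i`. -/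
def col (i : Fin μ.card) : ℕ := (T.entry.symm i).1.2

/-- `J_T`: the entries `i` such that `i + 1` is an entry and lies in a lower row. -/
def descents : Finset (Fin μ.card) :=
  Finset.univ.filter fun i => ∃ h : i.val + 1 < μ.card, T.row i < T.row ⟨i.val + 1, h⟩

/-- The map `ζ_J`, with values in `{1, ..., n - #J}`: it is weakly increasing, increases by at most
`1` at each step, and identifies `i` with `i + 1` exactly for `i ∈ J`. -/
def zeta {n : ℕ} (J : Finset (Fin n)) (i : Fin n) : ℕ :=
  i.val + 1 - (J.filter fun j => j < i).card

/-- The column-semistandard tableau `T_J = ζ_J ∘ T`. -/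
def fill (J : Finset (Fin μ.card)) (x : {c : ℕ × ℕ // c ∈ μ}) : ℕ := zeta J (T.entry x)

/-- The basis of `C_T`: the tableaux `T_J` with `J ⊆ J_T`, represented by the sets `J`
(`T_J` determines `J`, see `fill_injective`). -/
abbrev Index : Type := {J : Finset (Fin μ.card) // J ⊆ T.descents}

lemma zeta_succ {n : ℕ} (J : Finset (Fin n)) (i : Fin n) (h : i.val + 1 < n) :
    zeta J ⟨i.val + 1, h⟩ = if i ∈ J then zeta J i else zeta J i + 1 := by
  have hle : (J.filter fun j => j < i).card ≤ i.val := by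
    calc (J.filter fun j => j < i).card ≤ (Finset.Iio i).card :=
          Finset.card_le_card fun j hj => by simpa using (Finset.mem_filter.mp hj).2
      _ = i.val := by simp
  have hlt : ∀ j : Fin n, j < (⟨i.val + 1, h⟩ : Fin n) ↔ j < i ∨ j = i := fun j => by
    simp only [Fin.lt_def, Fin.ext_iff]
    omega
  by_cases hi : i ∈ J
  · have : (J.filter fun j => j < (⟨i.val + 1, h⟩ : Fin n)) =
        insert i (J.filter fun j => j < i) := by
      ext j
      simp only [Finset.mem_filter, Finset.mem_insert, hlt]
      constructor
      · rintro ⟨h1, h2 | h2⟩ <;> tauto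
      · rintro (rfl | h1) <;> tauto
    simp only [zeta, this, if_pos hi]
    rw [Finset.card_insert_of_notMem (by simp)]
    omega
  · have : (J.filter fun j => j < (⟨i.val + 1, h⟩ : Fin n)) = J.filter fun j => j < i := by
      ext j
      simp only [Finset.mem_filter, hlt]
      constructor
      · rintro ⟨h1, h2 | rfl⟩ <;> tauto
      · tauto
    simp only [zeta, this, if_neg hi]
    omega

lemma fill_injective : Function.Injective fun J : T.Index => T.fill J.1 := by
  have key : ∀ (J : T.Index) (i : Fin μ.card) (h : i.val + 1 < μ.card),
      i ∈ J.1 ↔ T.fill J.1 (T.entry.symm ⟨i.val + 1, h⟩) = T.fill J.1 (T.entry.symm i) := by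
    intro J i h
    simp only [fill, Equiv.apply_symm_apply, zeta_succ]
    split_ifs with hi <;> simp [hi]
  have hlast : ∀ (J : T.Index) (i : Fin μ.card), i ∈ J.1 → i.val + 1 < μ.card := fun J i hi => by
    have := J.2 hi
    simp only [descents, Finset.mem_filter] at this
    exact this.2.1
  intro J J' h
  refine Subtype.ext (Finset.ext fun i => ?_)
  dsimp only at h
  constructor
  · intro hi
    have h' := hlast J i hi
    rw [key J' i h', ← h, ← key J i h']
    exact hi
  · intro hi
    have h' := hlast J' i hi
    rw [key J i h', h, ← key J' i h']
    exact hi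

end StdTableau

/-! ### The combinatorial complex `C_T` -/

section Comb

variable (k : Type u) [Field k] {μ : YoungDiagram} (T : StdTableau μ)

/-- The vector space `C_T` with basis the `T_J`, `J ⊆ J_T`. -/
abbrev Comb : Type u := T.Index →₀ k

/-- The basis vector `T_J`. -/
def combBasis (J : T.Index) : Comb k T := Finsupp.single J 1

/-- The differential of `C_T`:
`T_J ↦ ∑_{j ∈ J} (-1)^#{i | i < j, i ∉ J} T_{J \ j}`. -/
def combD : Comb k T →ₗ[k] Comb k T :=
  Finsupp.linearCombination k fun J : T.Index => ∑ j ∈ J.1,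
    (-1 : k) ^ (Finset.univ.filter fun i => i < j ∧ i ∉ J.1).card •
      combBasis k T ⟨J.1.erase j, (Finset.erase_subset j J.1).trans J.2⟩

/-- The sign operator of `C_T`, where `T_J` has degree `- #J`. -/
def combSign : Comb k T →ₗ[k] Comb k T :=
  Finsupp.linearCombination k fun J : T.Index => (-1 : k) ^ J.1.card • combBasis k T J

end Comb

/-! ### Schur complexes -/

section Schur

variable {k : Type u} [Field k] (V W : CochainComplex (ModuleCat.{v} k) ℤ)

/-- The right action of the group algebra `k[Σ_n]` on `V^{⊗n}` which comes from the graded action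
on `(sV)^{⊗n}` through the identification `V^{⊗n} ≅ (sV)^{⊗n}`,
`v_1 ⊗ ... ⊗ v_n ↦ ± sv_1 ⊗ ... ⊗ sv_n`: a permutation `σ` acts by the graded action on `V^{⊗n}`
times the sign of `σ`. -/
def algAct {n : ℕ} (a : MonoidAlgebra k (Equiv.Perm (Fin n))) : TPow V n →ₗ[k] TPow V n :=
  ∑ σ : Equiv.Perm (Fin n), (a.coeff σ * ((Equiv.Perm.sign σ : ℤ) : k)) • act V σ

lemma tpowD_comp_algAct {n : ℕ} (a : MonoidAlgebra k (Equiv.Perm (Fin n))) :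
    tpowD V n ∘ₗ algAct V a = algAct V a ∘ₗ tpowD V n := by
  refine LinearMap.ext fun x => ?_
  simp only [algAct, LinearMap.comp_apply, LinearMap.sum_apply, LinearMap.smul_apply, map_sum,
    map_smul]
  exact Finset.sum_congr rfl fun σ _ => congrArg _ (LinearMap.congr_fun (tpowD_comp_act V σ) x)

variable {V W} in
lemma tpowMap_comp_algAct (f : V ⟶ W) {n : ℕ} (a : MonoidAlgebra k (Equiv.Perm (Fin n))) :
    tpowMap f n ∘ₗ algAct V a = algAct W a ∘ₗ tpowMap f n := by
  refine LinearMap.ext fun x => ?_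
  simp only [algAct, LinearMap.comp_apply, LinearMap.sum_apply, LinearMap.smul_apply, map_sum,
    map_smul]
  exact Finset.sum_congr rfl fun σ _ =>
    congrArg _ (LinearMap.congr_fun (map_comp_act (parityProj_totMap f) σ) x)

variable {μ : YoungDiagram} (T : StdTableau μ)

variable (k) in
/-- `c_T`: the sum of the permutations which preserve the columns of `T`. -/
def colSum : MonoidAlgebra k (Equiv.Perm (Fin μ.card)) :=
  ∑ σ ∈ Finset.univ.filter fun σ : Equiv.Perm (Fin μ.card) => ∀ i, T.col (σ i) = T.col i,
    MonoidAlgebra.single σ 1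

variable (k) in
/-- `r_T^-`: the alternating sum of the permutations which preserve the rows of `T`. -/
def rowAlt : MonoidAlgebra k (Equiv.Perm (Fin μ.card)) :=
  ∑ σ ∈ Finset.univ.filter fun σ : Equiv.Perm (Fin μ.card) => ∀ i, T.row (σ i) = T.row i,
    MonoidAlgebra.single σ ((Equiv.Perm.sign σ : ℤ) : k)

variable (k) in
/-- `e_T = c_T r_T^-`. -/
def youngElt : MonoidAlgebra k (Equiv.Perm (Fin μ.card)) := colSum k T * rowAlt k T

/-- The Schur complex `S^T(V) = V^{⊗n} e_T`. -/
def schur : Submodule k (TPow V μ.card) := LinearMap.range (algAct V (youngElt k T))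

/-- The differential of the Schur complex, restricted from `V^{⊗n}`. -/
def schurD : schur V T →ₗ[k] schur V T :=
  (tpowD V μ.card).restrict fun x hx => by
    obtain ⟨y, rfl⟩ := hx
    rw [← LinearMap.comp_apply, tpowD_comp_algAct]
    exact ⟨_, rfl⟩

/-- The elements of degree `p` of the Schur complex. -/
def schurDeg (p : ℤ) : Submodule k (schur V T) := (tpowDeg V μ.card p).comap (schur V T).subtype

variable {V W} in
/-- The map of Schur complexes induced by a morphism of complexes. -/
def schurMap (f : V ⟶ W) : schur V T →ₗ[k] schur W T :=
  (tpowMap f μ.card).restrict fun x hx => by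
    obtain ⟨y, rfl⟩ := hx
    rw [← LinearMap.comp_apply, tpowMap_comp_algAct]
    exact ⟨_, rfl⟩

/-- The vector space `C_T ⊗ S^T(V)`. -/
abbrev Summand : Type (max u v) := Comb k T ⊗[k] schur V T

/-- The differential of the tensor product of complexes `C_T ⊗ S^T(V)`. -/
def summandD : Summand V T →ₗ[k] Summand V T :=
  TensorProduct.map (combD k T) LinearMap.id + TensorProduct.map (combSign k T) (schurD V T)

/-- The elements of degree `p` of `C_T ⊗ S^T(V)`, where `T_J` has degree `- #J`. -/
def summandDeg (p : ℤ) : Submodule k (Summand V T) :=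
  Submodule.span k {x | ∃ (J : T.Index) (q : ℤ) (u : schur V T),
    u ∈ schurDeg V T q ∧ -(J.1.card : ℤ) + q = p ∧ x = combBasis k T J ⊗ₜ[k] u}

variable {V W} in
/-- The map `C_T ⊗ S^T(V) → C_T ⊗ S^T(W)` induced by a morphism of complexes. -/
def summandMap (f : V ⟶ W) : Summand V T →ₗ[k] Summand W T :=
  TensorProduct.map LinearMap.id (schurMap T f)

end Schur

/-! ### The sum over all standard tableaux -/

section Sum

variable {k : Type u} [Field k] (V W : CochainComplex (ModuleCat.{v} k) ℤ)

/-- The nonempty Young diagrams, i.e. the partitions of all `n ≥ 1`. -/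
abbrev Shape : Type := {μ : YoungDiagram // μ ≠ ⊥}

/-- The vector space `k ⊕ ⨁_λ ⨁_T C_T ⊗ S^T(V)`. -/
abbrev TableauSum : Type (max u v) := k × ⨁ μ : Shape, ⨁ T : StdTableau μ.1, Summand V T

/-- The differential of the sum, where `k` has differential zero. -/
def tableauSumD : TableauSum V →ₗ[k] TableauSum V :=
  LinearMap.prodMap 0 (DirectSum.lmap fun μ : Shape =>
    DirectSum.lmap fun T : StdTableau μ.1 => summandD V T)

/-- The elements of degree `p` of the sum, where `k` has degree zero. -/
def tableauSumDeg (p : ℤ) : Submodule k (TableauSum V) :=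
  (if p = 0 then ⊤ else ⊥ : Submodule k k).prod
    (⨅ (μ : Shape) (T : StdTableau μ.1), (summandDeg V T p).comap
      (DirectSum.component k (StdTableau μ.1) (fun T => Summand V T) T ∘ₗ
        DirectSum.component k Shape (fun μ => ⨁ T : StdTableau μ.1, Summand V T) μ))

variable {V W} in
/-- The map of sums induced by a morphism of complexes (the identity on `k`). -/
def tableauSumMap (f : V ⟶ W) : TableauSum V →ₗ[k] TableauSum W :=
  LinearMap.prodMap LinearMap.id (DirectSum.lmap fun μ : Shape =>
    DirectSum.lmap fun T : StdTableau μ.1 => summandMap T f)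

end Sum

end TableauDecomposition

end

open TableauDecomposition

/-! Both sides embed, naturally in `V`, in one auxiliary complex, the `Model`. It has a copy of
`V^{⊗n}` for each `n` and each finite set `J` of natural numbers, shifted by `-#J`. Its differential
is the tensor differential plus the signed sum of the maps that remove one element from `J`.

Cobar side. A product of generators from `Sym^{p_1+1}(sV), ..., Sym^{p_r+1}(sV)` gives a composition
of `n = ∑ (p_i + 1)`. Equivalently, it gives the set `J ⊆ {0, ..., n-2}` of the `j` for which the
positions `j` and `j + 1` lie in the same block. Desuspension turns graded symmetric tensors into
tensors fixed by the signed action on `V^{⊗n}`. The reduced coproduct cuts a block in two, that is,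
it removes an element from `J`. So the cobar construction becomes the subcomplex whose `(n, J)` part
consists of the tensors fixed by the signed transpositions of `j` and `j + 1` for `j ∈ J`
(`modelD_toModel`, `fromModel_toModel`, `toModel_mem_wordPart`, `inModel_mem_range`).

Tableau side. `T_J ⊗ x` goes to `x c_T h_T` in the copy indexed by `J`, where `h_T` is the sum of
the permutations preserving the descent blocks of `T`. What remains is a statement on group
algebras: `k[Σ_n]` is the direct sum of the `k[Σ_n] e_T c_T h_T`, and an element is fixed on the
right by the transposition `s_j` of `j` and `j + 1` exactly if its components sit at tableaux with
descent `j`. Hence the tensors invariant for `J` are the sum over the `T` with `J ⊆ J_T`, and these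
pairs `(T, J)` are the basis elements of the `C_T`.

Group algebra. In a relation `∑ x_T c_T h_T = 0`, left multiplication by `e_S z` kills all shapes
but that of `S` and leaves a relation between the vectors `r_S c_S π h_T`. These are independent by
a triangularity argument (`weight_minimal`, `blockVector_independent`). Independence also bounds
`dim k[Σ_n] e_S` below by the number of standard tableaux of the shape of `S`. There are `n!` pairs
of standard tableaux of equal shape (`sum_count_shape`), so dimensions force a bijection
(`assemble_bijective`). For `s_j`, reflecting tableaux at the diagonal exchanges descents and
non-descents, so the tableaux with descent `j` account for at least `n!/2` dimensions. The
invariants of `s_j` have dimension at most `n!/2`, because the sign twist moves them to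
anti-invariants (`exists_assemble_eq`).

The component of `1` at `T`, called `coblock`, then recovers the coefficients of the tableau sum
from the model and shows that the two images agree. Signs, degrees and naturality are all checked in
the model. -/

noncomputable section

namespace TableauDecomposition

/-! ### Symmetrizers and antisymmetrizers in the group algebra of `Σ_n` -/

section GroupAlgebra

open MonoidAlgebra

variable (k : Type u) [Field k] {n : ℕ}

/-- The group algebra of the symmetric group. -/
abbrev SymAlg (n : ℕ) : Type u := MonoidAlgebra k (Equiv.Perm (Fin n))

/-- A permutation as an element of the group algebra. -/
abbrev perm (σ : Equiv.Perm (Fin n)) : SymAlg k n := single σ 1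

/-- The sign of a permutation as an element of `k`. -/
abbrev sgn (σ : Equiv.Perm (Fin n)) : k := ((Equiv.Perm.sign σ : ℤ) : k)

/-- The permutations which preserve the fibres of `f`. -/
def fibrePerms (f : Fin n → ℕ) : Finset (Equiv.Perm (Fin n)) :=
  Finset.univ.filter fun σ => ∀ i, f (σ i) = f i

/-- The sum of the permutations which preserve the fibres of `f`. -/
def symSum (f : Fin n → ℕ) : SymAlg k n := ∑ σ ∈ fibrePerms f, single σ 1

/-- The alternating sum of the permutations which preserve the fibres of `f`. -/
def altSum (f : Fin n → ℕ) : SymAlg k n := ∑ σ ∈ fibrePerms f, single σ (sgn k σ)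

variable {k}

lemma mem_fibrePerms {f : Fin n → ℕ} {σ : Equiv.Perm (Fin n)} :
    σ ∈ fibrePerms f ↔ ∀ i, f (σ i) = f i := by simp [fibrePerms]

lemma one_mem_fibrePerms (f : Fin n → ℕ) : 1 ∈ fibrePerms f := by simp [mem_fibrePerms]

lemma mul_mem_fibrePerms {f : Fin n → ℕ} {σ τ : Equiv.Perm (Fin n)} (hσ : σ ∈ fibrePerms f)
    (hτ : τ ∈ fibrePerms f) : σ * τ ∈ fibrePerms f := by
  rw [mem_fibrePerms] at *
  intro i
  rw [Equiv.Perm.mul_apply, hσ, hτ]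

lemma inv_mem_fibrePerms {f : Fin n → ℕ} {σ : Equiv.Perm (Fin n)} (hσ : σ ∈ fibrePerms f) :
    σ⁻¹ ∈ fibrePerms f := by
  rw [mem_fibrePerms] at *
  intro i
  rw [← hσ (σ⁻¹ i)]
  simp

lemma swap_mem_fibrePerms {f : Fin n → ℕ} {i j : Fin n} (h : f i = f j) :
    Equiv.swap i j ∈ fibrePerms f := by
  rw [mem_fibrePerms]
  intro l
  by_cases h1 : l = i
  · subst h1; simp [h]
  by_cases h2 : l = j
  · subst h2; simp [h]
  rw [Equiv.swap_apply_of_ne_of_ne h1 h2]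

lemma sgn_mul (σ τ : Equiv.Perm (Fin n)) : sgn k (σ * τ) = sgn k σ * sgn k τ := by
  simp [sgn]

lemma sgn_mul_self (σ : Equiv.Perm (Fin n)) : sgn k σ * sgn k σ = 1 := by
  rw [← Int.cast_mul, ← Units.val_mul, Int.units_mul_self]
  simp

lemma sgn_inv (σ : Equiv.Perm (Fin n)) : sgn k σ⁻¹ = sgn k σ := by simp [sgn]

lemma perm_mul_perm (σ τ : Equiv.Perm (Fin n)) : perm k σ * perm k τ = perm k (σ * τ) := by
  simp [perm, single_mul_single]

lemma sum_fibrePerms_mul_left {M : Type*} [AddCommMonoid M] {f : Fin n → ℕ}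
    {σ : Equiv.Perm (Fin n)} (hσ : σ ∈ fibrePerms f) (F : Equiv.Perm (Fin n) → M) :
    ∑ τ ∈ fibrePerms f, F (σ * τ) = ∑ τ ∈ fibrePerms f, F τ := by
  refine Finset.sum_bij' (fun τ _ => σ * τ) (fun τ _ => σ⁻¹ * τ)
    (fun τ hτ => mul_mem_fibrePerms hσ hτ)
    (fun τ hτ => mul_mem_fibrePerms (inv_mem_fibrePerms hσ) hτ) ?_ ?_ ?_ <;> simp

lemma sum_fibrePerms_mul_right {M : Type*} [AddCommMonoid M] {f : Fin n → ℕ}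
    {σ : Equiv.Perm (Fin n)} (hσ : σ ∈ fibrePerms f) (F : Equiv.Perm (Fin n) → M) :
    ∑ τ ∈ fibrePerms f, F (τ * σ) = ∑ τ ∈ fibrePerms f, F τ := by
  refine Finset.sum_bij' (fun τ _ => τ * σ) (fun τ _ => τ * σ⁻¹)
    (fun τ hτ => mul_mem_fibrePerms hτ hσ)
    (fun τ hτ => mul_mem_fibrePerms hτ (inv_mem_fibrePerms hσ)) ?_ ?_ ?_ <;> simp

lemma sum_fibrePerms_inv {M : Type*} [AddCommMonoid M] {f : Fin n → ℕ}
    (F : Equiv.Perm (Fin n) → M) :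
    ∑ τ ∈ fibrePerms f, F τ⁻¹ = ∑ τ ∈ fibrePerms f, F τ := by
  refine Finset.sum_bij' (fun τ _ => τ⁻¹) (fun τ _ => τ⁻¹)
    (fun τ hτ => inv_mem_fibrePerms hτ) (fun τ hτ => inv_mem_fibrePerms hτ) ?_ ?_ ?_ <;> simp

lemma symSum_mul_perm {f : Fin n → ℕ} {σ : Equiv.Perm (Fin n)} (hσ : σ ∈ fibrePerms f) :
    symSum k f * perm k σ = symSum k f := by
  simp only [symSum, Finset.sum_mul, perm_mul_perm]
  exact sum_fibrePerms_mul_right hσ fun τ => perm k τ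

lemma perm_mul_altSum {f : Fin n → ℕ} {σ : Equiv.Perm (Fin n)} (hσ : σ ∈ fibrePerms f) :
    perm k σ * altSum k f = sgn k σ • altSum k f := by
  simp only [altSum, Finset.mul_sum, Finset.smul_sum]
  rw [← sum_fibrePerms_mul_left hσ fun τ => sgn k σ • (single τ (sgn k τ) : SymAlg k n)]
  refine Finset.sum_congr rfl fun τ _ => ?_
  rw [single_mul_single, smul_single, sgn_mul, smul_eq_mul, ← mul_assoc, sgn_mul_self]

/-- Conjugation by `π` carries the group of `f ∘ π` to that of `f`. With `π = move S T` this moves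
row and column sums between tableaux of equal shape. -/
lemma sum_fibrePerms_conj {M : Type*} [AddCommMonoid M] (f : Fin n → ℕ)
    (π : Equiv.Perm (Fin n)) (F : Equiv.Perm (Fin n) → M) :
    ∑ τ ∈ fibrePerms (f ∘ π), F (π * τ * π⁻¹) = ∑ τ ∈ fibrePerms f, F τ := by
  refine Finset.sum_bij' (fun τ _ => π * τ * π⁻¹) (fun τ _ => π⁻¹ * τ * π)
    (fun τ hτ => ?_) (fun τ hτ => ?_) ?_ ?_ ?_
  · rw [mem_fibrePerms] at *
    intro i
    simpa using hτ (π⁻¹ i)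
  · rw [mem_fibrePerms] at *
    intro i
    simpa using hτ (π i)
  all_goals simp [mul_assoc]

lemma perm_mul_symSum_comp (f : Fin n → ℕ) (π : Equiv.Perm (Fin n)) :
    perm k π * symSum k (f ∘ π) = symSum k f * perm k π := by
  simp only [symSum, Finset.mul_sum, Finset.sum_mul]
  rw [← sum_fibrePerms_conj f π]
  exact Finset.sum_congr rfl fun τ _ => by simp [single_mul_single]

lemma perm_mul_altSum_comp (f : Fin n → ℕ) (π : Equiv.Perm (Fin n)) :
    perm k π * altSum k (f ∘ π) = altSum k f * perm k π := by
  simp only [altSum, Finset.mul_sum, Finset.sum_mul]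
  rw [← sum_fibrePerms_conj f π]
  refine Finset.sum_congr rfl fun τ _ => ?_
  rw [single_mul_single, single_mul_single, sgn_mul, sgn_mul, sgn_inv, mul_right_comm (sgn k π),
    sgn_mul_self]
  simp

lemma span_perm : Submodule.span k (Set.range (perm k (n := n))) = ⊤ := by
  rw [eq_top_iff]
  rintro x -
  induction x using MonoidAlgebra.induction_linear with
  | zero => exact zero_mem _
  | add x y hx hy => exact add_mem hx hy
  | single σ r =>
    have : (single σ r : SymAlg k n) = r • perm k σ := by simp
    rw [this]
    exact Submodule.smul_mem _ _ (Submodule.subset_span ⟨σ, rfl⟩)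

lemma symAlg_eq_sum (x : SymAlg k n) : x = ∑ σ, x.coeff σ • perm k σ := by
  ext τ
  simp

/-! ### Inversion of permutations and the trace form -/

variable (k n) in
/-- The anti-involution of the group algebra which inverts the permutations. -/
def flip : SymAlg k n ≃ₗ[k] SymAlg k n := mapDomainLinearEquiv k k (Equiv.inv _)

@[simp] lemma flip_single (σ : Equiv.Perm (Fin n)) (r : k) :
    flip k n (single σ r) = single σ⁻¹ r := by simp [flip]

lemma flip_mul (x y : SymAlg k n) : flip k n (x * y) = flip k n y * flip k n x := by
  induction x using MonoidAlgebra.induction_linear with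
  | zero => simp
  | add x y hx hy => simp [add_mul, mul_add, hx, hy]
  | single σ r =>
    induction y using MonoidAlgebra.induction_linear with
    | zero => simp
    | add x y hx hy => simp [add_mul, mul_add, hx, hy]
    | single τ s => simp [single_mul_single, mul_comm]

lemma flip_symSum (f : Fin n → ℕ) : flip k n (symSum k f) = symSum k f := by
  simp only [symSum, map_sum, flip_single]
  exact sum_fibrePerms_inv fun τ => single τ (1 : k)

lemma flip_altSum (f : Fin n → ℕ) : flip k n (altSum k f) = altSum k f := by
  simp only [altSum, map_sum, flip_single]
  rw [← sum_fibrePerms_inv fun τ => single τ (sgn k τ)]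
  simp only [sgn_inv]

/-- The coefficient at `1` is a trace form, and `exists_coeff_mul_ne_zero` says that it is
nondegenerate. -/
lemma coeff_mul_one_comm (x y : SymAlg k n) : (x * y).coeff 1 = (y * x).coeff 1 := by
  induction x using MonoidAlgebra.induction_linear with
  | zero => simp
  | add x y hx hy => simp [add_mul, mul_add, hx, hy]
  | single σ r =>
    induction y using MonoidAlgebra.induction_linear with
    | zero => simp
    | add x y hx hy => simp [add_mul, mul_add, hx, hy]
    | single τ s =>
      have : σ * τ = 1 ↔ τ * σ = 1 := mul_eq_one_comm
      simp [single_mul_single, Finsupp.single_apply, this, mul_comm]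

lemma coeff_perm_mul (σ τ : Equiv.Perm (Fin n)) (x : SymAlg k n) :
    (perm k σ * x).coeff (σ * τ) = x.coeff τ := by
  rw [coeff_single_mul_eq_mul_coeff τ (by simp), one_mul]

lemma exists_coeff_mul_ne_zero {x : SymAlg k n} (hx : x ≠ 0) :
    ∃ z : SymAlg k n, (z * x).coeff 1 ≠ 0 := by
  by_contra! h
  refine hx (MonoidAlgebra.ext (Finsupp.ext fun σ => ?_))
  have := h (perm k σ⁻¹)
  rw [← inv_mul_cancel σ, coeff_perm_mul] at this
  exact this

/-- In the basis of permutations every diagonal entry is the coefficient at `1`. -/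
lemma trace_mulRight (x : SymAlg k n) :
    LinearMap.trace k (SymAlg k n) (LinearMap.mulRight k x) = n.factorial * x.coeff 1 := by
  rw [LinearMap.trace_eq_matrix_trace k (MonoidAlgebra.basis (Equiv.Perm (Fin n)) k),
    Matrix.trace]
  have : ∀ σ, (LinearMap.toMatrix (MonoidAlgebra.basis (Equiv.Perm (Fin n)) k)
      (MonoidAlgebra.basis (Equiv.Perm (Fin n)) k) (LinearMap.mulRight k x)).diag σ =
      x.coeff 1 := fun σ => by
    rw [Matrix.diag_apply, LinearMap.toMatrix_apply, MonoidAlgebra.basis_apply,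
      LinearMap.mulRight_apply]
    have := coeff_perm_mul σ 1 x
    rw [mul_one] at this
    exact this
  rw [Finset.sum_congr rfl fun σ _ => this σ]
  simp [Fintype.card_perm]

end GroupAlgebra

/-! ### Standard tableaux as placements of `Fin n` in the plane -/

/-- A standard tableau with `n` cells, as the family of the positions of its entries: the entry
`i` lies in the cell `(row i, col i)`, and each cell to the north-west of it has an entry `≤ i`. -/
@[ext]
structure Tab (n : ℕ) where
  /-- the row of an entry -/
  row : Fin n → ℕ
  /-- the column of an entry -/
  col : Fin n → ℕ
  inj : ∀ i j, row i = row j → col i = col j → i = j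
  std : ∀ i r c, r ≤ row i → c ≤ col i → ∃ j ≤ i, row j = r ∧ col j = c

namespace Tab

variable {n : ℕ} (S T : Tab n)

/-- The set of cells. -/
def shape : Finset (ℕ × ℕ) := Finset.univ.image fun i => (T.row i, T.col i)

lemma mem_shape {x : ℕ × ℕ} : x ∈ T.shape ↔ ∃ i, T.row i = x.1 ∧ T.col i = x.2 := by
  simp [shape, Prod.ext_iff]

lemma cell_mem_shape (i : Fin n) : (T.row i, T.col i) ∈ T.shape := T.mem_shape.mpr ⟨i, rfl, rfl⟩

lemma card_shape : T.shape.card = n := by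
  rw [shape, Finset.card_image_of_injective, Finset.card_univ, Fintype.card_fin]
  intro i j h
  exact T.inj i j (Prod.ext_iff.mp h).1 (Prod.ext_iff.mp h).2

lemma le_of_le {i j : Fin n} (hr : T.row i ≤ T.row j) (hc : T.col i ≤ T.col j) : i ≤ j := by
  obtain ⟨l, hl, h1, h2⟩ := T.std j _ _ hr hc
  exact T.inj l i h1 h2 ▸ hl

lemma lt_of_row_lt {i j : Fin n} (hc : T.col i = T.col j) (hr : T.row i < T.row j) : i < j :=
  lt_of_le_of_ne (T.le_of_le hr.le hc.le) fun h => hr.ne (congrArg T.row h)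

lemma lt_of_col_lt {i j : Fin n} (hr : T.row i = T.row j) (hc : T.col i < T.col j) : i < j :=
  lt_of_le_of_ne (T.le_of_le hr.le hc.le) fun h => hc.ne (congrArg T.col h)

/-- The tableau reflected at the diagonal. -/
def transpose : Tab n where
  row := T.col
  col := T.row
  inj i j h h' := T.inj i j h' h
  std i r c hr hc := by
    obtain ⟨j, hj, h1, h2⟩ := T.std i c r hc hr
    exact ⟨j, hj, h2, h1⟩

@[simp] lemma transpose_transpose : T.transpose.transpose = T := rfl

lemma shape_transpose : T.transpose.shape = T.shape.image Prod.swap := by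
  rw [shape, shape, Finset.image_image]
  rfl

lemma shape_transpose_eq_iff : S.transpose.shape = T.transpose.shape ↔ S.shape = T.shape := by
  rw [shape_transpose, shape_transpose]
  exact (Finset.image_injective Prod.swap_injective).eq_iff

/-- The earlier entries in the row of `i` fill exactly the cells to its left. So the rows alone
determine a tableau, which also gives finiteness of `Tab n`. -/
lemma col_eq_card (i : Fin n) :
    T.col i = (Finset.univ.filter fun j => j < i ∧ T.row j = T.row i).card := by
  have h : (Finset.univ.filter fun j => j < i ∧ T.row j = T.row i).image T.col =
      Finset.range (T.col i) := by
    ext c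
    simp only [Finset.mem_image, Finset.mem_filter, Finset.mem_univ, true_and, Finset.mem_range]
    constructor
    · rintro ⟨j, ⟨hj, hr⟩, rfl⟩
      by_contra! hc
      exact absurd (T.le_of_le hr.ge hc) (not_le.mpr hj)
    · intro hc
      obtain ⟨j, -, h1, h2⟩ := T.std i (T.row i) c le_rfl hc.le
      exact ⟨j, ⟨T.lt_of_col_lt h1 (h2 ▸ hc), h1⟩, h2⟩
  rw [← Finset.card_image_of_injOn (f := T.col), h, Finset.card_range]
  intro a ha b hb hab
  simp only [Finset.coe_filter, Finset.mem_univ, true_and, Set.mem_ofPred_eq] at ha hb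
  exact T.inj a b (ha.2.trans hb.2.symm) hab

variable {S T} in
lemma eq_of_row_eq (h : S.row = T.row) : S = T :=
  Tab.ext h (funext fun i => by rw [S.col_eq_card, T.col_eq_card, h])

lemma col_lt (i : Fin n) : T.col i < n := by
  rw [T.col_eq_card]
  calc _ ≤ (Finset.univ.erase i).card := Finset.card_le_card fun j hj => by
        simp only [Finset.mem_filter, Finset.mem_univ, true_and] at hj
        simpa using hj.1.ne
    _ < n := by
        rw [Finset.card_erase_of_mem (Finset.mem_univ i), Finset.card_univ, Fintype.card_fin]
        have := i.isLt
        omega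

lemma row_lt (i : Fin n) : T.row i < n := T.transpose.col_lt i

instance : Finite (Tab n) :=
  Finite.of_injective (fun T : Tab n => fun i => (⟨T.row i, T.row_lt i⟩ : Fin n)) fun _ _ h =>
    eq_of_row_eq (funext fun i => congrArg Fin.val (congrFun h i))

noncomputable instance : Fintype (Tab n) := Fintype.ofFinite _

noncomputable instance : DecidableEq (Tab n) := Classical.decEq _

variable {S T} in
lemma exists_cell (h : S.shape = T.shape) (i : Fin n) :
    ∃ j, S.row j = T.row i ∧ S.col j = T.col i :=
  S.mem_shape.mp (h ▸ T.cell_mem_shape i)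

/-- For tableaux `S`, `T` of the same shape, the permutation which maps the entries of `T` to the
entries of `S` in the same cells. -/
def move : Equiv.Perm (Fin n) :=
  if h : S.shape = T.shape then
    Equiv.ofBijective (fun i => (exists_cell h i).choose) (Finite.injective_iff_bijective.mp
      fun i j hij => by
        have hi := (exists_cell h i).choose_spec
        have hj := (exists_cell h j).choose_spec
        have h1 := congrArg S.row hij
        have h2 := congrArg S.col hij
        exact T.inj i j (hi.1.symm.trans (h1.trans hj.1)) (hi.2.symm.trans (h2.trans hj.2)))
  -- A filler value for tableaux of different shapes.
  else 1

variable {S T}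

lemma row_move (h : S.shape = T.shape) (i : Fin n) : S.row (move S T i) = T.row i := by
  rw [move, dif_pos h]
  exact (exists_cell h i).choose_spec.1

lemma col_move (h : S.shape = T.shape) (i : Fin n) : S.col (move S T i) = T.col i := by
  rw [move, dif_pos h]
  exact (exists_cell h i).choose_spec.2

lemma row_comp_move (h : S.shape = T.shape) : S.row ∘ move S T = T.row := funext (row_move h)

lemma col_comp_move (h : S.shape = T.shape) : S.col ∘ move S T = T.col := funext (col_move h)

variable (S) in
@[simp] lemma move_self : move S S = 1 :=
  Equiv.ext fun i => S.inj _ _ (row_move rfl i) (col_move rfl i)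

/-! #### Column counts -/

variable (T) in
/-- The number of cells in the first `m` columns. -/
def colCount (m : ℕ) : ℕ := (Finset.univ.filter fun i => T.col i < m).card

variable (T) in
-- Columns have no gaps from the top, so the column lengths determine the shape.
lemma mem_shape_iff_lt_card (r c : ℕ) :
    (r, c) ∈ T.shape ↔ r < (Finset.univ.filter fun i => T.col i = c).card := by
  have hinj : Set.InjOn T.row (Finset.univ.filter fun i => T.col i = c : Finset (Fin n)) := by
    intro a ha b hb hab
    simp only [Finset.coe_filter, Finset.mem_univ, true_and, Set.mem_ofPred_eq] at ha hb
    exact T.inj a b hab (ha.trans hb.symm)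
  rw [← Finset.card_image_of_injOn hinj, mem_shape]
  constructor
  · rintro ⟨i, rfl, rfl⟩
    have : Finset.range (T.row i + 1) ⊆
        (Finset.univ.filter fun j => T.col j = T.col i).image T.row := by
      intro s hs
      obtain ⟨j, -, h1, h2⟩ := T.std i s _ (by simpa [Nat.lt_succ_iff] using hs) le_rfl
      exact Finset.mem_image.mpr ⟨j, by simpa using h2, h1⟩
    simpa using Finset.card_le_card this
  · intro h
    by_contra! hne
    have : (Finset.univ.filter fun j => T.col j = c).image T.row ⊆ Finset.range r := by
      intro s hs
      obtain ⟨j, hj, rfl⟩ := Finset.mem_image.mp hs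
      rw [Finset.mem_range]
      by_contra! hle
      obtain ⟨l, -, h1, h2⟩ := T.std j r c hle (Finset.mem_filter.mp hj).2.ge
      exact hne l h1 h2
    have := Finset.card_le_card this
    rw [Finset.card_range] at this
    omega

lemma colCount_succ (c : ℕ) :
    T.colCount (c + 1) = T.colCount c + (Finset.univ.filter fun i => T.col i = c).card := by
  rw [colCount, colCount, ← Finset.card_union_of_disjoint]
  · congr 1
    ext i
    simp [Order.lt_add_one_iff, le_iff_lt_or_eq]
  · rw [Finset.disjoint_filter]
    intro i _ h
    exact h.ne

lemma shape_eq_of_colCount_eq (h : ∀ m, S.colCount m = T.colCount m) : S.shape = T.shape := by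
  ext ⟨r, c⟩
  have h1 := S.colCount_succ c
  have h2 := T.colCount_succ c
  rw [h, h] at h1
  rw [mem_shape_iff_lt_card, mem_shape_iff_lt_card]
  omega

lemma colCount_eq_of_shape_eq (h : S.shape = T.shape) (m : ℕ) : S.colCount m = T.colCount m := by
  rw [colCount, colCount]
  refine (Finset.card_bij (fun i _ => move S T i) ?_ ?_ ?_).symm
  · intro i hi
    simpa [col_move h] using hi
  · intro i _ j _ hij
    exact (move S T).injective hij
  · intro j hj
    refine ⟨(move S T).symm j, ?_, by simp⟩
    have := col_move h ((move S T).symm j)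
    rw [Equiv.apply_symm_apply] at this
    simpa [← this] using hj

/-! ### Dominance of shapes and the factorization of separating permutations -/

/-- If `f` is injective on the rows of `T`, then in each row `f` takes at most as many values
below `m` as there are cells in the first `m` columns. -/
lemma card_row_le (f : Fin n → ℕ) (hf : ∀ i j, T.row i = T.row j → f i = f j → i = j)
    (r m : ℕ) :
    (Finset.univ.filter fun i => T.row i = r ∧ f i < m).card ≤
      (Finset.univ.filter fun i => T.row i = r ∧ T.col i < m).card := by
  -- If the row ends before column `m`, the right side counts the whole row. Otherwise it counts `m`
  -- cells, and `f` has at most `m` values below `m`.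
  by_cases h : ∀ i, T.row i = r → T.col i < m
  · refine Finset.card_le_card fun i hi => ?_
    simp only [Finset.mem_filter, Finset.mem_univ, true_and] at hi ⊢
    exact ⟨hi.1, h i hi.1⟩
  · push Not at h
    obtain ⟨i, hi, hm⟩ := h
    have h1 : (Finset.univ.filter fun i => T.row i = r ∧ f i < m).card ≤ (Finset.range m).card := by
      refine Finset.card_le_card_of_injOn f (fun j hj => ?_) fun a ha b hb hab => ?_
      · simp only [Finset.coe_filter, Finset.mem_univ, true_and, Set.mem_ofPred_eq] at hj
        simpa using hj.2
      · simp only [Finset.coe_filter, Finset.mem_univ, true_and, Set.mem_ofPred_eq] at ha hb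
        exact hf a b (ha.1.trans hb.1.symm) hab
    refine h1.trans (Finset.card_le_card_of_surjOn T.col fun c hc => ?_)
    have hc : c < m := by simpa using hc
    obtain ⟨j, -, h1, h2⟩ := T.std i r c hi.ge (hc.le.trans hm)
    refine ⟨j, ?_, h2⟩
    simp [h1, h2, hc]

lemma card_filter_eq_sum_row (P : Fin n → Prop) [DecidablePred P] :
    (Finset.univ.filter P).card =
      ∑ r ∈ Finset.range n, (Finset.univ.filter fun i => T.row i = r ∧ P i).card := by
  rw [Finset.card_eq_sum_card_fiberwise (f := T.row) (t := Finset.range n)]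
  · refine Finset.sum_congr rfl fun r _ => ?_
    rw [Finset.filter_filter]
    simp only [and_comm]
  · intro i _
    simpa using T.row_lt i

lemma card_filter_perm (σ : Equiv.Perm (Fin n)) (P : Fin n → Prop) [DecidablePred P] :
    (Finset.univ.filter fun i => P (σ i)).card = (Finset.univ.filter P).card := by
  refine Finset.card_bij (fun i _ => σ i) ?_ ?_ ?_
  · simp
  · simp
  · intro j hj
    exact ⟨σ.symm j, by simpa using hj, by simp⟩

/-- `σ` maps distinct entries in a row of `T` to distinct columns of `S`. -/
def Separates (S T : Tab n) (σ : Equiv.Perm (Fin n)) : Prop :=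
  ∀ i j, T.row i = T.row j → S.col (σ i) = S.col (σ j) → i = j

/-- Summing `card_row_le` over the rows of `T` gives one inequality of the dominance order. -/
lemma Separates.colCount_le {σ : Equiv.Perm (Fin n)} (h : Separates S T σ) (m : ℕ) :
    S.colCount m ≤ T.colCount m := by
  rw [colCount, colCount, ← card_filter_perm σ, card_filter_eq_sum_row (T := T),
    card_filter_eq_sum_row (T := T)]
  exact Finset.sum_le_sum fun r _ => card_row_le (fun i => S.col (σ i)) h r m

/-- For equal shapes the inequalities of `card_row_le` have equal sums over the rows, so each is an
equality. Comparing two consecutive bounds then finds the cell. -/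
lemma Separates.exists_cell {σ : Equiv.Perm (Fin n)} (h : Separates S T σ)
    (hS : S.shape = T.shape) (i : Fin n) :
    ∃ j, T.row j = T.row i ∧ T.col j = S.col (σ i) := by
  have key : ∀ m, (Finset.univ.filter fun j => T.row j = T.row i ∧ S.col (σ j) < m).card =
      (Finset.univ.filter fun j => T.row j = T.row i ∧ T.col j < m).card := fun m => by
    have := colCount_eq_of_shape_eq hS m
    rw [colCount, colCount, ← card_filter_perm σ, card_filter_eq_sum_row (T := T),
      card_filter_eq_sum_row (T := T), Finset.sum_eq_sum_iff_of_le
        fun r _ => card_row_le (fun i => S.col (σ i)) h r m] at this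
    exact this _ (Finset.mem_range.mpr (T.row_lt i))
  have hlt : (Finset.univ.filter fun j => T.row j = T.row i ∧ S.col (σ j) < S.col (σ i)).card <
      (Finset.univ.filter fun j => T.row j = T.row i ∧ S.col (σ j) < S.col (σ i) + 1).card := by
    refine Finset.card_lt_card (Finset.ssubset_iff_of_subset ?_ |>.mpr ⟨i, ?_, ?_⟩)
    · intro j hj
      simp only [Finset.mem_filter, Finset.mem_univ, true_and] at hj ⊢
      exact ⟨hj.1, hj.2.trans (Nat.lt_succ_self _)⟩
    · simp
    · simp
  rw [key, key] at hlt
  obtain ⟨j, hj, hj'⟩ := Finset.exists_mem_notMem_of_card_lt_card hlt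
  simp only [Finset.mem_filter, Finset.mem_univ, true_and] at hj hj'
  refine ⟨j, hj.1, ?_⟩
  have := fun h' => hj' ⟨hj.1, h'⟩
  omega

/-- If `σ` separates the rows of `T` and the columns of `S`, then `σ = γ π ρ` with `γ` in the
column group of `S`, `ρ` in the row group of `T`, and `π` the map of cells. -/
lemma Separates.exists_eq {σ : Equiv.Perm (Fin n)} (h : Separates S T σ)
    (hS : S.shape = T.shape) :
    ∃ γ ∈ fibrePerms S.col, ∃ ρ ∈ fibrePerms T.row, σ = γ * move S T * ρ := by
  -- Within its row of `T`, each entry `i` is sent to the cell in the column of `σ i`. This is `ρ`,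
  -- and what remains of `σ` after the map of cells only permutes columns of `S`.
  choose f hf using h.exists_cell hS
  have hinj : Function.Injective f := fun i j hij =>
    h i j ((hf i).1.symm.trans (hij ▸ (hf j).1)) ((hf i).2.symm.trans (hij ▸ (hf j).2))
  set ρ : Equiv.Perm (Fin n) := Equiv.ofBijective f (Finite.injective_iff_bijective.mp hinj)
    with hρ
  have hfρ : ∀ i, ρ i = f i := fun i => rfl
  refine ⟨σ * (move S T * ρ)⁻¹, ?_, ρ, ?_, by group⟩
  · rw [mem_fibrePerms]
    intro i
    obtain ⟨j, rfl⟩ := (move S T * ρ).surjective i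
    have h1 : (σ * (move S T * ρ)⁻¹) ((move S T * ρ) j) = σ j := by simp
    rw [h1, Equiv.Perm.mul_apply, col_move hS, hfρ, (hf j).2]
  · rw [mem_fibrePerms]
    intro i
    rw [hfρ, (hf i).1]

end Tab

/-! ### Young symmetrizers -/

namespace Tab

open MonoidAlgebra

variable {k : Type u} [Field k] {n : ℕ} {S T : Tab n}

variable (k T) in
/-- The Young symmetrizer `e_T = c_T r_T^-`. -/
def young : SymAlg k n := symSum k T.col * altSum k T.row

lemma perm_move_mul_symSum (h : S.shape = T.shape) :
    perm k (move S T) * symSum k T.col = symSum k S.col * perm k (move S T) := by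
  rw [← col_comp_move h, perm_mul_symSum_comp]

lemma perm_move_mul_altSum (h : S.shape = T.shape) :
    perm k (move S T) * altSum k T.row = altSum k S.row * perm k (move S T) := by
  rw [← row_comp_move h, perm_mul_altSum_comp]

/-- Suppose `i` and `j` share a row of `T` and their images share a column of `S`. Then the column
sum absorbs the transposition while the row sum changes sign under it, so the product equals its own
negative. -/
lemma separates_of_ne_zero [CharZero k] {σ : Equiv.Perm (Fin n)}
    (h : symSum k S.col * perm k σ * altSum k T.row ≠ 0) : Separates S T σ := by
  intro i j hr hc
  by_contra hij
  refine h ?_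
  have h1 : symSum k S.col * perm k (σ * Equiv.swap i j) * altSum k T.row =
      symSum k S.col * perm k σ * altSum k T.row := by
    rw [Equiv.mul_swap_eq_swap_mul, ← perm_mul_perm, ← mul_assoc,
      symSum_mul_perm (swap_mem_fibrePerms hc)]
  rw [← perm_mul_perm, mul_assoc, mul_assoc, perm_mul_altSum (swap_mem_fibrePerms hr), sgn,
    Equiv.Perm.sign_swap hij] at h1
  have h2 : (2 : k) • (symSum k S.col * (perm k σ * altSum k T.row)) = 0 := by
    rw [two_smul]
    nth_rewrite 2 [← mul_assoc]
    rw [← h1]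
    simp
  rw [mul_assoc]
  exact (smul_eq_zero.mp h2).resolve_left two_ne_zero

lemma exists_separates [CharZero k] {x : SymAlg k n}
    (h : symSum k S.col * x * altSum k T.row ≠ 0) : ∃ σ, Separates S T σ := by
  by_contra! hσ
  refine h ?_
  rw [symAlg_eq_sum x, Finset.mul_sum, Finset.sum_mul]
  refine Finset.sum_eq_zero fun σ _ => ?_
  rw [mul_smul_comm, smul_mul_assoc]
  by_contra h'
  exact hσ σ (separates_of_ne_zero (right_ne_zero_of_smul h'))

/-- For a single permutation a nonzero product factors through `γ π ρ`. Then `γ` is absorbed on the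
left, `ρ` becomes a sign on the right, and `π r_T = r_S π`. -/
lemma exists_symSum_mul_altSum [CharZero k] (h : S.shape = T.shape) (x : SymAlg k n) :
    ∃ a : k, symSum k S.col * x * altSum k T.row = a • (S.young k * perm k (move S T)) := by
  have hx : x ∈ Submodule.span k (Set.range (perm k (n := n))) := by simp [span_perm]
  induction hx using Submodule.span_induction with
  | mem x hx =>
    obtain ⟨σ, rfl⟩ := hx
    by_cases h0 : symSum k S.col * perm k σ * altSum k T.row = 0
    · exact ⟨0, by simp [h0]⟩
    · obtain ⟨γ, hγ, ρ, hρ, rfl⟩ := (separates_of_ne_zero h0).exists_eq h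
      refine ⟨sgn k ρ, ?_⟩
      rw [← perm_mul_perm, ← perm_mul_perm, ← mul_assoc, ← mul_assoc, symSum_mul_perm hγ,
        mul_assoc, perm_mul_altSum hρ, mul_smul_comm, mul_assoc, perm_move_mul_altSum h, young,
        mul_assoc]
  | zero => exact ⟨0, by simp⟩
  | add x y _ _ hx hy =>
    obtain ⟨a, ha⟩ := hx
    obtain ⟨b, hb⟩ := hy
    exact ⟨a + b, by rw [mul_add, add_mul, ha, hb, add_smul]⟩
  | smul r x _ hx =>
    obtain ⟨a, ha⟩ := hx
    exact ⟨r * a, by rw [mul_smul_comm, smul_mul_assoc, ha, smul_smul]⟩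

lemma exists_young_mul_young [CharZero k] (h : S.shape = T.shape) (x : SymAlg k n) :
    ∃ a : k, S.young k * x * T.young k = a • (S.young k * perm k (move S T)) := by
  obtain ⟨a, ha⟩ := exists_symSum_mul_altSum h (altSum k S.row * x * symSum k T.col)
  refine ⟨a, ha ▸ ?_⟩
  simp only [young, mul_assoc]

/-- Young symmetrizers of different shapes are orthogonal. -/
lemma young_mul_young_eq_zero [CharZero k] (h : S.shape ≠ T.shape) (x : SymAlg k n) :
    S.young k * x * T.young k = 0 := by
  by_contra h0
  have e : S.young k * x * T.young k =
      symSum k S.col * (altSum k S.row * x * symSum k T.col) * altSum k T.row := by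
    simp only [young, mul_assoc]
  rw [e] at h0
  obtain ⟨σ, hσ⟩ := exists_separates h0
  have h1 : altSum k S.row * x * symSum k T.col ≠ 0 := fun h' => h0 (by rw [h']; simp)
  -- The inner factor has rows and columns in the opposite order. Inversion restores the order, and
  -- the second separating permutation gives the reverse dominance inequality.
  have h2 : symSum k T.col * flip k n x * altSum k S.row ≠ 0 := fun h' => h1 (by
    apply (flip k n).injective
    rw [flip_mul, flip_mul, flip_symSum, flip_altSum, ← mul_assoc, h', map_zero])
  obtain ⟨τ, hτ⟩ := exists_separates h2
  exact h (shape_eq_of_colCount_eq fun m => le_antisymm (hσ.colCount_le m) (hτ.colCount_le m))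

/-- Only the identity preserves both rows and columns, so `γ ρ = 1` forces `γ = ρ = 1`. -/
lemma coeff_young_one : (T.young k).coeff 1 = 1 := by
  have : T.young k = ∑ γ ∈ fibrePerms T.col, ∑ ρ ∈ fibrePerms T.row,
      single (γ * ρ) (sgn k ρ) := by
    simp only [young, symSum, altSum, Finset.sum_mul, Finset.mul_sum, single_mul_single, one_mul]
    exact Finset.sum_comm
  rw [this]
  simp only [coeff_sum, Finsupp.finsetSum_apply, coeff_single, Finsupp.single_apply]
  rw [Finset.sum_eq_single 1, Finset.sum_eq_single 1]
  · simp [sgn]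
  · intro ρ _ hρ
    simp [hρ]
  · simp [one_mem_fibrePerms]
  · intro γ hγ hγ'
    refine Finset.sum_eq_zero fun ρ hρ => if_neg fun h => hγ' ?_
    rw [mul_eq_one_iff_eq_inv] at h
    have hγ2 : γ ∈ fibrePerms T.row := h ▸ inv_mem_fibrePerms hρ
    rw [mem_fibrePerms] at hγ hγ2
    exact Equiv.ext fun i => T.inj _ _ (hγ2 i) (hγ i)
  · simp [one_mem_fibrePerms]

variable (k T) in
-- If `κ` vanished, right multiplication by `e_T` would be nilpotent, but its trace is `n!`.
lemma exists_young_mul_self [CharZero k] :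
    ∃ κ : k, κ ≠ 0 ∧ T.young k * T.young k = κ • T.young k := by
  obtain ⟨κ, hκ⟩ := exists_young_mul_young (k := k) (rfl : T.shape = T.shape) 1
  rw [mul_one, move_self, perm, ← one_def, mul_one] at hκ
  refine ⟨κ, ?_, hκ⟩
  rintro rfl
  have hnil : IsNilpotent (LinearMap.mulRight k (T.young k)) := ⟨2, by
    refine LinearMap.ext fun x => ?_
    rw [pow_two, Module.End.mul_apply, LinearMap.mulRight_apply, LinearMap.mulRight_apply,
      mul_assoc, hκ]
    simp⟩
  have := (LinearMap.isNilpotent_trace_of_isNilpotent hnil).eq_zero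
  rw [trace_mulRight, coeff_young_one, mul_one] at this
  exact (Nat.cast_ne_zero.mpr n.factorial_ne_zero) this

end Tab

namespace Tab

/-! ### Descent blocks and the triangularity of the symmetrized Young basis -/

section Blocks

variable {n : ℕ} (T : Tab n)

/-- `i` is a descent: the entry `i + 1` lies in a lower row. -/
def IsDescent (i : Fin n) : Prop := ∃ h : i.val + 1 < n, T.row i < T.row ⟨i.val + 1, h⟩

instance : DecidablePred T.IsDescent := fun _ => Classical.propDecidable _

/-- The number of the descent block of an entry. -/
def block (i : Fin n) : ℕ := (Finset.univ.filter fun j => j < i ∧ ¬ T.IsDescent j).card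

lemma block_mono : Monotone T.block := fun i i' h =>
  Finset.card_le_card fun j hj => by
    simp only [Finset.mem_filter, Finset.mem_univ, true_and] at hj ⊢
    exact ⟨hj.1.trans_le h, hj.2⟩

lemma block_succ (i : Fin n) (h : i.val + 1 < n) :
    T.block ⟨i.val + 1, h⟩ = T.block i ↔ T.IsDescent i := by
  have hsub : (Finset.univ.filter fun j => j < i ∧ ¬ T.IsDescent j) ⊆
      Finset.univ.filter fun j => j < (⟨i.val + 1, h⟩ : Fin n) ∧ ¬ T.IsDescent j := fun j hj => by
    simp only [Finset.mem_filter, Finset.mem_univ, true_and] at hj ⊢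
    exact ⟨hj.1.trans (Nat.lt_succ_self _), hj.2⟩
  constructor
  · intro he
    by_contra hd
    have := Finset.eq_of_subset_of_card_le hsub he.le
    have hi : i ∈ Finset.univ.filter fun j => j < (⟨i.val + 1, h⟩ : Fin n) ∧ ¬ T.IsDescent j := by
      simp [hd, Fin.lt_def]
    rw [← this] at hi
    simp at hi
  · intro hd
    refine le_antisymm (Finset.card_le_card fun j hj => ?_) (Finset.card_le_card hsub)
    simp only [Finset.mem_filter, Finset.mem_univ, true_and] at hj ⊢
    refine ⟨lt_of_le_of_ne (Nat.lt_succ_iff.mp hj.1) ?_, hj.2⟩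
    rintro rfl
    exact hj.2 hd

/-- Inside a block every step from an entry to the next is a descent. -/
lemma row_lt_row_of_block_eq {i i' : Fin n} (h : i < i') (hb : T.block i = T.block i') :
    T.row i < T.row i' := by
  suffices H : ∀ m (hm : m < n), i.val < m → T.block i = T.block ⟨m, hm⟩ →
      T.row i < T.row ⟨m, hm⟩ from H i'.val i'.isLt h hb
  intro m
  induction m with
  | zero => exact fun _ h => absurd h (Nat.not_lt_zero _)
  | succ m ih =>
    intro hm him hb
    have hm' : m < n := by omega
    have h1 : T.block i ≤ T.block ⟨m, hm'⟩ := T.block_mono (Nat.lt_succ_iff.mp him)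
    have h2 : T.block ⟨m, hm'⟩ ≤ T.block ⟨m + 1, hm⟩ := T.block_mono (Nat.le_succ m)
    have h3 : T.block ⟨m + 1, hm⟩ = T.block ⟨m, hm'⟩ := by omega
    obtain ⟨_, h4⟩ := (T.block_succ ⟨m, hm'⟩ hm).mp h3
    rcases (Nat.lt_succ_iff.mp him).lt_or_eq with h | h
    · exact (ih hm' h (hb.trans h3)).trans h4
    · have : i = ⟨m, hm'⟩ := Fin.ext h
      exact this ▸ h4

/-- The entry `i + 1` cannot lie both strictly below and strictly to the right of `i`: the cell in
the row of `i` and the column of `i + 1` would hold an entry strictly between them. If neither held,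
the order would give `i + 1 ≤ i`. -/
lemma isDescent_transpose_iff (i : Fin n) (h : i.val + 1 < n) :
    T.transpose.IsDescent i ↔ ¬ T.IsDescent i := by
  have hlt : i < ⟨i.val + 1, h⟩ := Nat.lt_succ_self _
  have e1 : T.IsDescent i ↔ T.row i < T.row ⟨i.val + 1, h⟩ := ⟨fun h => h.2, fun h' => ⟨h, h'⟩⟩
  have e2 : T.transpose.IsDescent i ↔ T.col i < T.col ⟨i.val + 1, h⟩ :=
    ⟨fun h => h.2, fun h' => ⟨h, h'⟩⟩
  rw [e1, e2]
  constructor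
  · intro hc hr
    obtain ⟨j, hj, h1, h2⟩ := T.std ⟨i.val + 1, h⟩ (T.row i) (T.col ⟨i.val + 1, h⟩) hr.le le_rfl
    have h3 : i < j := T.lt_of_col_lt h1.symm (h2 ▸ hc)
    have h4 : j ≠ ⟨i.val + 1, h⟩ := fun e => by
      rw [e] at h1
      exact hr.ne' h1
    have := lt_of_le_of_ne hj h4
    simp only [Fin.lt_def] at h3 this
    omega
  · intro hr
    by_contra hc
    exact absurd (T.le_of_le (not_lt.mp hr) (not_lt.mp hc)) (not_le.mpr hlt)

/-- The weighted sum of the rows, with decreasing weights. -/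
def weight (g : Equiv.Perm (Fin n)) : ℕ := ∑ i : Fin n, (n - i.val) * T.row (g i)

/-- This is the rearrangement inequality: the earlier position has the larger coefficient, so giving
it the smaller row lowers the sum. -/
lemma weight_mul_swap_lt {g : Equiv.Perm (Fin n)} {i i' : Fin n} (h : i < i')
    (hr : T.row (g i') < T.row (g i)) : T.weight (g * Equiv.swap i i') < T.weight g := by
  have split : ∀ F : Fin n → ℕ, ∑ l, F l =
      F i + (F i' + ∑ l ∈ (Finset.univ.erase i).erase i', F l) := fun F => by
    rw [Finset.add_sum_erase _ _ (Finset.mem_erase.mpr ⟨h.ne', Finset.mem_univ _⟩),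
      Finset.add_sum_erase _ _ (Finset.mem_univ _)]
  rw [weight, weight, split, split]
  have hrest : ∑ l ∈ (Finset.univ.erase i).erase i', (n - l.val) *
      T.row ((g * Equiv.swap i i') l) =
      ∑ l ∈ (Finset.univ.erase i).erase i', (n - l.val) * T.row (g l) := by
    refine Finset.sum_congr rfl fun l hl => ?_
    simp only [Finset.mem_erase, Finset.mem_univ, and_true] at hl
    rw [Equiv.Perm.mul_apply, Equiv.swap_apply_of_ne_of_ne hl.2 hl.1]
  rw [hrest]
  simp only [Equiv.Perm.mul_apply, Equiv.swap_apply_left, Equiv.swap_apply_right]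
  have h1 : n - i'.val < n - i.val := by
    have := i'.isLt
    simp only [Fin.lt_def] at h
    omega
  obtain ⟨a, ha⟩ := Nat.exists_eq_add_of_lt h1
  obtain ⟨b, hb⟩ := Nat.exists_eq_add_of_lt hr
  rw [ha, hb]
  nlinarith

/-- The products of a permutation in the column group and a block permutation. -/
def colBlock : Finset (Equiv.Perm (Fin n)) :=
  (fibrePerms T.col ×ˢ fibrePerms T.block).image fun x => x.1 * x.2

variable {T}

lemma mem_colBlock {g : Equiv.Perm (Fin n)} :
    g ∈ T.colBlock ↔ ∃ γ ∈ fibrePerms T.col, ∃ σ ∈ fibrePerms T.block, g = γ * σ := by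
  simp only [colBlock, Finset.mem_image, Finset.mem_product, Prod.exists]
  constructor
  · rintro ⟨γ, σ, ⟨h1, h2⟩, rfl⟩
    exact ⟨γ, h1, σ, h2, rfl⟩
  · rintro ⟨γ, h1, σ, h2, rfl⟩
    exact ⟨γ, σ, ⟨h1, h2⟩, rfl⟩

lemma eq_one_of_strictMono {g : Equiv.Perm (Fin n)} (hg : StrictMono g) : g = 1 :=
  Equiv.coe_fn_injective (StrictMono.range_inj hg strictMono_id |>.mp (by simp))

/-- Along the columns of `T`, the entries `g⁻¹ a` increase and have the same blocks as the `a`. -/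
lemma block_inv_eq {g : Equiv.Perm (Fin n)} (hg : g ∈ T.colBlock)
    (hinc : ∀ a b, T.col a = T.col b → T.row a < T.row b → g⁻¹ a < g⁻¹ b) (a : Fin n) :
    T.block (g⁻¹ a) = T.block a := by
  obtain ⟨γ, hγ, σ, hσ, rfl⟩ := mem_colBlock.mp hg
  have hφ : ∀ b, T.block ((γ * σ)⁻¹ b) = T.block (γ⁻¹ b) := fun b => by
    rw [mul_inv_rev, Equiv.Perm.mul_apply, mem_fibrePerms.mp (inv_mem_fibrePerms hσ)]
  -- Both `L t` and `L' t` are top segments of the column of `a`. They have the same size, since `γ`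
  -- only permutes the column and `σ` does not change blocks. Hence they coincide for every `t`.
  set L : ℕ → Finset (Fin n) := fun t =>
    Finset.univ.filter fun b => T.col b = T.col a ∧ T.block b ≤ t with hL
  set L' : ℕ → Finset (Fin n) := fun t =>
    Finset.univ.filter fun b => T.col b = T.col a ∧ T.block ((γ * σ)⁻¹ b) ≤ t with hL'
  have hcard : ∀ t, (L' t).card = (L t).card := fun t => by
    simp only [hL, hL']
    rw [← card_filter_perm γ⁻¹ fun b => T.col b = T.col a ∧ T.block b ≤ t]
    congr 1
    ext b
    simp only [Finset.mem_filter, Finset.mem_univ, true_and, hφ,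
      mem_fibrePerms.mp (inv_mem_fibrePerms hγ)]
  have hlow : ∀ t b c, b ∈ L t → T.col c = T.col b → T.row c < T.row b → c ∈ L t := by
    intro t b c hb hc hr
    simp only [hL, Finset.mem_filter, Finset.mem_univ, true_and] at hb ⊢
    exact ⟨hc.trans hb.1, (T.block_mono (T.lt_of_row_lt hc hr).le).trans hb.2⟩
  have hlow' : ∀ t b c, b ∈ L' t → T.col c = T.col b → T.row c < T.row b → c ∈ L' t := by
    intro t b c hb hc hr
    simp only [hL', Finset.mem_filter, Finset.mem_univ, true_and] at hb ⊢
    exact ⟨hc.trans hb.1, (T.block_mono (hinc c b hc hr).le).trans hb.2⟩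
  have hcol : ∀ t b, b ∈ L t ∨ b ∈ L' t → T.col b = T.col a := by
    intro t b hb
    simp only [hL, hL', Finset.mem_filter, Finset.mem_univ, true_and] at hb
    rcases hb with hb | hb <;> exact hb.1
  have heq : ∀ t, L' t = L t := fun t => by
    by_contra hne
    have h1 : ¬ L' t ⊆ L t := fun h => hne (Finset.eq_of_subset_of_card_le h (hcard t).ge)
    have h2 : ¬ L t ⊆ L' t := fun h => hne (Finset.eq_of_subset_of_card_le h (hcard t).le).symm
    obtain ⟨b, hb, hb'⟩ := Finset.not_subset.mp h1
    obtain ⟨c, hc, hc'⟩ := Finset.not_subset.mp h2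
    have hbc : T.col b = T.col c := (hcol t b (Or.inr hb)).trans (hcol t c (Or.inl hc)).symm
    rcases lt_trichotomy (T.row b) (T.row c) with h | h | h
    · exact hb' (hlow t c b hc hbc h)
    · exact hb' (T.inj b c h hbc ▸ hc)
    · exact hc' (hlow' t b c hb hbc.symm h)
  have h1 : a ∈ L (T.block a) := by simp [hL]
  have h2 : a ∈ L' (T.block ((γ * σ)⁻¹ a)) := by simp [hL']
  rw [← heq] at h1
  rw [heq] at h2
  simp only [hL, hL', Finset.mem_filter, Finset.mem_univ, true_and] at h1 h2
  exact le_antisymm h1 h2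

/-- Among the products of column and block permutations, the identity has minimal weight. -/
lemma weight_minimal {g : Equiv.Perm (Fin n)} (hg : g ∈ T.colBlock) :
    T.weight 1 ≤ T.weight g ∧ (T.weight g = T.weight 1 → g = 1) := by
  have key : ∀ g ∈ T.colBlock, (∀ g' ∈ T.colBlock, T.weight g ≤ T.weight g') → g = 1 := by
    intro g hg hmin
    -- Transpositions inside a block on the right and inside a column on the left stay in
    -- `colBlock`. A minimizer is therefore sorted along blocks and along columns.
    have hswap : ∀ i i', i < i' → g * Equiv.swap i i' ∈ T.colBlock →
        T.row (g i) ≤ T.row (g i') := fun i i' h hmem => by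
      by_contra! hr
      exact absurd (T.weight_mul_swap_lt h hr) (not_lt.mpr (hmin _ hmem))
    obtain ⟨γ, hγ, σ, hσ, hgγ⟩ := mem_colBlock.mp hg
    have hblock : ∀ i i', i < i' → T.block i = T.block i' → T.row (g i) ≤ T.row (g i') :=
      fun i i' h hb => hswap i i' h (mem_colBlock.mpr ⟨γ, hγ, σ * Equiv.swap i i',
        mul_mem_fibrePerms hσ (swap_mem_fibrePerms hb), by rw [hgγ, mul_assoc]⟩)
    have hinc : ∀ a b, T.col a = T.col b → T.row a < T.row b → g⁻¹ a < g⁻¹ b := by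
      intro a b hc hr
      by_contra! hle
      have hlt : g⁻¹ b < g⁻¹ a := lt_of_le_of_ne hle fun e => by
        rw [g⁻¹.injective e] at hr
        exact lt_irrefl _ hr
      have h1 : g * Equiv.swap (g⁻¹ b) (g⁻¹ a) = Equiv.swap b a * g := by
        rw [Equiv.mul_swap_eq_swap_mul]
        simp
      have h2 := hswap _ _ hlt (h1 ▸ mem_colBlock.mpr ⟨Equiv.swap b a * γ,
        mul_mem_fibrePerms (swap_mem_fibrePerms hc.symm) hγ, σ, hσ, by rw [hgγ, mul_assoc]⟩)
      have e : ∀ c, g (g⁻¹ c) = c := fun c => by simp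
      rw [e, e] at h2
      omega
    -- Being sorted along columns makes `g` preserve blocks. Rows increase strictly inside a block,
    -- so being sorted along blocks makes `g` monotone.
    have hpres : ∀ i, T.block (g i) = T.block i := fun i => by
      have := block_inv_eq hg hinc (g i)
      rw [← this]
      simp
    refine eq_one_of_strictMono fun i i' h => ?_
    rcases (T.block_mono h.le).lt_or_eq with hb | hb
    · rw [← hpres i, ← hpres i'] at hb
      by_contra! hle
      exact absurd (T.block_mono hle) (not_le.mpr hb)
    · by_contra! hle
      have hlt : g i' < g i := lt_of_le_of_ne hle fun e => h.ne' (g.injective e)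
      have := T.row_lt_row_of_block_eq hlt (by rw [hpres, hpres, hb])
      exact absurd (hblock i i' h hb) (not_le.mpr this)
  have hne : T.colBlock.Nonempty := ⟨g, hg⟩
  obtain ⟨g0, hg0, hmin⟩ := Finset.exists_min_image T.colBlock T.weight hne
  have h0 := key g0 hg0 hmin
  subst h0
  exact ⟨hmin g hg, fun h => key g hg fun g' hg' => h ▸ hmin g' hg'⟩

end Blocks

/-! ### Linear independence of the block vectors -/

section Independence

open MonoidAlgebra

variable {k : Type u} [Field k] {n : ℕ} {S T : Tab n}

variable (k S T) in
/-- The basis vectors `r_S c_S π_{ST} h_T` of the right ideal `r_S c_S k[Σ_n]`. -/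
def blockVector : SymAlg k n :=
  altSum k S.row * symSum k S.col * perm k (move S T) * symSum k T.block

lemma blockVector_eq_sum : blockVector k S T = ∑ ρ ∈ fibrePerms S.row, ∑ γ ∈ fibrePerms S.col,
    ∑ σ ∈ fibrePerms T.block, single (ρ * γ * move S T * σ) (sgn k ρ) := by
  simp only [blockVector, symSum, altSum, Finset.sum_mul, Finset.mul_sum, single_mul_single,
    mul_one]
  rw [Finset.sum_comm]
  refine (Finset.sum_congr rfl fun γ _ => Finset.sum_comm).trans Finset.sum_comm

/-- The terms of `blockVector k S T` at the permutation of a tableau `T'`. -/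
lemma eq_of_mul_eq_move {T' : Tab n} (hT : S.shape = T.shape) (hT' : S.shape = T'.shape)
    {ρ γ σ : Equiv.Perm (Fin n)} (hρ : ρ ∈ fibrePerms S.row) (hγ : γ ∈ fibrePerms S.col)
    (hσ : σ ∈ fibrePerms T.block) (h : ρ * γ * move S T * σ = move S T')
    (hw : T'.weight 1 ≤ T.weight 1) : T' = T ∧ ρ = 1 := by
  -- The column permutation `γ`, transported from `S` to `T`. Since `ρ` does not change rows of `S`,
  -- the row of `i` in `T'` is the row of `(γ' * σ) i` in `T`, and `weight_minimal` applies.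
  set γ' := (move S T)⁻¹ * γ * move S T with hγ'
  have hγ'mem : γ' ∈ fibrePerms T.col := by
    rw [mem_fibrePerms] at hγ ⊢
    intro i
    rw [← col_move hT, ← col_move hT i, ← hγ (move S T i)]
    simp [hγ']
  have hrow : ∀ i, T'.row i = T.row ((γ' * σ) i) := fun i => by
    rw [← row_move hT', ← h, ← row_move hT]
    simp only [Equiv.Perm.mul_apply, mem_fibrePerms.mp hρ]
    simp [hγ']
  have hmem : γ' * σ ∈ T.colBlock := mem_colBlock.mpr ⟨γ', hγ'mem, σ, hσ, rfl⟩
  have hw' : T'.weight 1 = T.weight (γ' * σ) :=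
    Finset.sum_congr rfl fun i _ => by rw [Equiv.Perm.one_apply, hrow]
  have h1 := weight_minimal hmem
  have h2 : γ' * σ = 1 := h1.2 (le_antisymm (hw' ▸ hw) h1.1)
  have h3 : T' = T := eq_of_row_eq (funext fun i => by rw [hrow, h2, Equiv.Perm.one_apply])
  refine ⟨h3, ?_⟩
  subst h3
  have h4 : ρ * move S T' * (γ' * σ) = move S T' := by
    rw [hγ']
    nth_rewrite 4 [← h]
    group
  rw [h2, mul_one] at h4
  exact mul_eq_right.mp h4

/-- The vectors `r_S c_S π_{ST} h_T` are linearly independent. -/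
lemma blockVector_independent [CharZero k] (S : Tab n) (a : Tab n → k)
    (h : ∑ T ∈ Finset.univ.filter fun T : Tab n => S.shape = T.shape, a T • blockVector k S T = 0)
    (T : Tab n) (hT : S.shape = T.shape) : a T = 0 := by
  classical
  by_contra hne
  set X : Finset (Tab n) := Finset.univ.filter fun T => S.shape = T.shape ∧ a T ≠ 0 with hX
  obtain ⟨T0, hT0, hmin⟩ := Finset.exists_min_image X (fun T => T.weight 1)
    ⟨T, by simp [hX, hT, hne]⟩
  simp only [hX, Finset.mem_filter, Finset.mem_univ, true_and] at hT0 hmin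
  have hcoeff := congrArg (fun x : SymAlg k n => x.coeff (move S T0)) h
  simp only [coeff_sum, Finsupp.finsetSum_apply, coeff_smul, Finsupp.smul_apply, coeff_zero,
    Finsupp.zero_apply] at hcoeff
  -- With `T0` of least weight, only `T = T0` reaches the permutation `move S T0`. All its
  -- contributions there have `ρ = 1`, hence sign `+1`, so the coefficient is a positive number of
  -- triples, nonzero in characteristic zero.
  have hbv : ∀ T, S.shape = T.shape → T0.weight 1 ≤ T.weight 1 →
      (blockVector k S T).coeff (move S T0) = if T = T0 then
        ((∑ ρ ∈ fibrePerms S.row, ∑ γ ∈ fibrePerms S.col, ∑ σ ∈ fibrePerms T0.block,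
          if ρ * γ * move S T0 * σ = move S T0 then 1 else 0 : ℕ) : k) else 0 := by
    intro T hT hw
    rw [blockVector_eq_sum]
    simp only [coeff_sum, Finsupp.finsetSum_apply, coeff_single, Finsupp.single_apply]
    split_ifs with hTT
    · subst hTT
      push_cast
      refine Finset.sum_congr rfl fun ρ hρ => Finset.sum_congr rfl fun γ hγ =>
        Finset.sum_congr rfl fun σ hσ => ?_
      split_ifs with he
      · rw [(eq_of_mul_eq_move hT hT hρ hγ hσ he hw).2]
        simp [sgn]
      · rfl
    · refine Finset.sum_eq_zero fun ρ hρ => Finset.sum_eq_zero fun γ hγ =>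
        Finset.sum_eq_zero fun σ hσ => if_neg fun he => ?_
      exact hTT (eq_of_mul_eq_move hT hT0.1 hρ hγ hσ he hw).1.symm
  rw [Finset.sum_eq_single T0] at hcoeff
  · rw [hbv T0 hT0.1 le_rfl, if_pos rfl, smul_eq_mul] at hcoeff
    have h0 := (mul_eq_zero.mp hcoeff).resolve_left hT0.2
    rw [Nat.cast_eq_zero, Finset.sum_eq_zero_iff] at h0
    have h1 := h0 1 (one_mem_fibrePerms _)
    rw [Finset.sum_eq_zero_iff] at h1
    have h2 := h1 1 (one_mem_fibrePerms _)
    rw [Finset.sum_eq_zero_iff] at h2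
    have h3 := h2 1 (one_mem_fibrePerms _)
    simp at h3
  · intro T hT hTT
    simp only [Finset.mem_filter, Finset.mem_univ, true_and] at hT
    by_cases ha : a T = 0
    · rw [ha, zero_smul]
    · rw [hbv T hT (hmin T ⟨hT, ha⟩), if_neg hTT, smul_zero]
  · intro h'
    simp [hT0.1] at h'

end Independence

end Tab

/-! ### Counting pairs of standard tableaux of the same shape -/

section Corners

/-- The length of a row of a finite set of cells. -/
def rowLength (μ : Finset (ℕ × ℕ)) (r : ℕ) : ℕ := (μ.filter fun x => x.1 = r).card

variable {μ : Finset (ℕ × ℕ)}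

lemma mem_iff_lt_rowLength (hμ : IsLowerSet (μ : Set (ℕ × ℕ))) (r c : ℕ) :
    (r, c) ∈ μ ↔ c < rowLength μ r := by
  have hinj : Set.InjOn Prod.snd ((μ.filter fun x => x.1 = r : Finset (ℕ × ℕ)) : Set (ℕ × ℕ)) := by
    intro a ha b hb hab
    simp only [Finset.coe_filter, Set.mem_ofPred_eq] at ha hb
    exact Prod.ext (ha.2.trans hb.2.symm) hab
  rw [rowLength, ← Finset.card_image_of_injOn hinj]
  constructor
  · intro h
    have : Finset.range (c + 1) ⊆ (μ.filter fun x => x.1 = r).image Prod.snd := by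
      intro s hs
      have hs : s ≤ c := Nat.lt_succ_iff.mp (Finset.mem_range.mp hs)
      exact Finset.mem_image.mpr ⟨(r, s), Finset.mem_filter.mpr
        ⟨hμ (show (r, s) ≤ (r, c) from ⟨le_rfl, hs⟩) h, rfl⟩, rfl⟩
    simpa using Finset.card_le_card this
  · intro h
    by_contra hne
    have : (μ.filter fun x => x.1 = r).image Prod.snd ⊆ Finset.range c := by
      intro s hs
      obtain ⟨x, hx, rfl⟩ := Finset.mem_image.mp hs
      obtain ⟨hxμ, rfl⟩ := Finset.mem_filter.mp hx
      rw [Finset.mem_range]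
      by_contra! hle
      exact hne (hμ (show (x.1, c) ≤ x from ⟨le_rfl, hle⟩) hxμ)
    have := Finset.card_le_card this
    rw [Finset.card_range] at this
    omega

lemma lt_card_of_mem (hμ : IsLowerSet (μ : Set (ℕ × ℕ))) {r c : ℕ} (h : (r, c) ∈ μ) :
    r < μ.card := by
  have : (Finset.range (r + 1)).image (fun s => (s, c)) ⊆ μ := by
    intro x hx
    obtain ⟨s, hs, rfl⟩ := Finset.mem_image.mp hx
    exact hμ (show (s, c) ≤ (r, c) from ⟨Nat.lt_succ_iff.mp (Finset.mem_range.mp hs), le_rfl⟩) h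
  have := Finset.card_le_card this
  rw [Finset.card_image_of_injective _ fun a b h => (Prod.ext_iff.mp h).1,
    Finset.card_range] at this
  omega

/-- The cells which can be added to a finite lower set of cells. -/
def addable (μ : Finset (ℕ × ℕ)) : Finset (ℕ × ℕ) :=
  ((Finset.range (μ.card + 1)).filter fun r =>
    r = 0 ∨ rowLength μ r < rowLength μ (r - 1)).image fun r => (r, rowLength μ r)

open Classical in
/-- The cells which can be removed from a finite lower set of cells. -/
def removable (μ : Finset (ℕ × ℕ)) : Finset (ℕ × ℕ) :=
  μ.filter fun x => IsLowerSet (μ.erase x : Set (ℕ × ℕ))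

lemma mem_removable {x : ℕ × ℕ} :
    x ∈ removable μ ↔ x ∈ μ ∧ IsLowerSet (μ.erase x : Set (ℕ × ℕ)) := by simp [removable]

lemma isLowerSet_insert_iff (hμ : IsLowerSet (μ : Set (ℕ × ℕ))) (x : ℕ × ℕ) :
    IsLowerSet ((insert x μ : Finset (ℕ × ℕ)) : Set (ℕ × ℕ)) ↔ ∀ y < x, y ∈ μ := by
  constructor
  · intro h y hy
    have := h hy.le (Finset.mem_coe.mpr (Finset.mem_insert_self x μ))
    exact (Finset.mem_insert.mp this).resolve_left hy.ne
  · intro h a b hba ha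
    rcases Finset.mem_insert.mp ha with rfl | ha
    · rcases hba.eq_or_lt with rfl | hlt
      · exact ha
      · exact Finset.mem_insert_of_mem (h b hlt)
    · exact Finset.mem_insert_of_mem (hμ hba ha)

lemma isLowerSet_erase_iff (hμ : IsLowerSet (μ : Set (ℕ × ℕ))) (x : ℕ × ℕ) :
    IsLowerSet (μ.erase x : Set (ℕ × ℕ)) ↔ ∀ y ∈ μ, ¬ x < y := by
  constructor
  · intro h y hy hxy
    have := h hxy.le (Finset.mem_coe.mpr (Finset.mem_erase.mpr ⟨hxy.ne', hy⟩))
    simp at this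
  · intro h a b hba ha
    rw [Finset.mem_coe, Finset.mem_erase] at ha ⊢
    refine ⟨?_, hμ hba ha.2⟩
    rintro rfl
    exact h a ha.2 (lt_of_le_of_ne hba ha.1.symm)

lemma mem_addable (hμ : IsLowerSet (μ : Set (ℕ × ℕ))) {x : ℕ × ℕ} :
    x ∈ addable μ ↔ x ∉ μ ∧ IsLowerSet ((insert x μ : Finset (ℕ × ℕ)) : Set (ℕ × ℕ)) := by
  obtain ⟨r, c⟩ := x
  rw [isLowerSet_insert_iff hμ, mem_iff_lt_rowLength hμ]
  simp only [addable, Finset.mem_image, Finset.mem_filter, Finset.mem_range, Prod.mk.injEq]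
  constructor
  · rintro ⟨r', ⟨-, hr⟩, rfl, rfl⟩
    refine ⟨lt_irrefl _, ?_⟩
    rintro ⟨a, b⟩ hab
    rw [mem_iff_lt_rowLength hμ]
    rw [Prod.mk_lt_mk] at hab
    rcases hab with ⟨h1, h2⟩ | ⟨h1, h2⟩
    · obtain ⟨s, rfl⟩ : ∃ s, r' = s + 1 := ⟨r' - 1, by omega⟩
      have h3 := hr.resolve_left (Nat.succ_ne_zero s)
      rw [Nat.add_sub_cancel] at h3
      have h4 : (s, b) ∈ μ := (mem_iff_lt_rowLength hμ _ _).mpr (h2.trans_lt h3)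
      exact (mem_iff_lt_rowLength hμ _ _).mp
        (hμ (show (a, b) ≤ (s, b) from ⟨Nat.lt_succ_iff.mp h1, le_rfl⟩) h4)
    · have h3 : (r', b) ∈ μ := (mem_iff_lt_rowLength hμ _ _).mpr h2
      exact (mem_iff_lt_rowLength hμ _ _).mp (hμ (show (a, b) ≤ (r', b) from ⟨h1, le_rfl⟩) h3)
  · rintro ⟨h1, h2⟩
    have hc : c = rowLength μ r := by
      refine le_antisymm ?_ (not_lt.mp h1)
      by_contra! hlt
      have := h2 (r, rowLength μ r) (Prod.mk_lt_mk.mpr (Or.inr ⟨le_rfl, hlt⟩))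
      rw [mem_iff_lt_rowLength hμ] at this
      exact lt_irrefl _ this
    subst hc
    rcases Nat.eq_zero_or_pos r with rfl | hr
    · exact ⟨0, ⟨by omega, Or.inl rfl⟩, rfl, rfl⟩
    · have h3 := h2 (r - 1, rowLength μ r) (Prod.mk_lt_mk.mpr (Or.inl ⟨by omega, le_rfl⟩))
      have h4 := lt_card_of_mem hμ h3
      rw [mem_iff_lt_rowLength hμ] at h3
      exact ⟨r, ⟨by omega, Or.inr h3⟩, rfl, rfl⟩

lemma mem_removable_iff (hμ : IsLowerSet (μ : Set (ℕ × ℕ))) {r c : ℕ} :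
    (r, c) ∈ removable μ ↔ rowLength μ r = c + 1 ∧ rowLength μ (r + 1) ≤ c := by
  rw [mem_removable, isLowerSet_erase_iff hμ, mem_iff_lt_rowLength hμ]
  constructor
  · rintro ⟨h1, h2⟩
    constructor
    · by_contra hne
      exact h2 (r, c + 1) ((mem_iff_lt_rowLength hμ _ _).mpr (by omega))
        (Prod.mk_lt_mk.mpr (Or.inr ⟨le_rfl, Nat.lt_succ_self c⟩))
    · by_contra! hlt
      exact h2 (r + 1, c) ((mem_iff_lt_rowLength hμ _ _).mpr hlt)
        (Prod.mk_lt_mk.mpr (Or.inl ⟨Nat.lt_succ_self r, le_rfl⟩))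
  · rintro ⟨h1, h2⟩
    refine ⟨by omega, ?_⟩
    rintro ⟨a, b⟩ hab hlt
    rw [Prod.mk_lt_mk] at hlt
    rcases hlt with ⟨h3, h4⟩ | ⟨h3, h4⟩
    · have := (mem_iff_lt_rowLength hμ _ _).mp
        (hμ (show (r + 1, c) ≤ (a, b) from ⟨h3, h4⟩) hab)
      omega
    · have := (mem_iff_lt_rowLength hμ _ _).mp
        (hμ (show (r, c + 1) ≤ (a, b) from ⟨h3, h4⟩) hab)
      omega

/-- A cell can always be added to row `0`. For the others, row `r + 1` can be extended exactly if
the last cell of row `r` can be removed: both say that row `r + 1` is shorter than row `r`. -/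
lemma card_addable (hμ : IsLowerSet (μ : Set (ℕ × ℕ))) :
    (addable μ).card = (removable μ).card + 1 := by
  have h0 : (0, rowLength μ 0) ∈ addable μ :=
    Finset.mem_image.mpr ⟨0, by simp, rfl⟩
  rw [← Finset.card_erase_add_one h0]
  congr 1
  refine (Finset.card_bij (fun x _ => (x.1 + 1, rowLength μ (x.1 + 1))) ?_ ?_ ?_).symm
  · rintro ⟨r, c⟩ hx
    have hrc := (mem_removable.mp hx).1
    rw [mem_removable_iff hμ] at hx
    refine Finset.mem_erase.mpr ⟨by simp, Finset.mem_image.mpr ⟨r + 1, ?_, rfl⟩⟩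
    have := lt_card_of_mem hμ hrc
    simp only [Finset.mem_filter, Finset.mem_range, Nat.add_sub_cancel]
    exact ⟨by omega, Or.inr (by omega)⟩
  · rintro ⟨r, c⟩ hx ⟨r', c'⟩ hx' h
    rw [mem_removable_iff hμ] at hx hx'
    simp only [Prod.mk.injEq, Nat.add_right_cancel_iff] at h
    obtain rfl := h.1
    simp only [Prod.mk.injEq, true_and]
    omega
  · intro x hx
    obtain ⟨hne, hx⟩ := Finset.mem_erase.mp hx
    obtain ⟨r, hr, rfl⟩ := Finset.mem_image.mp hx
    obtain ⟨-, hr⟩ := Finset.mem_filter.mp hr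
    obtain ⟨s, rfl⟩ : ∃ s, r = s + 1 := ⟨r - 1, by
      have : r ≠ 0 := by
        rintro rfl
        exact hne rfl
      omega⟩
    have hr := hr.resolve_left (Nat.succ_ne_zero s)
    rw [Nat.add_sub_cancel] at hr
    exact ⟨(s, rowLength μ s - 1), (mem_removable_iff hμ).mpr ⟨by omega, by omega⟩, rfl⟩

end Corners

/-! ### Removing the largest entry and counting tableaux -/

namespace Tab

variable {n : ℕ}

lemma isLowerSet_shape (T : Tab n) : IsLowerSet (T.shape : Set (ℕ × ℕ)) := by
  intro a b hba ha
  obtain ⟨i, h1, h2⟩ := T.mem_shape.mp ha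
  obtain ⟨j, -, h3, h4⟩ := T.std i b.1 b.2 (h1 ▸ hba.1) (h2 ▸ hba.2)
  exact T.mem_shape.mpr ⟨j, h3, h4⟩

/-- The tableau without its largest entry. -/
def restrict (T : Tab (n + 1)) : Tab n where
  row i := T.row i.castSucc
  col i := T.col i.castSucc
  inj i j hr hc := Fin.castSucc_injective n (T.inj _ _ hr hc)
  std i r c hr hc := by
    obtain ⟨j, hj, h1, h2⟩ := T.std _ r c hr hc
    have hlt : j.val < n := lt_of_le_of_lt hj i.isLt
    exact ⟨⟨j.val, hlt⟩, hj, h1, h2⟩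

/-- The tableau with a new largest entry in an addable cell. -/
def extend (T : Tab n) (x : ℕ × ℕ) (hx : x ∉ T.shape) (hlow : ∀ y < x, y ∈ T.shape) :
    Tab (n + 1) where
  row := Fin.snoc T.row x.1
  col := Fin.snoc T.col x.2
  inj i j := by
    refine Fin.lastCases ?_ (fun i => ?_) i <;> refine Fin.lastCases ?_ (fun j => ?_) j
    · simp
    · simp only [Fin.snoc_last, Fin.snoc_castSucc]
      exact fun h1 h2 => absurd (T.mem_shape.mpr ⟨j, h1.symm, h2.symm⟩) hx
    · simp only [Fin.snoc_last, Fin.snoc_castSucc]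
      exact fun h1 h2 => absurd (T.mem_shape.mpr ⟨i, h1, h2⟩) hx
    · simp only [Fin.snoc_castSucc]
      exact fun h1 h2 => congrArg _ (T.inj i j h1 h2)
  std i r c := by
    refine Fin.lastCases ?_ (fun i => ?_) i
    · simp only [Fin.snoc_last]
      intro h1 h2
      rcases (show (r, c) ≤ x from ⟨h1, h2⟩).eq_or_lt with h | h
      · exact ⟨Fin.last n, le_rfl, by simp [← h], by simp [← h]⟩
      · obtain ⟨j, h3, h4⟩ := T.mem_shape.mp (hlow _ h)
        exact ⟨j.castSucc, Fin.le_last _, by simp [h3], by simp [h4]⟩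
    · simp only [Fin.snoc_castSucc]
      intro h1 h2
      obtain ⟨j, hj, h3, h4⟩ := T.std i r c h1 h2
      exact ⟨j.castSucc, hj, by simp [h3], by simp [h4]⟩

lemma shape_restrict (T : Tab (n + 1)) :
    T.shape = insert (T.row (Fin.last n), T.col (Fin.last n)) T.restrict.shape := by
  ext x
  rw [Finset.mem_insert, mem_shape, mem_shape]
  constructor
  · rintro ⟨i, h1, h2⟩
    revert h1 h2
    refine Fin.lastCases (fun h1 h2 => Or.inl ?_) (fun i h1 h2 => Or.inr ⟨i, h1, h2⟩) i
    exact Prod.ext h1.symm h2.symm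
  · rintro (rfl | ⟨i, h1, h2⟩)
    · exact ⟨Fin.last n, rfl, rfl⟩
    · exact ⟨i.castSucc, h1, h2⟩

lemma last_notMem_shape_restrict (T : Tab (n + 1)) :
    (T.row (Fin.last n), T.col (Fin.last n)) ∉ T.restrict.shape := by
  rw [mem_shape]
  rintro ⟨i, h1, h2⟩
  exact absurd (T.inj _ _ h1 h2) (Fin.castSucc_lt_last i).ne

/-- A tableau is determined by its restriction and the cell of the largest entry, which can be any
addable cell. -/
lemma sum_tab_succ (f : Finset (ℕ × ℕ) → ℕ) :
    ∑ T : Tab (n + 1), f T.shape =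
      ∑ T : Tab n, ∑ x ∈ addable T.shape, f (insert x T.shape) := by
  rw [Finset.sum_sigma']
  refine Finset.sum_bij'
    (fun T _ => (⟨T.restrict, (T.row (Fin.last n), T.col (Fin.last n))⟩ : Σ _ : Tab n, ℕ × ℕ))
    (fun p hp => p.1.extend p.2
      ((mem_addable p.1.isLowerSet_shape).mp (Finset.mem_sigma.mp hp).2).1
      ((isLowerSet_insert_iff p.1.isLowerSet_shape _).mp
        ((mem_addable p.1.isLowerSet_shape).mp (Finset.mem_sigma.mp hp).2).2))
    ?_ ?_ ?_ ?_ ?_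
  · intro T _
    refine Finset.mem_sigma.mpr ⟨Finset.mem_univ _, (mem_addable (isLowerSet_shape _)).mpr
      ⟨T.last_notMem_shape_restrict, ?_⟩⟩
    rw [← shape_restrict]
    exact T.isLowerSet_shape
  · simp
  · intro T _
    ext i
    · refine Fin.lastCases ?_ (fun i => ?_) i <;> simp [extend, restrict]
    · refine Fin.lastCases ?_ (fun i => ?_) i <;> simp [extend, restrict]
  · rintro ⟨T, x⟩ _
    simp [extend, restrict]
  · intro T _
    rw [← shape_restrict]

/-- The number of standard tableaux of a given shape. -/
def count (n : ℕ) (μ : Finset (ℕ × ℕ)) : ℕ := ∑ T : Tab n, if T.shape = μ then 1 else 0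

lemma count_succ {μ : Finset (ℕ × ℕ)} (hμ : IsLowerSet (μ : Set (ℕ × ℕ))) :
    count (n + 1) μ = ∑ x ∈ removable μ, count n (μ.erase x) := by
  rw [count, sum_tab_succ fun s => if s = μ then 1 else 0]
  simp only [count]
  rw [Finset.sum_comm (s := removable μ)]
  refine Finset.sum_congr rfl fun T _ => ?_
  rw [← Finset.sum_filter, ← Finset.sum_filter]
  congr 1
  ext x
  simp only [Finset.mem_filter, mem_addable T.isLowerSet_shape, mem_removable]
  constructor
  · rintro ⟨⟨h1, -⟩, rfl⟩
    have e : (insert x T.shape).erase x = T.shape := Finset.erase_insert h1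
    exact ⟨⟨Finset.mem_insert_self _ _, e.symm ▸ T.isLowerSet_shape⟩, e.symm⟩
  · rintro ⟨⟨h1, -⟩, h3⟩
    have e : insert x T.shape = μ := by rw [h3, Finset.insert_erase h1]
    exact ⟨⟨by simp [h3], e.symm ▸ hμ⟩, e⟩

/-- Adding a cell and then removing one differs from the opposite order only when the same cell is
added and removed. By `card_addable` this leaves one surplus copy of `count n μ`, and induction
supplies the rest. -/
lemma sum_count_insert (n : ℕ) : ∀ {μ : Finset (ℕ × ℕ)}, IsLowerSet (μ : Set (ℕ × ℕ)) →
    μ.card = n → ∑ x ∈ addable μ, count (n + 1) (insert x μ) = (n + 1) * count n μ := by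
  induction n with
  | zero =>
    intro μ hμ hc
    obtain rfl := Finset.card_eq_zero.mp hc
    have h1 : ∀ x ∈ addable (∅ : Finset (ℕ × ℕ)), count 1 (insert x ∅) = count 0 ∅ := by
      intro x hx
      rw [mem_addable hμ] at hx
      rw [count_succ hx.2, show removable (insert x ∅ : Finset (ℕ × ℕ)) = {x} from ?_]
      · simp
      · ext y
        rw [mem_removable]
        simp only [insert_empty_eq, Finset.mem_singleton, and_iff_left_iff_imp]
        rintro rfl
        simpa using hμ
    rw [Finset.sum_congr rfl h1, Finset.sum_const, card_addable hμ,
      show removable (∅ : Finset (ℕ × ℕ)) = ∅ from rfl]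
    simp
  | succ n ih =>
    intro μ hμ hc
    have h1 : ∀ x ∈ addable μ, count (n + 2) (insert x μ) = count (n + 1) μ +
        ∑ y ∈ (removable (insert x μ)).erase x, count (n + 1) ((insert x μ).erase y) := by
      intro x hx
      rw [mem_addable hμ] at hx
      have e : (insert x μ).erase x = μ := Finset.erase_insert hx.1
      rw [count_succ hx.2, ← Finset.add_sum_erase _ _ (mem_removable.mpr
        ⟨Finset.mem_insert_self x μ, e.symm ▸ hμ⟩), e]
    have h2 : ∀ y ∈ removable μ, count (n + 1) μ +
        ∑ x ∈ (addable (μ.erase y)).erase y, count (n + 1) (insert x (μ.erase y)) =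
          (n + 1) * count n (μ.erase y) := by
      intro y hy
      rw [mem_removable] at hy
      have e : insert y (μ.erase y) = μ := Finset.insert_erase hy.1
      rw [← ih hy.2 (by rw [Finset.card_erase_of_mem hy.1, hc]; rfl),
        ← Finset.add_sum_erase (addable (μ.erase y)) _ ((mem_addable hy.2).mpr
          ⟨Finset.notMem_erase y μ, e.symm ▸ hμ⟩), e]
    -- For distinct cells `x` and `y`, adding `x` and removing `y` commute; intersections and unions
    -- of lower sets show that the intermediate diagrams are lower sets.
    have h3 : ∑ x ∈ addable μ, ∑ y ∈ (removable (insert x μ)).erase x,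
        count (n + 1) ((insert x μ).erase y) = ∑ y ∈ removable μ,
          ∑ x ∈ (addable (μ.erase y)).erase y, count (n + 1) (insert x (μ.erase y)) := by
      rw [Finset.sum_comm' (t' := removable μ) (s' := fun y => (addable (μ.erase y)).erase y)]
      · refine Finset.sum_congr rfl fun y hy => Finset.sum_congr rfl fun x hx => ?_
        rw [Finset.erase_insert_of_ne (Finset.mem_erase.mp hx).1]
      · intro x y
        rw [Finset.mem_erase, Finset.mem_erase, mem_addable hμ, mem_removable, mem_removable,
          Finset.mem_insert]
        constructor
        · rintro ⟨⟨h1, h2⟩, h3, h4, h5⟩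
          have hy := h4.resolve_left h3
          have hl : IsLowerSet (μ.erase y : Set (ℕ × ℕ)) := by
            have e : (μ.erase y : Set (ℕ × ℕ)) = ↑μ ∩ ↑((insert x μ).erase y) := by
              ext z
              simp only [Finset.coe_erase, Finset.coe_insert, Set.mem_sdiff, Set.mem_inter_iff,
                Set.mem_insert_iff]
              tauto
            rw [e]
            exact hμ.inter h5
          refine ⟨⟨Ne.symm h3, (mem_addable hl).mpr ⟨fun h => h1 (Finset.mem_of_mem_erase h), ?_⟩⟩,
            hy, hl⟩
          rw [← Finset.erase_insert_of_ne (Ne.symm h3)]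
          exact h5
        · rintro ⟨⟨h1, h2⟩, h3, h4⟩
          rw [mem_addable h4] at h2
          have hx : x ∉ μ := fun h => h2.1 (Finset.mem_erase.mpr ⟨h1, h⟩)
          refine ⟨⟨hx, ?_⟩, Ne.symm h1, Or.inr h3, ?_⟩
          · have e : ((insert x μ : Finset (ℕ × ℕ)) : Set (ℕ × ℕ)) =
                ↑μ ∪ ↑(insert x (μ.erase y)) := by
              ext z
              simp only [Finset.coe_erase, Finset.coe_insert, Set.mem_sdiff, Set.mem_union,
                Set.mem_insert_iff]
              tauto
            rw [e]
            exact hμ.union h2.2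
          · rw [Finset.erase_insert_of_ne h1]
            exact h2.2
    have h4 := Finset.sum_congr rfl h2
    rw [Finset.sum_add_distrib, ← Finset.mul_sum, ← count_succ hμ, Finset.sum_const] at h4
    rw [Finset.sum_congr rfl h1, Finset.sum_add_distrib, h3, Finset.sum_const, card_addable hμ]
    simp only [smul_eq_mul] at h4 ⊢
    linarith

/-- The number of pairs of standard tableaux of the same shape with `n` cells is `n!`. -/
lemma sum_count_shape (n : ℕ) : ∑ T : Tab n, count n T.shape = n.factorial := by
  induction n with
  | zero =>
    have hu : ∀ S T : Tab 0, S = T := fun S T => Tab.ext (funext fun i => i.elim0)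
      (funext fun i => i.elim0)
    let T : Tab 0 := ⟨fun i => i.elim0, fun i => i.elim0, fun i => i.elim0, fun i => i.elim0⟩
    have huniv : (Finset.univ : Finset (Tab 0)) = {T} := by
      ext S
      simpa using hu S T
    rw [huniv, Finset.sum_singleton, count, huniv, Finset.sum_singleton, if_pos rfl]
    rfl
  | succ n ih =>
    rw [sum_tab_succ, Nat.factorial_succ, ← ih, Finset.mul_sum]
    exact Finset.sum_congr rfl fun T _ => sum_count_insert n T.isLowerSet_shape T.card_shape

lemma count_eq_card (μ : Finset (ℕ × ℕ)) :
    count n μ = (Finset.univ.filter fun T : Tab n => T.shape = μ).card := by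
  rw [count, Finset.card_filter]

/-- Half of the pairs of tableaux of the same shape have a given descent in the first tableau. -/
lemma two_mul_sum_descent (j : Fin n) (hj : j.val + 1 < n) :
    2 * ∑ T ∈ Finset.univ.filter fun T : Tab n => T.IsDescent j, count n T.shape =
      n.factorial := by
  -- Reflection at the diagonal exchanges the two cases and preserves the number of tableaux of the
  -- shape.
  have h : ∑ T ∈ Finset.univ.filter fun T : Tab n => T.IsDescent j, count n T.shape =
      ∑ T ∈ Finset.univ.filter fun T : Tab n => ¬ T.IsDescent j, count n T.shape := by
    refine Finset.sum_bij' (fun T _ => T.transpose) (fun T _ => T.transpose) ?_ ?_ ?_ ?_ ?_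
    · intro T hT
      simpa [isDescent_transpose_iff _ _ hj] using hT
    · intro T hT
      simpa [isDescent_transpose_iff _ _ hj] using hT
    · simp
    · simp
    · intro T _
      rw [count_eq_card, count_eq_card]
      refine Finset.card_bij' (fun S _ => S.transpose) (fun S _ => S.transpose) ?_ ?_ ?_ ?_
      · intro S hS
        simpa [shape_transpose_eq_iff] using hS
      · intro S hS
        simp only [Finset.mem_filter, Finset.mem_univ, true_and] at hS ⊢
        rw [← shape_transpose_eq_iff, transpose_transpose]
        exact hS
      · simp
      · simp
  rw [two_mul]
  nth_rewrite 2 [h]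
  rw [Finset.sum_filter_add_sum_filter_not, sum_count_shape]

end Tab

namespace Tab

/-! ### The decomposition of the group algebra -/

section Decomposition

open MonoidAlgebra

variable (k : Type u) [Field k] {n : ℕ} (S T : Tab n)

/-- The left ideal generated by the Young symmetrizer. -/
def leftIdeal : Submodule k (SymAlg k n) := LinearMap.range (LinearMap.mulRight k (T.young k))

/-- The element `c_T h_T`: right multiplication by it maps `k[Σ_n] e_T` to the elements which are
invariant under the descent blocks of `T`. -/
def blockSum : SymAlg k n := symSum k T.col * symSum k T.block

/-- The map `(x_T) ↦ ∑ x_T c_T h_T`. -/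
def assemble {ι : Type} [Fintype ι] (f : ι → Tab n) :
    (∀ i : ι, (f i).leftIdeal k) →ₗ[k] SymAlg k n :=
  ∑ i, LinearMap.mulRight k ((f i).blockSum k) ∘ₗ ((f i).leftIdeal k).subtype ∘ₗ LinearMap.proj i

variable {k S T}

lemma assemble_apply {ι : Type} [Fintype ι] (f : ι → Tab n) (x : ∀ i : ι, (f i).leftIdeal k) :
    assemble k f x = ∑ i, (x i : SymAlg k n) * (f i).blockSum k := by
  simp [assemble]

lemma blockSum_mul_swap {j : Fin n} (h : j.val + 1 < n) (hj : T.IsDescent j) :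
    T.blockSum k * perm k (Equiv.swap j ⟨j.val + 1, h⟩) = T.blockSum k := by
  rw [blockSum, mul_assoc,
    symSum_mul_perm (swap_mem_fibrePerms ((T.block_succ j h).mpr hj).symm)]

lemma finrank_symAlg : Module.finrank k (SymAlg k n) = n.factorial := by
  rw [Module.finrank_eq_card_basis (MonoidAlgebra.basis (Equiv.Perm (Fin n)) k),
    Fintype.card_perm, Fintype.card_fin]

instance : Module.Finite k (SymAlg k n) :=
  Module.Finite.of_basis (MonoidAlgebra.basis (Equiv.Perm (Fin n)) k)

/-- Inversion takes `r_S c_S π h_T` to `h_T π⁻¹ c_S r_S`, an element of the left ideal of `e_S`. The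
independence of the block vectors gives one dimension for each `T`. -/
lemma count_le_finrank [CharZero k] : count n S.shape ≤ Module.finrank k (S.leftIdeal k) := by
  have hmem : ∀ T : Tab n, flip k n (blockVector k S T) ∈ S.leftIdeal k := fun T => by
    rw [blockVector, flip_mul, flip_mul, flip_mul, flip_altSum, flip_symSum, flip_symSum]
    exact ⟨symSum k T.block * flip k n (perm k (move S T)), by
      simp [young, mul_assoc]⟩
  have hli : LinearIndependent k fun T : {T : Tab n // T.shape = S.shape} =>
      (⟨flip k n (blockVector k S T.1), hmem T.1⟩ : S.leftIdeal k) := by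
    rw [Fintype.linearIndependent_iff]
    intro a ha T
    have h1 := congrArg (fun x => (flip k n).symm (Submodule.subtype _ x)) ha
    simp only [map_sum, map_smul, Submodule.subtype_apply, LinearEquiv.symm_apply_apply,
      map_zero] at h1
    have h2 := blockVector_independent S
      (fun T => if h : T.shape = S.shape then a ⟨T, h⟩ else 0) ?_ T.1 T.2.symm
    · simpa [T.2] using h2
    · rw [← h1, ← Finset.sum_subtype_of_mem (p := fun T : Tab n => T.shape = S.shape)]
      · refine Finset.sum_bij (fun T _ => T) ?_ ?_ ?_ ?_
        · simp
        · simp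
        · simpa using fun T h => Eq.symm h
        · intro T _
          simp [T.2]
      · intro T hT
        simpa using (Finset.mem_filter.mp hT).2.symm
  have := hli.fintype_card_le_finrank
  rw [count_eq_card]
  rwa [Fintype.card_subtype] at this

/-- Multiplying a relation by `e_S z` on the left replaces `x_T` by a multiple of `e_S π` for the
shape of `S`, and by zero for the others. What remains is a relation between block vectors, and `z`
is chosen to make its coefficient at `S` nonzero. -/
lemma assemble_injective [CharZero k] : Function.Injective (assemble k (id : Tab n → Tab n)) := by
  rw [← LinearMap.ker_eq_bot, LinearMap.ker_eq_bot']
  intro x hx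
  rw [assemble_apply] at hx
  funext S
  by_contra hne
  have hxS : (x S : SymAlg k n) ≠ 0 := fun h => hne (Subtype.ext h)
  obtain ⟨κ, hκ, he⟩ := exists_young_mul_self k S
  choose y hy using fun T : Tab n => (x T).2
  simp only [LinearMap.mulRight_apply, id] at hy
  obtain ⟨z, hz⟩ := exists_coeff_mul_ne_zero hxS
  -- Since `x S` is a left multiple of `e_S`, it satisfies `x_S e_S = κ x_S`. The symmetry of the
  -- trace form moves `e_S` to the front.
  have hzS : S.young k * z * x S ≠ 0 := fun h0 => by
    have h1 : (z * x S * S.young k).coeff 1 = κ * (z * x S).coeff 1 := by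
      rw [mul_assoc, ← hy S, mul_assoc (y S), he]
      simp
    rw [coeff_mul_one_comm, ← mul_assoc, h0] at h1
    exact mul_ne_zero hκ hz h1.symm
  have hα : ∀ T : Tab n, ∃ a : k, S.shape = T.shape →
      S.young k * z * x T = a • (S.young k * perm k (move S T)) := fun T => by
    by_cases h : S.shape = T.shape
    · obtain ⟨a, ha⟩ := exists_young_mul_young h (z * y T)
      exact ⟨a, fun _ => by rw [← ha, ← hy T]; simp only [mul_assoc]⟩
    · exact ⟨0, fun h' => absurd h' h⟩
  choose a ha using hα
  have haS : a S ≠ 0 := fun h0 => hzS (by rw [ha S rfl, h0, zero_smul])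
  have h1 : symSum k S.col *
      ∑ T ∈ Finset.univ.filter fun T : Tab n => S.shape = T.shape, a T • blockVector k S T = 0 := by
    have h2 := congrArg (fun w => S.young k * z * w) hx
    simp only [Finset.mul_sum, mul_zero, id] at h2
    rw [← h2, Finset.mul_sum, Finset.sum_filter]
    refine Finset.sum_congr rfl fun T _ => ?_
    split_ifs with h
    · rw [← mul_assoc, ha T h, blockVector, blockSum, young, mul_smul_comm, smul_mul_assoc]
      congr 1
      simp only [mul_assoc]
      rw [← mul_assoc (perm k (move S T)), perm_move_mul_symSum h]
      simp only [mul_assoc]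
    · rw [← mul_assoc, ← hy T, ← mul_assoc, mul_assoc (S.young k),
        young_mul_young_eq_zero h, zero_mul]
  -- The inverted form of `e_S e_S = κ e_S`. After multiplication by `r_S` it cancels the leading
  -- `c_S`.
  have hrc : altSum k S.row * symSum k S.col * (altSum k S.row * symSum k S.col) =
      κ • (altSum k S.row * symSum k S.col) := by
    apply (flip k n).injective
    rw [flip_mul, flip_mul, map_smul, flip_mul, flip_altSum, flip_symSum]
    exact he
  have h3 : ∑ T ∈ Finset.univ.filter fun T : Tab n => S.shape = T.shape,
      (a T) • blockVector k S T = 0 := by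
    have h4 := congrArg (fun w => altSum k S.row * w) h1
    simp only [mul_zero] at h4
    have h5 : κ • ∑ T ∈ Finset.univ.filter fun T : Tab n => S.shape = T.shape,
        a T • blockVector k S T = 0 := by
      rw [← h4, ← mul_assoc, Finset.mul_sum, Finset.smul_sum]
      refine Finset.sum_congr rfl fun T _ => ?_
      rw [mul_smul_comm, smul_comm]
      congr 1
      rw [blockVector, mul_assoc _ (perm k _), ← mul_assoc (_ * _) (_ * _), hrc, smul_mul_assoc]
    exact (smul_eq_zero.mp h5).resolve_left hκ
  exact haS (blockVector_independent S a h3 S rfl)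

lemma finrank_pi_leftIdeal {ι : Type} [Fintype ι] (f : ι → Tab n) :
    Module.finrank k (∀ i : ι, (f i).leftIdeal k) =
      ∑ i, Module.finrank k ((f i).leftIdeal k) :=
  Module.finrank_pi_fintype k

/-- The source has dimension at least the number of pairs of tableaux of equal shape, which is `n!`,
the dimension of the target. -/
lemma assemble_bijective [CharZero k] : Function.Bijective (assemble k (id : Tab n → Tab n)) := by
  refine ⟨assemble_injective, ?_⟩
  rw [← LinearMap.range_eq_top]
  refine Submodule.eq_top_of_finrank_eq (le_antisymm (Submodule.finrank_le _) ?_)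
  rw [LinearMap.finrank_range_of_inj assemble_injective, finrank_pi_leftIdeal, finrank_symAlg,
    ← sum_count_shape]
  exact Finset.sum_le_sum fun T _ => count_le_finrank

/-! ### Invariants under a simple transposition -/

variable (k n) in
/-- The twist of the group algebra by the sign. -/
def signTwist : SymAlg k n →ₗ[k] SymAlg k n :=
  (MonoidAlgebra.basis (Equiv.Perm (Fin n)) k).constr k fun σ => sgn k σ • perm k σ

lemma signTwist_perm (σ : Equiv.Perm (Fin n)) :
    signTwist k n (perm k σ) = sgn k σ • perm k σ := by
  rw [perm, ← MonoidAlgebra.basis_apply, signTwist, Module.Basis.constr_basis]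
  rfl

lemma signTwist_signTwist (x : SymAlg k n) : signTwist k n (signTwist k n x) = x := by
  rw [symAlg_eq_sum x]
  simp only [map_sum, map_smul, signTwist_perm, smul_smul, mul_assoc]
  exact Finset.sum_congr rfl fun σ _ => by rw [sgn_mul_self, mul_one]

lemma signTwist_mul_perm (x : SymAlg k n) (σ : Equiv.Perm (Fin n)) :
    signTwist k n (x * perm k σ) = sgn k σ • (signTwist k n x * perm k σ) := by
  rw [symAlg_eq_sum x]
  simp only [map_sum, Finset.sum_mul, Finset.smul_sum]
  refine Finset.sum_congr rfl fun τ _ => ?_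
  rw [smul_mul_assoc, map_smul, perm_mul_perm, signTwist_perm, map_smul, signTwist_perm,
    smul_mul_assoc, smul_mul_assoc, perm_mul_perm, smul_smul, smul_smul, smul_smul, sgn_mul]
  congr 1
  ring

/-- The elements of the group algebra which are invariant under a transposition form a subspace
of at most half the dimension. -/
lemma two_mul_finrank_invariants_le [CharZero k] {i j : Fin n} (hij : i ≠ j) :
    2 * Module.finrank k (LinearMap.ker (LinearMap.mulRight k (perm k (Equiv.swap i j)) -
      LinearMap.id)) ≤ n.factorial := by
  set s := Equiv.swap i j with hs
  set E := LinearMap.ker (LinearMap.mulRight k (perm k s) - LinearMap.id) with hE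
  have hmem : ∀ x, x ∈ E ↔ x * perm k s = x := fun x => by
    rw [hE, LinearMap.mem_ker, LinearMap.sub_apply, LinearMap.mulRight_apply, LinearMap.id_apply,
      sub_eq_zero]
  have hinj : Function.Injective (signTwist k n) :=
    Function.LeftInverse.injective signTwist_signTwist
  -- The sign twist sends invariants injectively to anti-invariants, and only zero is both. So two
  -- copies of `E` fit into the group algebra.
  have hdisj : Disjoint E (E.map (signTwist k n)) := by
    rw [Submodule.disjoint_def]
    rintro x hx ⟨y, hy, rfl⟩
    have h1 := (hmem _).mp hx
    have h2 := congrArg (signTwist k n) ((hmem y).mp hy)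
    rw [signTwist_mul_perm, h1, sgn, hs, Equiv.Perm.sign_swap hij] at h2
    have h3 : (2 : k) • signTwist k n y = 0 := by
      rw [two_smul]
      nth_rewrite 1 [← h2]
      simp
    exact (smul_eq_zero.mp h3).resolve_left two_ne_zero
  have := Submodule.finrank_add_finrank_le_of_disjoint hdisj
  rw [(Submodule.equivMapOfInjective _ hinj E).finrank_eq.symm, finrank_symAlg] at this
  omega

/-- An element which is invariant under the transposition of `j` and `j + 1` only has components
at the tableaux with descent `j`. -/
lemma exists_assemble_eq [CharZero k] {j : Fin n} (h : j.val + 1 < n) {x : SymAlg k n}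
    (hx : x * perm k (Equiv.swap j ⟨j.val + 1, h⟩) = x) :
    ∃ y : ∀ T : Tab n, T.leftIdeal k, assemble k (id : Tab n → Tab n) y = x ∧
      ∀ T, ¬ T.IsDescent j → y T = 0 := by
  classical
  set s := Equiv.swap j ⟨j.val + 1, h⟩ with hs
  set E := LinearMap.ker (LinearMap.mulRight k (perm k s) - LinearMap.id) with hE
  have hmem : ∀ x, x ∈ E ↔ x * perm k s = x := fun x => by
    rw [hE, LinearMap.mem_ker, LinearMap.sub_apply, LinearMap.mulRight_apply, LinearMap.id_apply,
      sub_eq_zero]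
  let ι := {T : Tab n // T.IsDescent j}
  let f : ι → Tab n := Subtype.val
  let ext0 : (∀ i : ι, (f i).leftIdeal k) → ∀ T : Tab n, T.leftIdeal k := fun y T =>
    if hT : T.IsDescent j then y ⟨T, hT⟩ else 0
  have hext : ∀ y, assemble k (id : Tab n → Tab n) (ext0 y) = assemble k f y := fun y => by
    rw [assemble_apply, assemble_apply, ← Finset.sum_subset (Finset.subset_univ
      (Finset.univ.filter fun T : Tab n => T.IsDescent j))]
    · rw [← Finset.sum_subtype_of_mem (p := fun T : Tab n => T.IsDescent j)]
      · refine Finset.sum_bij (fun T _ => T) (by simp) (by simp) (by simpa using fun T => T.2) ?_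
        intro T _
        simp only [id, ext0, dif_pos T.2]
        rfl
      · intro T hT
        exact (Finset.mem_filter.mp hT).2
    · intro T _ hT
      have hT : ¬ T.IsDescent j := by simpa using hT
      simp [ext0, hT]
  have hinj : Function.Injective (assemble k f) := by
    intro y y' hyy
    rw [← hext, ← hext] at hyy
    have := assemble_injective hyy
    funext i
    have h2 := congrFun this i.1
    simpa only [ext0, dif_pos i.2] using h2
  have hle : LinearMap.range (assemble k f) ≤ E := by
    rintro _ ⟨y, rfl⟩
    rw [hmem, assemble_apply, Finset.sum_mul]
    exact Finset.sum_congr rfl fun i _ => by rw [mul_assoc, blockSum_mul_swap h i.2]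
  have hij : j ≠ ⟨j.val + 1, h⟩ := fun e => by
    have := congrArg Fin.val e
    simp at this
  -- The tableaux with descent `j` contribute at least `n!/2` dimensions, and the invariants have at
  -- most `n!/2`.
  have hdim : Module.finrank k E ≤ Module.finrank k (LinearMap.range (assemble k f)) := by
    rw [LinearMap.finrank_range_of_inj hinj, finrank_pi_leftIdeal]
    have h1 : 2 * Module.finrank k E ≤ n.factorial := two_mul_finrank_invariants_le hij
    have h2 := two_mul_sum_descent j h
    have h3 : ∑ T ∈ Finset.univ.filter fun T : Tab n => T.IsDescent j, count n T.shape ≤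
        ∑ i : ι, Module.finrank k ((f i).leftIdeal k) := by
      rw [← Finset.sum_subtype_of_mem (p := fun T : Tab n => T.IsDescent j)]
      · refine le_trans (le_of_eq ?_) (Finset.sum_le_sum fun i _ => count_le_finrank (k := k))
        exact Finset.sum_bij (fun T _ => T) (by simp) (by simp)
          (by simpa using fun T => T.2) fun T _ => rfl
      · intro T hT
        exact (Finset.mem_filter.mp hT).2
    omega
  have heq := Submodule.eq_of_le_of_finrank_le hle hdim
  obtain ⟨y, hy⟩ : x ∈ LinearMap.range (assemble k f) := heq ▸ (hmem x).mpr hx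
  exact ⟨ext0 y, (hext y).trans hy, fun T hT => dif_neg hT⟩

/-! ### The elements which extract the components -/

variable (k) in
/-- The component of `1` at `T` in the decomposition of the group algebra. -/
def coblock [CharZero k] (T : Tab n) : SymAlg k n :=
  (LinearEquiv.ofBijective _ (assemble_bijective (k := k) (n := n))).symm 1 T

/-- The decomposition is one of left modules, so the components of `x = x * 1` are `x` times those
of `1`. -/
lemma symm_assemble_apply [CharZero k] (x : SymAlg k n) (T : Tab n) :
    ((LinearEquiv.ofBijective _ (assemble_bijective (k := k) (n := n))).symm x T : SymAlg k n) =
      x * T.coblock k := by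
  have hmem : ∀ T : Tab n, x * T.coblock k ∈ T.leftIdeal k := fun T => by
    obtain ⟨y, hy⟩ := ((LinearEquiv.ofBijective _
      (assemble_bijective (k := k) (n := n))).symm 1 T).2
    exact ⟨x * y, by
      rw [LinearMap.mulRight_apply] at hy ⊢
      rw [mul_assoc]
      exact congrArg (x * ·) hy⟩
  have h : (LinearEquiv.ofBijective _ (assemble_bijective (k := k) (n := n))).symm x =
      fun T => ⟨x * T.coblock k, hmem T⟩ := by
    rw [LinearEquiv.symm_apply_eq, LinearEquiv.ofBijective_apply, assemble_apply]
    have h1 := LinearEquiv.apply_symm_apply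
      (LinearEquiv.ofBijective _ (assemble_bijective (k := k) (n := n))) 1
    rw [LinearEquiv.ofBijective_apply, assemble_apply] at h1
    have h2 := congrArg (fun w => x * w) h1
    simp only [mul_one, Finset.mul_sum] at h2
    exact h2.symm.trans (Finset.sum_congr rfl fun T _ => (mul_assoc x (T.coblock k) _).symm)
  rw [h]

variable (k) in
lemma sum_coblock_mul_blockSum [CharZero k] :
    ∑ T : Tab n, T.coblock k * T.blockSum k = 1 := by
  have h1 := LinearEquiv.apply_symm_apply
    (LinearEquiv.ofBijective _ (assemble_bijective (k := k) (n := n))) 1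
  rwa [LinearEquiv.ofBijective_apply, assemble_apply] at h1

variable (k T) in
lemma exists_coblock_eq [CharZero k] : ∃ y, T.coblock k = y * T.young k := by
  obtain ⟨y, hy⟩ := ((LinearEquiv.ofBijective _
    (assemble_bijective (k := k) (n := n))).symm 1 T).2
  exact ⟨y, hy.symm⟩

variable (k S T) in
-- The element `e_S c_S h_S` has the single component `e_S`, at `S`. This is how vectors of a Schur
-- complex are recovered from their images in the model.
lemma young_mul_blockSum_mul_coblock [CharZero k] :
    S.young k * S.blockSum k * T.coblock k = if S = T then S.young k else 0 := by
  have hmem : S.young k ∈ S.leftIdeal k := ⟨1, by simp⟩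
  have h : S.young k * S.blockSum k = assemble k (id : Tab n → Tab n)
      (Pi.single S (⟨S.young k, hmem⟩ : S.leftIdeal k)) := by
    rw [assemble_apply, Finset.sum_eq_single S]
    · simp
    · intro T _ hT
      simp [hT]
    · simp
  rw [← symm_assemble_apply, h]
  have h2 := LinearEquiv.symm_apply_apply
    (LinearEquiv.ofBijective _ (assemble_bijective (k := k) (n := n)))
    (Pi.single S (⟨S.young k, hmem⟩ : S.leftIdeal k))
  rw [LinearEquiv.ofBijective_apply] at h2
  rw [h2]
  split_ifs with hST
  · subst hST
    simp
  · rw [Pi.single_eq_of_ne (Ne.symm hST)]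
    rfl

/-- The element `1 + s_j` is fixed by `s_j`, hence has no component at a tableau without descent
`j`. -/
lemma one_add_swap_mul_coblock [CharZero k] {j : Fin n} (h : j.val + 1 < n)
    (hj : ¬ T.IsDescent j) :
    (1 + perm k (Equiv.swap j ⟨j.val + 1, h⟩)) * T.coblock k = 0 := by
  have hx : (1 + perm k (Equiv.swap j ⟨j.val + 1, h⟩)) *
      perm k (Equiv.swap j ⟨j.val + 1, h⟩) = 1 + perm k (Equiv.swap j ⟨j.val + 1, h⟩) := by
    rw [add_mul, perm_mul_perm, Equiv.swap_mul_self, one_mul, add_comm]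
    rfl
  obtain ⟨y, hy, hy0⟩ := exists_assemble_eq h hx
  rw [← symm_assemble_apply, ← hy]
  have h2 := LinearEquiv.symm_apply_apply
    (LinearEquiv.ofBijective _ (assemble_bijective (k := k) (n := n))) y
  rw [LinearEquiv.ofBijective_apply] at h2
  rw [h2, hy0 T hj]
  rfl

end Decomposition

end Tab

/-! ### The signed action and the concatenation of tensors -/

section Signed

variable {k : Type u} [Field k] (V W : CochainComplex (ModuleCat.{v} k) ℤ)

lemma algAct_single {n : ℕ} (σ : Equiv.Perm (Fin n)) (r : k) :
    algAct V (MonoidAlgebra.single σ r) = (r * sgn k σ) • act V σ := by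
  rw [algAct, Finset.sum_eq_single σ]
  · simp
  · intro τ _ h
    simp [Ne.symm h]
  · simp

lemma algAct_add {n : ℕ} (a b : SymAlg k n) : algAct V (a + b) = algAct V a + algAct V b := by
  simp only [algAct, ← Finset.sum_add_distrib, ← add_smul, ← add_mul]
  rfl

lemma algAct_smul {n : ℕ} (r : k) (a : SymAlg k n) : algAct V (r • a) = r • algAct V a := by
  simp only [algAct, Finset.smul_sum, smul_smul, ← mul_assoc]
  rfl

/-- The signed action as a linear map. -/
def algActLin (n : ℕ) : SymAlg k n →ₗ[k] Module.End k (TPow V n) where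
  toFun := algAct V
  map_add' := algAct_add V
  map_smul' := algAct_smul V

lemma algAct_zero {n : ℕ} : algAct V (0 : SymAlg k n) = 0 := (algActLin V n).map_zero

lemma algAct_sum {n : ℕ} {ι : Type*} (s : Finset ι) (f : ι → SymAlg k n) :
    algAct V (∑ i ∈ s, f i) = ∑ i ∈ s, algAct V (f i) := map_sum (algActLin V n) f s

lemma algAct_mul {n : ℕ} (a b : SymAlg k n) : algAct V (a * b) = algAct V b ∘ₗ algAct V a := by
  induction a using MonoidAlgebra.induction_linear with
  | zero => rw [zero_mul, algAct_zero, LinearMap.comp_zero]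
  | add x y hx hy => rw [add_mul, algAct_add, algAct_add, hx, hy, LinearMap.comp_add]
  | single σ r =>
    induction b using MonoidAlgebra.induction_linear with
    | zero => rw [mul_zero, algAct_zero, LinearMap.zero_comp]
    | add x y hx hy => rw [mul_add, algAct_add, algAct_add, hx, hy, LinearMap.add_comp]
    | single τ s =>
      rw [MonoidAlgebra.single_mul_single, algAct_single, algAct_single, algAct_single, act_mul,
        LinearMap.comp_smul, LinearMap.smul_comp, smul_smul, sgn_mul]
      congr 1
      ring

lemma algAct_mul_apply {n : ℕ} (a b : SymAlg k n) (x : TPow V n) :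
    algAct V (a * b) x = algAct V b (algAct V a x) := LinearMap.congr_fun (algAct_mul V a b) x

lemma algAct_one {n : ℕ} : algAct V (1 : SymAlg k n) = LinearMap.id := by
  rw [MonoidAlgebra.one_def, algAct_single, act_one]
  simp [sgn]

/-- The sign operator of the tensor power. -/
def tpowSign (n : ℕ) : Module.End k (TPow V n) := PiTensorProduct.map fun _ => signOp V

/-- Concatenation of tensors. -/
def concat (a b : ℕ) : TPow V a →ₗ[k] TPow V b →ₗ[k] TPow V (a + b) :=
  (TensorProduct.mk k _ _).compr₂ (TensorPower.mulEquiv (R := k) (M := Tot V)).toLinearMap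

variable {V W}

lemma concat_apply {a b : ℕ} (x : TPow V a) (y : TPow V b) :
    concat V a b x y = TensorPower.mulEquiv (x ⊗ₜ[k] y) := rfl

lemma concat_tprod {a b : ℕ} (w : Fin a → Tot V) (w' : Fin b → Tot V) :
    concat V a b (PiTensorProduct.tprod k w) (PiTensorProduct.tprod k w') =
      PiTensorProduct.tprod k (Fin.append w w') := TensorPower.tprod_mul_tprod k w w'

lemma concat_assoc {a b c : ℕ} (x : TPow V a) (y : TPow V b) (z : TPow V c) :
    TensorPower.cast k (Tot V) (add_assoc a b c) (concat V (a + b) c (concat V a b x y) z) =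
      concat V a (b + c) x (concat V b c y z) := TensorPower.mul_assoc x y z

lemma mulEquiv_symm_concat {a b : ℕ} (x : TPow V a) (y : TPow V b) :
    TensorPower.mulEquiv.symm (concat V a b x y) = x ⊗ₜ[k] y := by
  rw [concat_apply, LinearEquiv.symm_apply_apply]

/-- Two bilinear expressions agree if they agree on pure tensors. -/
lemma concat_ext {a b : ℕ} {M : Type*} [AddCommGroup M] [Module k M]
    {f g : TPow V a →ₗ[k] TPow V b →ₗ[k] M}
    (h : ∀ w w', f (PiTensorProduct.tprod k w) (PiTensorProduct.tprod k w') =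
      g (PiTensorProduct.tprod k w) (PiTensorProduct.tprod k w')) : f = g :=
  PiTensorProduct.ext (MultilinearMap.ext fun w => PiTensorProduct.ext
    (MultilinearMap.ext fun w' => h w w'))

lemma map_append {a b : ℕ} (f : Fin (a + b) → Tot V →ₗ[k] Tot W) (w : Fin a → Tot V)
    (w' : Fin b → Tot V) :
    (fun i => f i (Fin.append w w' i)) =
      Fin.append (fun i => f (Fin.castAdd b i) (w i)) (fun i => f (Fin.natAdd a i) (w' i)) := by
  funext i
  refine Fin.addCases (fun i => ?_) (fun i => ?_) i <;> simp

lemma map_concat {a b : ℕ} (f : Fin (a + b) → Tot V →ₗ[k] Tot W) (x : TPow V a) (y : TPow V b) :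
    PiTensorProduct.map f (concat V a b x y) =
      concat W a b (PiTensorProduct.map (fun i => f (Fin.castAdd b i)) x)
        (PiTensorProduct.map (fun i => f (Fin.natAdd a i)) y) := by
  have : (concat V a b).compr₂ (PiTensorProduct.map f) =
      (concat W a b).compl₁₂ (PiTensorProduct.map (fun i => f (Fin.castAdd b i)))
        (PiTensorProduct.map (fun i => f (Fin.natAdd a i))) := by
    refine concat_ext fun w w' => ?_
    simp only [LinearMap.compr₂_apply, LinearMap.compl₁₂_apply, concat_tprod,
      PiTensorProduct.map_tprod, map_append]
  exact LinearMap.congr_fun (LinearMap.congr_fun this x) y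

lemma tpowSign_concat {a b : ℕ} (x : TPow V a) (y : TPow V b) :
    tpowSign V (a + b) (concat V a b x y) =
      concat V a b (tpowSign V a x) (tpowSign V b y) := map_concat _ x y

lemma tpowMap_concat (f : V ⟶ W) {a b : ℕ} (x : TPow V a) (y : TPow V b) :
    tpowMap f (a + b) (concat V a b x y) =
      concat W a b (tpowMap f a x) (tpowMap f b y) := map_concat _ x y

/-- The Leibniz rule for the differential of tensor powers. -/
lemma tpowD_concat {a b : ℕ} (x : TPow V a) (y : TPow V b) :
    tpowD V (a + b) (concat V a b x y) =
      concat V a b (tpowD V a x) y + concat V a b (tpowSign V a x) (tpowD V b y) := by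
  rw [tpowD, LinearMap.sum_apply, Fin.sum_univ_add, tpowD, LinearMap.sum_apply, map_sum,
    LinearMap.sum_apply, tpowD, LinearMap.sum_apply, map_sum]
  refine congrArg₂ _ (Finset.sum_congr rfl fun i _ => ?_) (Finset.sum_congr rfl fun i _ => ?_)
  · rw [map_concat]
    have h1 : (fun j : Fin b => if Fin.natAdd a j < Fin.castAdd b i then signOp V else
        if Fin.natAdd a j = Fin.castAdd b i then totD V else LinearMap.id) =
        fun _ => LinearMap.id := by
      funext j
      have := i.isLt
      rw [if_neg, if_neg]
      · simp only [Fin.ext_iff, Fin.val_natAdd, Fin.val_castAdd]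
        omega
      · simp only [Fin.lt_def, Fin.val_natAdd, Fin.val_castAdd]
        omega
    have h2 : (fun j : Fin a => if Fin.castAdd b j < Fin.castAdd b i then signOp V else
        if Fin.castAdd b j = Fin.castAdd b i then totD V else LinearMap.id) =
        fun j => if j < i then signOp V else if j = i then totD V else LinearMap.id := by
      funext j
      simp only [Fin.lt_def, Fin.ext_iff, Fin.val_castAdd]
    rw [h1, h2, PiTensorProduct.map_id, LinearMap.id_apply]
  · rw [map_concat]
    have h1 : (fun j : Fin a => if Fin.castAdd b j < Fin.natAdd a i then signOp V else
        if Fin.castAdd b j = Fin.natAdd a i then totD V else LinearMap.id) =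
        fun _ => signOp V := by
      funext j
      rw [if_pos]
      simp only [Fin.lt_def, Fin.val_natAdd, Fin.val_castAdd]
      omega
    have h2 : (fun j : Fin b => if Fin.natAdd a j < Fin.natAdd a i then signOp V else
        if Fin.natAdd a j = Fin.natAdd a i then totD V else LinearMap.id) =
        fun j => if j < i then signOp V else if j = i then totD V else LinearMap.id := by
      funext j
      simp only [Fin.lt_def, Fin.ext_iff, Fin.val_natAdd, Nat.add_lt_add_iff_left,
        Nat.add_left_cancel_iff]
    rw [h1, h2]
    rfl

lemma act_blockPerm_concat {a b : ℕ} (σ : Equiv.Perm (Fin a)) (τ : Equiv.Perm (Fin b))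
    (x : TPow V a) (y : TPow V b) :
    act V (blockPerm σ τ) (concat V a b x y) = concat V a b (act V σ x) (act V τ y) := by
  apply (TensorPower.mulEquiv (R := k) (M := Tot V)).symm.injective
  rw [← map_act_mulEquiv_symm, mulEquiv_symm_concat, mulEquiv_symm_concat,
    TensorProduct.map_tmul]

lemma blockPerm_swap_one {a b : ℕ} (i j : Fin a) :
    blockPerm (Equiv.swap i j) (1 : Equiv.Perm (Fin b)) =
      Equiv.swap (Fin.castAdd b i) (Fin.castAdd b j) := by
  ext l
  congr 1
  refine Fin.addCases (fun l => ?_) (fun l => ?_) l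
  · rw [blockPerm_castAdd, Equiv.swap_apply_def, Equiv.swap_apply_def]
    simp only [Fin.castAdd_inj]
    split_ifs <;> rfl
  · rw [blockPerm_natAdd, Equiv.swap_apply_of_ne_of_ne]
    · rfl
    · have := i.isLt
      simp only [ne_eq, Fin.ext_iff, Fin.val_natAdd, Fin.val_castAdd]
      omega
    · have := j.isLt
      simp only [ne_eq, Fin.ext_iff, Fin.val_natAdd, Fin.val_castAdd]
      omega

lemma blockPerm_one_swap {a b : ℕ} (i j : Fin b) :
    blockPerm (1 : Equiv.Perm (Fin a)) (Equiv.swap i j) =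
      Equiv.swap (Fin.natAdd a i) (Fin.natAdd a j) := by
  ext l
  congr 1
  refine Fin.addCases (fun l => ?_) (fun l => ?_) l
  · rw [blockPerm_castAdd, Equiv.swap_apply_of_ne_of_ne]
    · rfl
    · have := l.isLt
      simp only [ne_eq, Fin.ext_iff, Fin.val_natAdd, Fin.val_castAdd]
      omega
    · have := l.isLt
      simp only [ne_eq, Fin.ext_iff, Fin.val_natAdd, Fin.val_castAdd]
      omega
  · rw [blockPerm_natAdd, Equiv.swap_apply_def, Equiv.swap_apply_def]
    simp only [Fin.natAdd_inj]
    split_ifs <;> rfl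

variable (V) in
/-- The signed action of a transposition. -/
def swapAct {n : ℕ} (i j : Fin n) : Module.End k (TPow V n) := algAct V (perm k (Equiv.swap i j))

lemma swapAct_eq {n : ℕ} {i j : Fin n} (h : i ≠ j) :
    swapAct V i j = -act V (Equiv.swap i j) := by
  rw [swapAct, algAct_single, sgn, Equiv.Perm.sign_swap h, one_mul]
  rw [Units.val_neg, Units.val_one, Int.cast_neg, Int.cast_one]
  refine LinearMap.ext fun x => ?_
  rw [LinearMap.neg_apply, LinearMap.smul_apply]
  exact neg_one_smul k (act V (Equiv.swap i j) x)

lemma swapAct_castAdd_concat {a b : ℕ} {i j : Fin a} (h : i ≠ j) (x : TPow V a) (y : TPow V b) :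
    swapAct V (Fin.castAdd b i) (Fin.castAdd b j) (concat V a b x y) =
      concat V a b (swapAct V i j x) y := by
  rw [swapAct_eq h, swapAct_eq fun e => h (Fin.castAdd_injective a b e), ← blockPerm_swap_one,
    LinearMap.neg_apply, act_blockPerm_concat, act_one, LinearMap.neg_apply, map_neg]
  rfl

lemma swapAct_natAdd_concat {a b : ℕ} {i j : Fin b} (h : i ≠ j) (x : TPow V a) (y : TPow V b) :
    swapAct V (Fin.natAdd a i) (Fin.natAdd a j) (concat V a b x y) =
      concat V a b x (swapAct V i j y) := by
  rw [swapAct_eq h, swapAct_eq fun e => h (Fin.natAdd_injective b a e), ← blockPerm_one_swap,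
    LinearMap.neg_apply, act_blockPerm_concat, act_one, LinearMap.neg_apply, map_neg]
  rfl

lemma signOp_signOp (x : Tot V) : signOp V (signOp V x) = x := by
  have h : signOp V ∘ₗ signOp V = LinearMap.id := by
    rw [← parityProj_add V, signOp]
    simp only [LinearMap.comp_sub, LinearMap.sub_comp, parityProj_comp]
    simp
  exact LinearMap.congr_fun h x

lemma tpowSign_tpowSign {n : ℕ} (x : TPow V n) : tpowSign V n (tpowSign V n x) = x := by
  rw [tpowSign, ← LinearMap.comp_apply, ← PiTensorProduct.map_comp]
  have : (fun _ : Fin n => signOp V ∘ₗ signOp V) = fun _ => LinearMap.id :=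
    funext fun _ => LinearMap.ext signOp_signOp
  rw [this, PiTensorProduct.map_id, LinearMap.id_apply]

lemma act_tpowSign {n : ℕ} (σ : Equiv.Perm (Fin n)) (x : TPow V n) :
    act V σ (tpowSign V n x) = tpowSign V n (act V σ x) :=
  (LinearMap.congr_fun (map_comp_act (parityProj_signOp V) σ) x).symm

lemma totD_signOp (x : Tot V) : totD V (signOp V x) = -signOp V (totD V x) := by
  have h0 := LinearMap.congr_fun (parityProj_totD V 0) x
  have h1 := LinearMap.congr_fun (parityProj_totD V 1) x
  simp only [LinearMap.comp_apply, zero_add, show (1 + 1 : ZMod 2) = 0 from rfl] at h0 h1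
  rw [signOp, LinearMap.sub_apply, LinearMap.sub_apply, map_sub, ← h0, ← h1]
  abel

lemma signOp_totMap (f : V ⟶ W) (x : Tot V) : signOp W (totMap f x) = totMap f (signOp V x) := by
  have h0 := LinearMap.congr_fun (parityProj_totMap f 0) x
  have h1 := LinearMap.congr_fun (parityProj_totMap f 1) x
  simp only [LinearMap.comp_apply] at h0 h1
  rw [signOp, signOp, LinearMap.sub_apply, LinearMap.sub_apply, map_sub, ← h0, ← h1]

end Signed

/-! ### The desuspension of tensor powers -/

section Desuspension

variable {k : Type u} [Field k] (V W : CochainComplex (ModuleCat.{v} k) ℤ)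

/-- The identification of the total spaces of `sV` and `V`. -/
def desusp : Tot (susp V) ≃ₗ[k] Tot V :=
  (DirectSum.lequivCongrLeft k (M := fun q : ℤ => V.X q) (Equiv.subRight (1 : ℤ))).symm

/-- The identification `(sV)^p = V^{p+1}`. -/
def suspX (p : ℤ) : (susp V).X p ≃ₗ[k] V.X (p + 1) := LinearEquiv.refl k (V.X (p + 1))

lemma desusp_lof (p : ℤ) (x : (susp V).X p) :
    desusp V (DirectSum.lof k ℤ (fun q => (susp V).X q) p x) =
      DirectSum.lof k ℤ (fun q => V.X q) (p + 1) (suspX V p x) :=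
  DirectSum.lequivCongrLeft_symm_lof k (M := fun q : ℤ => V.X q) (h := Equiv.subRight (1 : ℤ))

lemma suspX_d (p : ℤ) (x : (susp V).X p) :
    suspX V (p + 1) (((susp V).d p (p + 1)).hom x) =
      -(V.d (p + 1) (p + 1 + 1)).hom (suspX V p x) := by
  have h := CochainComplex.shiftFunctor_obj_d' V 1 p (p + 1)
  rw [Int.negOnePow_one] at h
  rw [h, Units.neg_smul, one_smul]
  rfl

lemma suspX_map {V W : CochainComplex (ModuleCat.{v} k) ℤ} (f : V ⟶ W) (p : ℤ)
    (x : (susp V).X p) :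
    suspX W p (((f⟦(1 : ℤ)⟧').f p).hom x) = (f.f (p + 1)).hom (suspX V p x) := rfl

lemma cast_succ_eq (p : ℤ) (a : ZMod 2) : ((p + 1 : ℤ) : ZMod 2) = a + 1 ↔ (p : ZMod 2) = a := by
  push_cast
  exact add_left_inj 1

lemma parityProj_desusp (a : ZMod 2) :
    parityProj V (a + 1) ∘ₗ (desusp V).toLinearMap =
      (desusp V).toLinearMap ∘ₗ parityProj (susp V) a := by
  refine DirectSum.linearMap_ext k fun p => LinearMap.ext fun x => ?_
  change parityProj V (a + 1) (desusp V (DirectSum.lof k ℤ (fun q => (susp V).X q) p x)) =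
    desusp V (parityProj (susp V) a (DirectSum.lof k ℤ (fun q => (susp V).X q) p x))
  rw [desusp_lof, parityProj, DirectSum.lmap_lof, parityProj, DirectSum.lmap_lof]
  by_cases h : (p : ZMod 2) = a
  · rw [if_pos h, if_pos ((cast_succ_eq p a).2 h)]
    exact (desusp_lof V p x).symm
  · rw [if_neg h, if_neg (mt (cast_succ_eq p a).1 h), LinearMap.zero_apply, LinearMap.zero_apply,
      map_zero, map_zero, map_zero]

lemma totD_desusp (x : Tot (susp V)) :
    totD V (desusp V x) = -desusp V (totD (susp V) x) := by
  have : totD V ∘ₗ (desusp V).toLinearMap = -((desusp V).toLinearMap ∘ₗ totD (susp V)) := by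
    refine DirectSum.linearMap_ext k fun p => LinearMap.ext fun x => ?_
    change totD V (desusp V (DirectSum.lof k ℤ (fun q => (susp V).X q) p x)) =
      -desusp V (totD (susp V) (DirectSum.lof k ℤ (fun q => (susp V).X q) p x))
    rw [desusp_lof, totD, DirectSum.toModule_lof, totD, DirectSum.toModule_lof]
    simp only [LinearMap.comp_apply]
    rw [desusp_lof, ← map_neg]
    rw [suspX_d, neg_neg]
  exact LinearMap.congr_fun this x

variable {V W} in
lemma totMap_desusp (f : V ⟶ W) (x : Tot (susp V)) :
    totMap f (desusp V x) = desusp W (totMap (f⟦(1 : ℤ)⟧') x) := by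
  have : totMap f ∘ₗ (desusp V).toLinearMap =
      (desusp W).toLinearMap ∘ₗ totMap (f⟦(1 : ℤ)⟧') := by
    refine DirectSum.linearMap_ext k fun p => LinearMap.ext fun x => ?_
    change totMap f (desusp V (DirectSum.lof k ℤ (fun q => (susp V).X q) p x)) =
      desusp W (totMap (f⟦(1 : ℤ)⟧') (DirectSum.lof k ℤ (fun q => (susp V).X q) p x))
    rw [desusp_lof, totMap, DirectSum.lmap_lof, totMap, DirectSum.lmap_lof, desusp_lof, suspX_map]
  exact LinearMap.congr_fun this x

lemma map_desusp_totDeg (p : ℤ) :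
    (totDeg (susp V) p).map (desusp V).toLinearMap = totDeg V (p + 1) := by
  rw [totDeg, ← LinearMap.range_comp]
  have : (desusp V).toLinearMap ∘ₗ DirectSum.lof k ℤ (fun q => (susp V).X q) p =
      DirectSum.lof k ℤ (fun q => V.X q) (p + 1) ∘ₗ (suspX V p).toLinearMap :=
    LinearMap.ext fun x => desusp_lof V p x
  rw [this, LinearEquiv.range_comp]
  rfl

/-- The sign operator as an equivalence. -/
def signEquiv : Tot V ≃ₗ[k] Tot V := LinearEquiv.ofInvolutive (signOp V) signOp_signOp

/-- The identification of `sV` and `V`, twisted by a power of the sign operator. -/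
def twist : ℕ → (Tot (susp V) ≃ₗ[k] Tot V)
  | 0 => desusp V
  | j + 1 => (signEquiv (susp V)).trans (twist j)

lemma twist_succ (j : ℕ) (x : Tot (susp V)) :
    twist V (j + 1) x = twist V j (signOp (susp V) x) := rfl

lemma twist_add (j l : ℕ) (x : Tot (susp V)) :
    twist V (j + l) x = twist V j ((signOp (susp V) ^ l) x) := by
  induction l generalizing x with
  | zero => rfl
  | succ l ih => rw [← add_assoc, twist_succ, ih, pow_succ, Module.End.mul_apply]

lemma signOp_desusp (x : Tot (susp V)) :
    signOp V (desusp V x) = -desusp V (signOp (susp V) x) := by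
  have h0 := LinearMap.congr_fun (parityProj_desusp V 0) x
  have h1 := LinearMap.congr_fun (parityProj_desusp V 1) x
  simp only [LinearMap.comp_apply, zero_add, show (1 + 1 : ZMod 2) = 0 from rfl,
    LinearEquiv.coe_coe] at h0 h1
  rw [signOp, signOp, LinearMap.sub_apply, LinearMap.sub_apply, map_sub, ← h0, ← h1]
  abel

lemma signOp_twist (j : ℕ) (x : Tot (susp V)) :
    signOp V (twist V j x) = -twist V j (signOp (susp V) x) := by
  induction j generalizing x with
  | zero => exact signOp_desusp V x
  | succ j ih => rw [twist_succ, twist_succ, ih]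

/-- One sign is that of the suspended differential, and each sign operator passed by the
differential gives another. -/
lemma totD_twist (j : ℕ) (x : Tot (susp V)) :
    totD V (twist V j x) = (-1 : k) ^ (j + 1) • twist V j (totD (susp V) x) := by
  induction j generalizing x with
  | zero =>
    rw [zero_add, pow_one, neg_one_smul]
    exact totD_desusp V x
  | succ j ih =>
    rw [twist_succ, twist_succ, ih, totD_signOp, map_neg, pow_succ (-1 : k) (j + 1), mul_neg_one,
      neg_smul, smul_neg]

variable {V W} in
lemma totMap_twist (f : V ⟶ W) (j : ℕ) (x : Tot (susp V)) :
    totMap f (twist V j x) = twist W j (totMap (f⟦(1 : ℤ)⟧') x) := by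
  induction j generalizing x with
  | zero => exact totMap_desusp f x
  | succ j ih => rw [twist_succ, twist_succ, ih, signOp_totMap]

lemma parityProj_signOp_apply {a : ZMod 2} {x : Tot V} (h : parityProj V a x = x) :
    parityProj V a (signOp V x) = signOp V x := by
  have := LinearMap.congr_fun (parityProj_signOp V a) x
  simpa [h] using this

lemma parityProj_twist {a : ZMod 2} (j : ℕ) {x : Tot (susp V)}
    (h : parityProj (susp V) a x = x) : parityProj V (a + 1) (twist V j x) = twist V j x := by
  induction j generalizing x with
  | zero =>
    have := LinearMap.congr_fun (parityProj_desusp V a) x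
    simp only [LinearMap.comp_apply, h] at this
    exact this
  | succ j ih => exact ih (parityProj_signOp_apply (susp V) h)

/-- The identification `(sV)^{⊗n} ≅ V^{⊗n}` with its Koszul sign. -/
def desuspPow (n : ℕ) : TPow (susp V) n ≃ₗ[k] TPow V n :=
  -- The exponent counts the later factors, whose desuspensions move past the factor `i`.
  PiTensorProduct.congr fun i : Fin n => twist V (n - 1 - i)

lemma desuspPow_tprod {n : ℕ} (w : Fin n → Tot (susp V)) :
    desuspPow V n (PiTensorProduct.tprod k w) =
      PiTensorProduct.tprod k fun i : Fin n => twist V (n - 1 - i) (w i) :=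
  PiTensorProduct.congr_tprod _ w

lemma desuspPow_eq_map (n : ℕ) (x : TPow (susp V) n) :
    desuspPow V n x = PiTensorProduct.map (fun i : Fin n => (twist V (n - 1 - i)).toLinearMap) x :=
  rfl

lemma tpowSign_pow (n l : ℕ) :
    tpowSign V n ^ l = PiTensorProduct.map fun _ => signOp V ^ l := by
  induction l with
  | zero => exact PiTensorProduct.map_one.symm
  | succ l ih => rw [pow_succ, ih, tpowSign, Module.End.mul_eq_comp, ← PiTensorProduct.map_comp]; rfl

/-- The `b` desuspensions of the right tensor move past the whole left tensor. -/
lemma desuspPow_concat {a b : ℕ} (x : TPow (susp V) a) (y : TPow (susp V) b) :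
    desuspPow V (a + b) (concat (susp V) a b x y) =
      concat V a b (desuspPow V a ((tpowSign (susp V) a ^ b) x)) (desuspPow V b y) := by
  rw [desuspPow_eq_map, map_concat, desuspPow_eq_map, desuspPow_eq_map, tpowSign_pow,
    ← LinearMap.comp_apply (PiTensorProduct.map _) (PiTensorProduct.map _),
    ← PiTensorProduct.map_comp]
  have h1 : (fun i : Fin a => (twist V (a + b - 1 - (Fin.castAdd b i : ℕ))).toLinearMap) =
      fun i : Fin a => (twist V (a - 1 - i)).toLinearMap ∘ₗ signOp (susp V) ^ b := by
    funext i
    refine LinearMap.ext fun z => ?_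
    have := i.isLt
    rw [Fin.val_castAdd, show a + b - 1 - (i : ℕ) = a - 1 - i + b by omega]
    exact twist_add V _ _ z
  have h2 : (fun i : Fin b => (twist V (a + b - 1 - (Fin.natAdd a i : ℕ))).toLinearMap) =
      fun i : Fin b => (twist V (b - 1 - i)).toLinearMap := by
    funext i
    rw [Fin.val_natAdd, show a + b - 1 - (a + (i : ℕ)) = b - 1 - i by omega]
  rw [h1, h2]

variable {V W} in
lemma tpowMap_desuspPow (f : V ⟶ W) {n : ℕ} (x : TPow (susp V) n) :
    tpowMap f n (desuspPow V n x) = desuspPow W n (tpowMap (f⟦(1 : ℤ)⟧') n x) := by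
  rw [desuspPow_eq_map, desuspPow_eq_map, tpowMap, tpowMap, ← LinearMap.comp_apply,
    ← LinearMap.comp_apply, ← PiTensorProduct.map_comp, ← PiTensorProduct.map_comp]
  congr 2
  funext i
  exact LinearMap.ext fun z => totMap_twist f _ z

lemma tpowSign_desuspPow {n : ℕ} (x : TPow (susp V) n) :
    tpowSign V n (desuspPow V n x) = (-1 : k) ^ n • desuspPow V n (tpowSign (susp V) n x) := by
  suffices h : tpowSign V n ∘ₗ (desuspPow V n).toLinearMap =
      (-1 : k) ^ n • ((desuspPow V n).toLinearMap ∘ₗ tpowSign (susp V) n) from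
    LinearMap.congr_fun h x
  refine PiTensorProduct.ext (MultilinearMap.ext fun w => ?_)
  simp only [LinearMap.compMultilinearMap_apply, LinearMap.comp_apply, LinearMap.smul_apply,
    LinearEquiv.coe_coe, desuspPow_tprod, tpowSign, PiTensorProduct.map_tprod]
  have : (fun i : Fin n => signOp V (twist V (n - 1 - i) (w i))) =
      fun i : Fin n => (-1 : k) • twist V (n - 1 - i) (signOp (susp V) (w i)) := by
    funext i
    rw [signOp_twist, neg_one_smul]
  rw [this, MultilinearMap.map_smul_univ]
  simp

/-- In the term with `d` in place `i`, the `i` earlier factors give one sign each and the twist at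
`i` gives `n - i` signs. The total `n` does not depend on `i`. -/
lemma tpowD_desuspPow {n : ℕ} (x : TPow (susp V) n) :
    tpowD V n (desuspPow V n x) = (-1 : k) ^ n • desuspPow V n (tpowD (susp V) n x) := by
  suffices h : tpowD V n ∘ₗ (desuspPow V n).toLinearMap =
      (-1 : k) ^ n • ((desuspPow V n).toLinearMap ∘ₗ tpowD (susp V) n) from
    LinearMap.congr_fun h x
  refine PiTensorProduct.ext (MultilinearMap.ext fun w => ?_)
  simp only [LinearMap.compMultilinearMap_apply, LinearMap.comp_apply, LinearMap.smul_apply,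
    LinearEquiv.coe_coe, desuspPow_tprod, tpowD, LinearMap.sum_apply, PiTensorProduct.map_tprod,
    map_sum, Finset.smul_sum]
  refine Finset.sum_congr rfl fun i _ => ?_
  have : (fun j : Fin n => (if j < i then signOp V else if j = i then totD V else LinearMap.id)
      (twist V (n - 1 - j) (w j))) =
      fun j => (if j < i then (-1 : k) else if j = i then (-1) ^ (n - i) else 1) •
        twist V (n - 1 - j) ((if j < i then signOp (susp V) else if j = i then totD (susp V)
          else LinearMap.id) (w j)) := by
    funext j
    split_ifs with h1 h2
    · rw [signOp_twist, neg_one_smul]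
    · subst h2
      have := j.isLt
      rw [totD_twist, show n - 1 - (j : ℕ) + 1 = n - j by omega]
    · rw [one_smul]
      rfl
  rw [this, MultilinearMap.map_smul_univ]
  congr 1
  have h2 : (fun j : Fin n => if j < i then (-1 : k) else if j = i then (-1) ^ (n - i : ℕ) else 1) =
      fun j => (if j < i then (-1 : k) else 1) * if j = i then (-1) ^ (n - i : ℕ) else 1 := by
    funext j
    split_ifs with h1 h2 <;> simp
    exact absurd h2 h1.ne
  rw [h2, Finset.prod_mul_distrib, Finset.prod_ite_eq' Finset.univ i, ← Finset.prod_filter,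
    Finset.prod_const, if_pos (Finset.mem_univ i), ← pow_add]
  congr 1
  have : (Finset.univ.filter fun j => j < i) = Finset.Iio i := by
    ext j
    simp
  rw [this, Fin.card_Iio]
  have := i.isLt
  omega

lemma koszulSign_adjacent {n : ℕ} (i : Fin n) (p : Fin (n + 1) → ZMod 2) :
    koszulSign (Equiv.swap i.castSucc i.succ) p =
      if p i.castSucc = 1 ∧ p i.succ = 1 then -1 else 1 := by
  have key : ∀ a b : Fin (n + 1), a < b → Equiv.swap i.castSucc i.succ b <
      Equiv.swap i.castSucc i.succ a → a = i.castSucc ∧ b = i.succ := by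
    intro a b
    rw [Equiv.swap_apply_def, Equiv.swap_apply_def]
    split_ifs <;> simp only [Fin.lt_def, Fin.ext_iff, Fin.val_castSucc, Fin.val_succ] at * <;> omega
  rw [koszulSign, Finset.prod_eq_single i.castSucc, Finset.prod_eq_single i.succ]
  · simp only [Equiv.swap_apply_left, Equiv.swap_apply_right, Fin.castSucc_lt_succ, true_and]
    exact if_congr and_comm rfl rfl
  · intro b _ hb
    exact if_neg fun h => hb (key _ _ h.1 h.2.1).2
  · simp
  · intro a _ ha
    exact Finset.prod_eq_one fun b _ => if_neg fun h => ha (key _ _ h.1 h.2.1).1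
  · simp

lemma twist_succ_of_parity {a : ZMod 2} (j : ℕ) {x : Tot (susp V)}
    (h : parityProj (susp V) a x = x) :
    twist V (j + 1) x = (if a = 1 then (-1 : k) else 1) • twist V j x := by
  rw [twist_succ, signOp_of_parity _ h, map_smul]

lemma twist_of_parity_succ {a : ZMod 2} (j : ℕ) {x : Tot (susp V)}
    (h : parityProj (susp V) a x = x) :
    twist V j x = (if a = 1 then (-1 : k) else 1) • twist V (j + 1) x := by
  rw [twist_succ_of_parity V j h, smul_smul]
  split_ifs <;> simp

lemma tpow_neg_smul {n : ℕ} (c : k) (x : TPow V n) : -(c • x) = -c • x := (neg_smul c x).symm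

/-- For neighbours of parities `p` and `q` in `sV`, the Koszul exponents `p q` and `(p + 1)(q + 1)`
differ by `p + q + 1` modulo two. The part `p + q` is absorbed because each vector changes its twist
exponent by one, and `1` is the sign of the transposition. -/
lemma desuspPow_act_adjacent {n : ℕ} (i : Fin n) (x : TPow (susp V) (n + 1)) :
    desuspPow V (n + 1) (act (susp V) (Equiv.swap i.castSucc i.succ) x) =
      -act V (Equiv.swap i.castSucc i.succ) (desuspPow V (n + 1) x) := by
  suffices h : (desuspPow V (n + 1)).toLinearMap ∘ₗ act (susp V) (Equiv.swap i.castSucc i.succ) =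
      -(act V (Equiv.swap i.castSucc i.succ) ∘ₗ (desuspPow V (n + 1)).toLinearMap) from
    LinearMap.congr_fun h x
  refine tpow_ext (susp V) fun p w hw => ?_
  simp only [LinearMap.comp_apply, LinearMap.neg_apply, LinearEquiv.coe_coe]
  rw [act_tprod _ _ p w hw, map_smul, desuspPow_tprod, desuspPow_tprod,
    act_tprod V _ (fun j => p j + 1) _ fun j => parityProj_twist V _ (hw j)]
  set s := Equiv.swap i.castSucc i.succ with hs
  have hne : i.castSucc ≠ i.succ := Fin.castSucc_lt_succ.ne
  have h1 : (fun j : Fin (n + 1) => twist V (n + 1 - 1 - j) (w (s j))) =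
      fun j => ((if j = i.castSucc then (if p i.succ = 1 then (-1 : k) else 1) else 1) *
        (if j = i.succ then (if p i.castSucc = 1 then (-1 : k) else 1) else 1)) •
        twist V (n + 1 - 1 - s j) (w (s j)) := by
    funext j
    have := i.isLt
    by_cases hj : j = i.castSucc
    · subst hj
      rw [if_pos rfl, if_neg hne, mul_one, hs, Equiv.swap_apply_left, Fin.val_castSucc,
        Fin.val_succ, show n + 1 - 1 - (i : ℕ) = n + 1 - 1 - (i + 1) + 1 by omega]
      exact twist_succ_of_parity V _ (hw _)
    · by_cases hj' : j = i.succ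
      · subst hj'
        rw [if_pos rfl, if_neg hne.symm, one_mul, hs, Equiv.swap_apply_right, Fin.val_castSucc,
          Fin.val_succ, show n + 1 - 1 - (i : ℕ) = n + 1 - 1 - (i + 1) + 1 by omega]
        exact twist_of_parity_succ V _ (hw _)
      · rw [if_neg hj, if_neg hj', mul_one, one_smul, hs, Equiv.swap_apply_of_ne_of_ne hj hj']
  rw [h1, MultilinearMap.map_smul_univ, Finset.prod_mul_distrib, Finset.prod_ite_eq' Finset.univ,
    Finset.prod_ite_eq' Finset.univ, if_pos (Finset.mem_univ _), if_pos (Finset.mem_univ _),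
    smul_smul, tpow_neg_smul]
  congr 1
  rw [koszulSign_adjacent, koszulSign_adjacent]
  rcases zmod_two_cases (p i.castSucc) with h | h <;> rcases zmod_two_cases (p i.succ) with h' | h' <;>
    simp [h, h', show (1 + 1 : ZMod 2) = 0 from rfl]

/-- Adjacent transpositions generate. Graded symmetric tensors of `sV` thus correspond to invariants
of the signed action, the one that defines the Schur complexes. -/
lemma desuspPow_act {n : ℕ} (σ : Equiv.Perm (Fin n)) (x : TPow (susp V) n) :
    desuspPow V n (act (susp V) σ x) = sgn k σ • act V σ (desuspPow V n x) := by
  cases n with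
  | zero =>
    rw [Subsingleton.elim σ 1, act_one, act_one]
    simp [sgn]
  | succ n =>
    have hσ : σ ∈ Submonoid.closure (Set.range fun i : Fin n => Equiv.swap i.castSucc i.succ) := by
      rw [Equiv.Perm.mclosure_swap_castSucc_succ]
      trivial
    induction hσ using Submonoid.closure_induction generalizing x with
    | mem s hs =>
      obtain ⟨i, rfl⟩ := hs
      rw [desuspPow_act_adjacent, sgn, Equiv.Perm.sign_swap Fin.castSucc_lt_succ.ne,
        Units.val_neg, Units.val_one, Int.cast_neg, Int.cast_one]
      exact (neg_one_smul k _).symm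
    | one =>
      rw [act_one, act_one]
      simp [sgn]
    | mul σ τ _ _ h1 h2 =>
      rw [act_mul, act_mul, LinearMap.comp_apply, LinearMap.comp_apply, h2, h1, map_smul, smul_smul,
        sgn_mul, mul_comm]

end Desuspension

/-! ### The operators on the model complex -/

lemma tpow_cast_refl {k : Type u} [Field k] (V : CochainComplex (ModuleCat.{v} k) ℤ) {n : ℕ}
    (h : n = n) (x : TPow V n) : TensorPower.cast k (Tot V) h x = x := by
  rw [TensorPower.cast_refl, LinearEquiv.refl_apply]

/-! ### Position sets of a block followed by further blocks -/

/-- The set `{0, ..., p - 1} ∪ (p + 1 + J)`. -/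
def consSet (p : ℕ) (J : Finset ℕ) : Finset ℕ := Finset.range p ∪ J.image fun j => p + 1 + j

lemma mem_consSet {p : ℕ} {J : Finset ℕ} {i : ℕ} :
    i ∈ consSet p J ↔ i < p ∨ ∃ j ∈ J, p + 1 + j = i := by
  simp [consSet]

lemma disjoint_consSet (p : ℕ) (J : Finset ℕ) :
    Disjoint (Finset.range p) (J.image fun j => p + 1 + j) := by
  rw [Finset.disjoint_left]
  intro i hi hi'
  obtain ⟨j, -, rfl⟩ := Finset.mem_image.1 hi'
  have := Finset.mem_range.1 hi
  omega

lemma card_consSet (p : ℕ) (J : Finset ℕ) : (consSet p J).card = p + J.card := by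
  rw [consSet, Finset.card_union_of_disjoint (disjoint_consSet p J), Finset.card_range,
    Finset.card_image_of_injective _ (add_right_injective _)]

lemma sum_consSet {M : Type*} [AddCommMonoid M] (p : ℕ) (J : Finset ℕ) (f : ℕ → M) :
    ∑ j ∈ consSet p J, f j = (∑ i : Fin p, f i) + ∑ j ∈ J, f (p + 1 + j) := by
  rw [consSet, Finset.sum_union (disjoint_consSet p J), Finset.sum_range,
    Finset.sum_image fun x _ y _ h => add_right_injective _ h]

/-- A position `j` in the set means that `j` and `j + 1` lie in the same block, so `p`, the end of
the first block, is missing. Cutting this block after `i` loses exactly `i`; this is the reduced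
coproduct on position sets. -/
lemma consSet_consSet {p i : ℕ} (h : i < p) (J : Finset ℕ) :
    consSet i (consSet (p - 1 - i) J) = (consSet p J).erase i := by
  ext a
  simp only [mem_consSet, Finset.mem_erase]
  constructor
  · rintro (ha | ⟨b, hb | ⟨j, hj, rfl⟩, rfl⟩)
    · exact ⟨by omega, Or.inl (by omega)⟩
    · exact ⟨by omega, Or.inl (by omega)⟩
    · exact ⟨by omega, Or.inr ⟨j, hj, by omega⟩⟩
  · rintro ⟨h1, h2 | ⟨j, hj, rfl⟩⟩
    · rcases lt_or_gt_of_ne h1 with h1 | h1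
      · exact Or.inl h1
      · exact Or.inr ⟨a - (i + 1), Or.inl (by omega), by omega⟩
    · exact Or.inr ⟨p - 1 - i + 1 + j, Or.inr ⟨j, hj, rfl⟩, by omega⟩

lemma erase_consSet (p : ℕ) (J : Finset ℕ) (j : ℕ) :
    (consSet p J).erase (p + 1 + j) = consSet p (J.erase j) := by
  ext a
  simp only [mem_consSet, Finset.mem_erase]
  constructor
  · rintro ⟨h1, h2 | ⟨l, hl, rfl⟩⟩
    · exact Or.inl h2
    · exact Or.inr ⟨l, ⟨fun e => h1 (by rw [e]), hl⟩, rfl⟩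
  · rintro (h | ⟨l, ⟨h1, h2⟩, rfl⟩)
    · exact ⟨by omega, Or.inl h⟩
    · exact ⟨by omega, Or.inr ⟨l, h2, rfl⟩⟩

lemma range_sdiff_consSet_of_lt {p i : ℕ} (h : i < p) (J : Finset ℕ) :
    Finset.range i \ consSet p J = ∅ := by
  rw [Finset.sdiff_eq_empty_iff_subset]
  intro a ha
  exact mem_consSet.2 (Or.inl ((Finset.mem_range.1 ha).trans h))

/-- The additional missing position is `p`, the end of the new block. It produces the minus sign of
the graded commutator in `modelD_genOp`. -/
lemma card_range_sdiff_consSet (p : ℕ) (J : Finset ℕ) (j : ℕ) :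
    (Finset.range (p + 1 + j) \ consSet p J).card = (Finset.range j \ J).card + 1 := by
  have : Finset.range (p + 1 + j) \ consSet p J =
      insert p ((Finset.range j \ J).image fun l => p + 1 + l) := by
    ext a
    simp only [Finset.mem_sdiff, Finset.mem_range, mem_consSet, Finset.mem_insert,
      Finset.mem_image]
    constructor
    · rintro ⟨h1, h2⟩
      push Not at h2
      rcases h2.1.eq_or_lt with h | h
      · exact Or.inl h.symm
      · exact Or.inr ⟨a - (p + 1), ⟨by omega, fun h' => h2.2 _ h' (by omega)⟩, by omega⟩
    · rintro (rfl | ⟨l, ⟨h1, h2⟩, rfl⟩)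
      · refine ⟨by omega, ?_⟩
        rintro (h | ⟨l, -, h⟩) <;> omega
      · refine ⟨by omega, ?_⟩
        rintro (h | ⟨l', h, h'⟩)
        · omega
        · exact h2 (by rwa [show l = l' by omega])
  rw [this, Finset.card_insert_of_notMem, Finset.card_image_of_injective _ (add_right_injective _)]
  intro h
  obtain ⟨l, -, h⟩ := Finset.mem_image.1 h
  omega

lemma cobarGen_apply {k : Type u} [Field k] {C : Type v} [AddCommMonoid C] [Module k C]
    (ε d : C →ₗ[k] C) (Δ : C →ₗ[k] C ⊗[k] C) (c : C) :
    cobarGen ε d Δ c = LinearMap.mul' k (TensorAlgebra k C)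
      (TensorProduct.map (TensorAlgebra.ι k ∘ₗ ε) (TensorAlgebra.ι k) (Δ c)) -
        TensorAlgebra.ι k (d c) := rfl

/-! ### The model complex and the action of the cobar construction on it -/

section Model

variable {k : Type u} [Field k] (V W : CochainComplex (ModuleCat.{v} k) ℤ)

/-- The sum of copies of the tensor powers of `V` indexed by finite sets of natural numbers. -/
abbrev Model : Type (max u v) := ⨁ i : ℕ × Finset ℕ, TPow V i.1

instance : AddCommGroup (Model V) := Module.addCommMonoidToAddCommGroup k

/-- The inclusion of a copy of `V^{⊗n}`. -/
def inModel (n : ℕ) (J : Finset ℕ) : TPow V n →ₗ[k] Model V :=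
  DirectSum.lof k (ℕ × Finset ℕ) (fun i => TPow V i.1) (n, J)

variable {V} in
lemma model_ext {M : Type*} [AddCommGroup M] [Module k M] {f g : Model V →ₗ[k] M}
    (h : ∀ n J y, f (inModel V n J y) = g (inModel V n J y)) : f = g :=
  DirectSum.linearMap_ext k fun i => LinearMap.ext fun y => h i.1 i.2 y

variable {V} in
lemma inModel_cast {n m : ℕ} (h : n = m) (J : Finset ℕ) (y : TPow V n) :
    inModel V m J (TensorPower.cast k (Tot V) h y) = inModel V n J y := by
  subst h
  rw [tpow_cast_refl]

/-- The differential of the model. -/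
def modelD : Module.End k (Model V) :=
  DirectSum.toModule k (ℕ × Finset ℕ) (Model V) fun i =>
    -- The copy at `J` stands for `T_J ⊗ V^{⊗n}` with `T_J` of degree `-#J`; both signs are those of
    -- `C_T ⊗ S^T(V)`.
    (-1 : k) ^ i.2.card • (inModel V i.1 i.2 ∘ₗ tpowD V i.1) +
      ∑ j ∈ i.2, (-1 : k) ^ (Finset.range j \ i.2).card • inModel V i.1 (i.2.erase j)

lemma modelD_inModel (n : ℕ) (J : Finset ℕ) (y : TPow V n) :
    modelD V (inModel V n J y) = (-1 : k) ^ J.card • inModel V n J (tpowD V n y) +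
      ∑ j ∈ J, (-1 : k) ^ (Finset.range j \ J).card • inModel V n (J.erase j) y := by
  refine (DirectSum.toModule_lof k (ι := ℕ × Finset ℕ) (M := fun i => TPow V i.1) (n, J) y).trans ?_
  simp only [LinearMap.add_apply, LinearMap.smul_apply, LinearMap.comp_apply, LinearMap.sum_apply]

variable {V W} in
/-- The map of models induced by a morphism of complexes. -/
def modelMap (f : V ⟶ W) : Model V →ₗ[k] Model W :=
  DirectSum.lmap fun i : ℕ × Finset ℕ => tpowMap f i.1

variable {V W} in
lemma modelMap_inModel (f : V ⟶ W) (n : ℕ) (J : Finset ℕ) (y : TPow V n) :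
    modelMap f (inModel V n J y) = inModel W n J (tpowMap f n y) :=
  DirectSum.lmap_lof (ι := ℕ × Finset ℕ) (fun i => tpowMap f i.1) (n, J) y

/-- Concatenation with a tensor on the left. -/
def concOp (p : ℕ) : TPow (susp V) (p + 1) →ₗ[k] Module.End k (Model V) :=
  (DirectSum.toModule k (ℕ × Finset ℕ) (TPow (susp V) (p + 1) →ₗ[k] Model V) fun i =>
    -- The power of the sign operator is the Koszul sign for moving the tensor past an index `J` of
    -- degree `-#J`.
    (((concat V (p + 1) i.1).compr₂ (inModel V (p + 1 + i.1) (consSet p i.2))) ∘ₗ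
      (desuspPow V (p + 1)).toLinearMap ∘ₗ (tpowSign (susp V) (p + 1) ^ i.2.card)).flip).flip

lemma concOp_inModel (p : ℕ) (x : TPow (susp V) (p + 1)) (n : ℕ) (J : Finset ℕ) (y : TPow V n) :
    concOp V p x (inModel V n J y) = inModel V (p + 1 + n) (consSet p J)
      (concat V (p + 1) n (desuspPow V (p + 1) ((tpowSign (susp V) (p + 1) ^ J.card) x)) y) := by
  refine (LinearMap.flip_apply _ _ _).trans ?_
  refine (LinearMap.congr_fun (DirectSum.toModule_lof k (ι := ℕ × Finset ℕ)
    (M := fun i => TPow V i.1) (n, J) y) x).trans ?_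
  rfl

/-- The action of the generators of the cobar construction on the model. -/
def genOp : SymBar (susp V) →ₗ[k] Module.End k (Model V) :=
  DirectSum.toModule k ℕ _ fun p => concOp V p ∘ₗ (symPow (susp V) (p + 1)).subtype

/-- The inclusion of `Sym^{p+1}(sV)`. -/
def inSym (p : ℕ) : symPow V (p + 1) →ₗ[k] SymBar V :=
  DirectSum.lof k ℕ (fun m => symPow V (m + 1)) p

lemma genOp_inSym (p : ℕ) (x : symPow (susp V) (p + 1)) :
    genOp V (inSym (susp V) p x) = concOp V p x.1 :=
  DirectSum.toModule_lof k (ι := ℕ) (M := fun m => symPow (susp V) (m + 1)) p x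

/-- The action of the cobar construction on the model. -/
def cobarOp : CobarSym V →ₐ[k] Module.End k (Model V) := TensorAlgebra.lift k (genOp V)

lemma cobarOp_ι (c : SymBar (susp V)) : cobarOp V (TensorAlgebra.ι k c) = genOp V c :=
  TensorAlgebra.lift_ι_apply _ _

lemma tpowD_tpowSign {n : ℕ} (x : TPow V n) :
    tpowD V n (tpowSign V n x) = -tpowSign V n (tpowD V n x) := by
  suffices h : tpowD V n ∘ₗ tpowSign V n = -(tpowSign V n ∘ₗ tpowD V n) from
    LinearMap.congr_fun h x
  refine PiTensorProduct.ext (MultilinearMap.ext fun w => ?_)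
  simp only [LinearMap.compMultilinearMap_apply, LinearMap.comp_apply, LinearMap.neg_apply,
    tpowSign, PiTensorProduct.map_tprod, tpowD, LinearMap.sum_apply, map_sum]
  rw [← Finset.sum_neg_distrib]
  refine Finset.sum_congr rfl fun i _ => ?_
  have : (fun j : Fin n => (if j < i then signOp V else if j = i then totD V else LinearMap.id)
      (signOp V (w j))) = fun j => (if j = i then (-1 : k) else 1) • signOp V
        ((if j < i then signOp V else if j = i then totD V else LinearMap.id) (w j)) := by
    funext j
    split_ifs with h1 h2 h2
    · exact absurd h2 h1.ne
    · rw [one_smul]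
    · rw [totD_signOp, neg_one_smul]
    · rw [one_smul]
      rfl
  rw [this, MultilinearMap.map_smul_univ, Finset.prod_ite_eq' Finset.univ i,
    if_pos (Finset.mem_univ i)]
  exact neg_one_smul k _

lemma tpowD_tpowSign_pow {n : ℕ} (l : ℕ) (x : TPow V n) :
    tpowD V n ((tpowSign V n ^ l) x) = (-1 : k) ^ l • (tpowSign V n ^ l) (tpowD V n x) := by
  induction l generalizing x with
  | zero => simp
  | succ l ih =>
    rw [pow_succ, Module.End.mul_apply, ih, tpowD_tpowSign, map_neg, Module.End.mul_apply,
      pow_succ (-1 : k), mul_neg_one, ← tpow_neg_smul, smul_neg]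

lemma tpowSign_pow_concat {a b : ℕ} (l : ℕ) (x : TPow V a) (y : TPow V b) :
    (tpowSign V (a + b) ^ l) (concat V a b x y) =
      concat V a b ((tpowSign V a ^ l) x) ((tpowSign V b ^ l) y) := by
  induction l generalizing x y with
  | zero => rfl
  | succ l ih =>
    rw [pow_succ, Module.End.mul_apply, tpowSign_concat, ih, pow_succ, pow_succ,
      Module.End.mul_apply, Module.End.mul_apply]

/-- The part of the coproduct in `Sym^a ⊗ Sym^b` acts on the model as the concatenation with its
image in `(sV)^{⊗(a + b)}`. -/
lemma cobarOp_product (i i' : ℕ) (t : symPow (susp V) (i + 1) ⊗[k] symPow (susp V) (i' + 1))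
    (n : ℕ) (J : Finset ℕ) (y : TPow V n) :
    cobarOp V (LinearMap.mul' k (CobarSym V) (TensorProduct.map
      (TensorAlgebra.ι k ∘ₗ symBarSign (susp V)) (TensorAlgebra.ι k)
        (TensorProduct.map (inSym (susp V) i) (inSym (susp V) i') t))) (inModel V n J y) =
      inModel V (i + 1 + (i' + 1) + n) (consSet i (consSet i' J))
        (concat V (i + 1 + (i' + 1)) n (desuspPow V (i + 1 + (i' + 1))
          ((tpowSign (susp V) (i + 1 + (i' + 1)) ^ J.card) (TensorPower.mulEquiv
            (TensorProduct.map (symPow (susp V) (i + 1)).subtype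
              (symPow (susp V) (i' + 1)).subtype t)))) y) := by
  induction t using TensorProduct.induction_on with
  | zero => simp
  | add t t' h h' => simp only [map_add, LinearMap.add_apply, h, h']
  | tmul c c' =>
    have h1 : symBarSign (susp V) (inSym (susp V) i c) =
        inSym (susp V) i (symSign (susp V) (i + 1) c) :=
      DirectSum.lmap_lof (ι := ℕ) (fun n => symSign (susp V) (n + 1)) i c
    have h2 : (symSign (susp V) (i + 1) c).1 = tpowSign (susp V) (i + 1) c.1 := rfl
    rw [TensorProduct.map_tmul, TensorProduct.map_tmul, LinearMap.mul'_apply, map_mul,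
      LinearMap.comp_apply, cobarOp_ι, cobarOp_ι, h1, genOp_inSym, genOp_inSym,
      Module.End.mul_apply, concOp_inModel, concOp_inModel, ← concat_assoc, inModel_cast,
      TensorProduct.map_tmul, card_consSet, h2, ← concat_apply, tpowSign_pow_concat,
      desuspPow_concat, ← Module.End.mul_apply, ← Module.End.mul_apply, ← pow_succ, ← pow_add]
    -- The left factor receives `i' + #J` signs from passing `consSet i' J` and one from `(-1)^(deg
    -- c')` in the cobar differential. Desuspending the concatenation asks for `i' + 1` and `#J`.
    rw [show i' + J.card + 1 = i' + 1 + J.card by omega]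
    rfl

lemma inModel_concat_cast {N N' : ℕ} (h : N = N') (K : Finset ℕ) (l n : ℕ)
    (x : TPow (susp V) N) (y : TPow V n) :
    inModel V (N' + n) K (concat V N' n (desuspPow V N' ((tpowSign (susp V) N' ^ l)
      (TensorPower.cast k (Tot (susp V)) h x))) y) =
      inModel V (N + n) K (concat V N n (desuspPow V N ((tpowSign (susp V) N ^ l) x)) y) := by
  subst h
  rw [tpow_cast_refl]

/-- Since the coproduct is deconcatenation, concatenating its parts gives back `x` in every summand;
only the position set records where the block was cut. -/
lemma cobarOp_cobarGen [CharZero k] (p : ℕ) (x : symPow (susp V) (p + 1)) (n : ℕ) (J : Finset ℕ)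
    (y : TPow V n) :
    cobarOp V (cobarGen (symBarSign (susp V)) (symBarD (susp V)) (symBarComul (susp V))
      (inSym (susp V) p x)) (inModel V n J y) =
      (∑ i : Fin p, inModel V (p + 1 + n) ((consSet p J).erase i) (concat V (p + 1) n
        (desuspPow V (p + 1) ((tpowSign (susp V) (p + 1) ^ J.card) x.1)) y)) -
      inModel V (p + 1 + n) (consSet p J) (concat V (p + 1) n (desuspPow V (p + 1)
        ((tpowSign (susp V) (p + 1) ^ J.card) (tpowD (susp V) (p + 1) x.1))) y) := by
  have h1 : symBarComul (susp V) (inSym (susp V) p x) = ∑ i : Fin p,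
      TensorProduct.map (inSym (susp V) i) (inSym (susp V) (p - 1 - i))
        (symComul (susp V) (i + 1) (p - 1 - i + 1) (p + 1) (by omega) x) := by
    refine (DirectSum.toModule_lof k (ι := ℕ) (M := fun m => symPow (susp V) (m + 1)) p x).trans ?_
    rw [LinearMap.sum_apply]
    rfl
  have h2 : symBarD (susp V) (inSym (susp V) p x) = inSym (susp V) p (symD (susp V) (p + 1) x) :=
    DirectSum.lmap_lof (ι := ℕ) (fun n => symD (susp V) (n + 1)) p x
  have h3 : (symD (susp V) (p + 1) x).1 = tpowD (susp V) (p + 1) x.1 := rfl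
  have h4 : cobarOp V (TensorAlgebra.ι k (inSym (susp V) p (symD (susp V) (p + 1) x))) =
      concOp V p (tpowD (susp V) (p + 1) x.1) := by
    rw [cobarOp_ι, genOp_inSym, h3]
  let F : SymBar (susp V) ⊗[k] SymBar (susp V) →ₗ[k] Model V :=
    LinearMap.applyₗ (inModel V n J y) ∘ₗ (cobarOp V).toLinearMap ∘ₗ
      LinearMap.mul' k (CobarSym V) ∘ₗ TensorProduct.map
        (TensorAlgebra.ι k ∘ₗ symBarSign (susp V)) (TensorAlgebra.ι k)
  rw [cobarGen_apply, h2, map_sub, h4, LinearMap.sub_apply, concOp_inModel]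
  refine congrArg (fun z => z - _) ?_
  change F (symBarComul (susp V) (inSym (susp V) p x)) = _
  rw [h1, map_sum F]
  refine Finset.sum_congr rfl fun i _ => ?_
  refine (cobarOp_product V i (p - 1 - i) _ n J y).trans ?_
  rw [map_subtype_symComul, LinearEquiv.apply_symm_apply,
    inModel_concat_cast, consSet_consSet i.isLt]

/-- Removing one of the first `p` positions cuts the new block and gives the coproduct. Removing a
later position, or differentiating the right tensor, gives the term in which `modelD` acts first.
Differentiating the left tensor gives `- s⁻¹ (d c)`. -/
lemma modelD_genOp [CharZero k] (c : SymBar (susp V)) :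
    modelD V * genOp V c = cobarOp V (cobarGen (symBarSign (susp V)) (symBarD (susp V))
      (symBarComul (susp V)) c) - genOp V (symBarSign (susp V) c) * modelD V := by
  suffices h : LinearMap.mulLeft k (modelD V) ∘ₗ genOp V =
      (cobarOp V).toLinearMap ∘ₗ cobarGen (symBarSign (susp V)) (symBarD (susp V))
        (symBarComul (susp V)) -
      LinearMap.mulRight k (modelD V) ∘ₗ genOp V ∘ₗ symBarSign (susp V) from
    LinearMap.congr_fun h c
  refine DirectSum.linearMap_ext k fun p => LinearMap.ext fun x => model_ext fun n J y => ?_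
  change modelD V (genOp V (inSym (susp V) p x) (inModel V n J y)) =
    cobarOp V (cobarGen (symBarSign (susp V)) (symBarD (susp V)) (symBarComul (susp V))
      (inSym (susp V) p x)) (inModel V n J y) -
    genOp V (symBarSign (susp V) (inSym (susp V) p x)) (modelD V (inModel V n J y))
  have h1 : symBarSign (susp V) (inSym (susp V) p x) =
      inSym (susp V) p (symSign (susp V) (p + 1) x) :=
    DirectSum.lmap_lof (ι := ℕ) (fun n => symSign (susp V) (n + 1)) p x
  have h2 : (symSign (susp V) (p + 1) x).1 = tpowSign (susp V) (p + 1) x.1 := rfl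
  rw [h1, genOp_inSym, genOp_inSym, concOp_inModel, modelD_inModel, modelD_inModel,
    cobarOp_cobarGen, h2, sum_consSet, tpowD_concat, map_add (concOp V p _),
    map_sum (concOp V p _), map_smul (concOp V p _), concOp_inModel, map_add (inModel V _ _),
    tpowD_desuspPow, tpowSign_desuspPow, tpowD_tpowSign_pow, card_consSet]
  have e1 : ∀ i : Fin p, (-1 : k) ^ (Finset.range (i : ℕ) \ consSet p J).card = 1 := fun i => by
    rw [range_sdiff_consSet_of_lt i.isLt, Finset.card_empty, pow_zero]
  have e2 : ∀ j ∈ J, concOp V p (tpowSign (susp V) (p + 1) x.1)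
      ((-1 : k) ^ (Finset.range j \ J).card • inModel V n (J.erase j) y) =
      -((-1 : k) ^ (Finset.range (p + 1 + j) \ consSet p J).card •
        inModel V (p + 1 + n) ((consSet p J).erase (p + 1 + j)) (concat V (p + 1) n
          (desuspPow V (p + 1) ((tpowSign (susp V) (p + 1) ^ J.card) x.1)) y)) := fun j hj => by
    rw [map_smul, concOp_inModel, card_range_sdiff_consSet, erase_consSet,
      ← Module.End.mul_apply, ← pow_succ, Finset.card_erase_add_one hj, pow_succ (-1 : k),
      mul_neg_one, neg_smul, neg_neg]
  rw [Finset.sum_congr rfl e2, Finset.sum_neg_distrib]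
  simp only [e1, one_smul]
  have e3 : tpowSign (susp V) (p + 1) ((tpowSign (susp V) (p + 1) ^ J.card) x.1) =
      (tpowSign (susp V) (p + 1) ^ J.card) (tpowSign (susp V) (p + 1) x.1) := by
    rw [← Module.End.mul_apply, ← Module.End.mul_apply, ← pow_succ, ← pow_succ']
  rw [e3]
  simp only [map_smul, LinearMap.smul_apply, smul_add, smul_smul]
  rw [show (-1 : k) ^ (p + J.card) * ((-1) ^ (p + 1) * (-1) ^ J.card) = -1 by
    rw [← pow_add, ← pow_add]
    exact Odd.neg_one_pow ⟨p + J.card, by ring⟩,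
    show (-1 : k) ^ (p + J.card) * (-1) ^ (p + 1) = -(-1) ^ J.card by
      rw [← pow_add, show p + J.card + (p + 1) = 2 * p + 1 + J.card by ring, pow_add, pow_succ,
        pow_mul]
      simp,
    neg_one_smul, neg_smul]
  abel

end Model

/-! ### The map from the cobar construction to the model -/

/-- The relation passes to scalars, sums and products, so it only has to be checked on generators.
-/
lemma mul_map_eq_of_leibniz {k : Type*} [Field k] {C A : Type*} [AddCommMonoid C] [Module k C]
    [Ring A] [Algebra k A] (φ : TensorAlgebra k C →ₐ[k] A) (m : A)
    (δ : TensorAlgebra k C →ₗ[k] TensorAlgebra k C) (s : TensorAlgebra k C →ₐ[k] TensorAlgebra k C)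
    (hδ : ∀ r, δ (algebraMap k _ r) = 0) (hmul : ∀ x y, δ (x * y) = δ x * y + s x * δ y)
    (hs : ∀ r, s (algebraMap k _ r) = algebraMap k _ r)
    (hι : ∀ c, m * φ (TensorAlgebra.ι k c) =
      φ (δ (TensorAlgebra.ι k c)) + φ (s (TensorAlgebra.ι k c)) * m) (x : TensorAlgebra k C) :
    m * φ x = φ (δ x) + φ (s x) * m := by
  induction x using TensorAlgebra.induction with
  | algebraMap r =>
    rw [hδ, hs, AlgHom.commutes, map_zero, zero_add]
    exact (Algebra.commutes r m).symm
  | ι c => exact hι c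
  | mul x y hx hy =>
    rw [map_mul, ← mul_assoc, hx, add_mul, mul_assoc, hy, hmul, map_add, map_mul, map_mul, map_mul,
      map_mul, mul_add, add_assoc, mul_assoc]
  | add x y hx hy =>
    rw [map_add, mul_add, hx, hy, map_add, map_add, map_add, map_add, add_mul]
    abel

section ToModel

variable {k : Type u} [Field k] (V W : CochainComplex (ModuleCat.{v} k) ℤ)

lemma cobarSymD_algebraMap (r : k) : cobarSymD V (algebraMap k (CobarSym V) r) = 0 := by
  simp [cobarSymD, cobarD, Matrix.algebraMap_matrix_apply]

lemma modelD_cobarOp [CharZero k] (x : CobarSym V) :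
    modelD V * cobarOp V x = cobarOp V (cobarSymD V x) +
      cobarOp V (cobarSign (symBarSign (susp V)) x) * modelD V := by
  refine mul_map_eq_of_leibniz (cobarOp V) (modelD V) (cobarSymD V)
    (cobarSign (symBarSign (susp V))) (cobarSymD_algebraMap V) (fun x y => cobarD_mul _ _ _ x y)
    (fun r => AlgHom.commutes _ r) (fun c => ?_) x
  have h : cobarSign (symBarSign (susp V)) (TensorAlgebra.ι k c) =
      -TensorAlgebra.ι k (symBarSign (susp V) c) := TensorAlgebra.lift_ι_apply _ _
  have h2 : cobarOp V (-TensorAlgebra.ι k (symBarSign (susp V) c)) =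
      -cobarOp V (TensorAlgebra.ι k (symBarSign (susp V) c)) := map_neg _ _
  rw [h, h2, cobarOp_ι, cobarOp_ι, cobarSymD, cobarD_ι, modelD_genOp]
  exact (sub_eq_add_neg _ _).trans (congrArg _ (LinearMap.ext fun _ => rfl))

/-- The image of `1` in the model. -/
def modelOne : Model V := inModel V 0 ∅ (PiTensorProduct.tprod k Fin.elim0)

/-- The map from the cobar construction to the model. -/
def toModel : CobarSym V →ₗ[k] Model V :=
  LinearMap.applyₗ (modelOne V) ∘ₗ (cobarOp V).toLinearMap

lemma toModel_apply (x : CobarSym V) : toModel V x = cobarOp V x (modelOne V) := rfl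

lemma toModel_mul (x y : CobarSym V) : toModel V (x * y) = cobarOp V x (toModel V y) := by
  rw [toModel_apply, map_mul]
  rfl

lemma modelD_modelOne : modelD V (modelOne V) = 0 := by
  rw [modelOne, modelD_inModel, Finset.sum_empty, tpowD]
  simp

/-- The commutation relation is applied to `modelOne`, which is a cycle. -/
lemma modelD_toModel [CharZero k] (x : CobarSym V) :
    modelD V (toModel V x) = toModel V (cobarSymD V x) := by
  have h := LinearMap.congr_fun (modelD_cobarOp V x) (modelOne V)
  refine h.trans ?_
  rw [LinearMap.add_apply, Module.End.mul_apply, modelD_modelOne, map_zero, add_zero]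
  rfl

variable {V W} in
lemma modelMap_genOp (f : V ⟶ W) (c : SymBar (susp V)) (z : Model V) :
    modelMap f (genOp V c z) = genOp W (symBarMap (f⟦(1 : ℤ)⟧') c) (modelMap f z) := by
  suffices h : (genOp V).compr₂ (modelMap f) =
      (genOp W).compl₁₂ (symBarMap (f⟦(1 : ℤ)⟧')) (modelMap f) from
    LinearMap.congr_fun (LinearMap.congr_fun h c) z
  refine DirectSum.linearMap_ext k fun p => LinearMap.ext fun x => model_ext fun n J y => ?_
  change modelMap f (genOp V (inSym (susp V) p x) (inModel V n J y)) =
    genOp W (symBarMap (f⟦(1 : ℤ)⟧') (inSym (susp V) p x)) (modelMap f (inModel V n J y))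
  have h1 : symBarMap (f⟦(1 : ℤ)⟧') (inSym (susp V) p x) =
      inSym (susp W) p (symMap (f⟦(1 : ℤ)⟧') (p + 1) x) :=
    DirectSum.lmap_lof (ι := ℕ) (fun n => symMap (f⟦(1 : ℤ)⟧') (n + 1)) p x
  have h2 : (symMap (f⟦(1 : ℤ)⟧') (p + 1) x).1 = tpowMap (f⟦(1 : ℤ)⟧') (p + 1) x.1 := rfl
  have h3 : ∀ (l : ℕ) (z : TPow (susp V) (p + 1)),
      tpowMap (f⟦(1 : ℤ)⟧') (p + 1) ((tpowSign (susp V) (p + 1) ^ l) z) =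
        (tpowSign (susp W) (p + 1) ^ l) (tpowMap (f⟦(1 : ℤ)⟧') (p + 1) z) := by
    intro l
    induction l with
    | zero => exact fun z => rfl
    | succ l ih =>
      intro z
      rw [pow_succ, Module.End.mul_apply, ih, pow_succ, Module.End.mul_apply]
      congr 1
      rw [tpowMap, tpowSign, tpowSign, ← LinearMap.comp_apply, ← LinearMap.comp_apply,
        ← PiTensorProduct.map_comp, ← PiTensorProduct.map_comp]
      congr 2
      funext i
      exact LinearMap.ext fun v => (signOp_totMap (f⟦(1 : ℤ)⟧') v).symm
  rw [h1, genOp_inSym, genOp_inSym, concOp_inModel, modelMap_inModel, modelMap_inModel,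
    concOp_inModel, h2, tpowMap_concat, tpowMap_desuspPow, h3]

variable {V W} in
lemma modelMap_toModel (f : V ⟶ W) (x : CobarSym V) :
    modelMap f (toModel V x) = toModel W (cobarSymMap f x) := by
  have key : ∀ (x : CobarSym V) (z : Model V),
      modelMap f (cobarOp V x z) = cobarOp W (cobarSymMap f x) (modelMap f z) := by
    intro x
    induction x using TensorAlgebra.induction with
    | algebraMap r =>
      intro z
      rw [cobarSymMap, cobarMap, AlgHom.toLinearMap_apply, AlgHom.commutes, AlgHom.commutes,
        AlgHom.commutes]
      exact map_smul (modelMap f) r z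
    | ι c =>
      intro z
      have h : cobarSymMap f (TensorAlgebra.ι k c) =
        TensorAlgebra.ι k (symBarMap (f⟦(1 : ℤ)⟧') c) := TensorAlgebra.lift_ι_apply _ _
      rw [h, cobarOp_ι, cobarOp_ι, modelMap_genOp]
    | mul x y hx hy =>
      intro z
      have h : cobarSymMap f (x * y) = cobarSymMap f x * cobarSymMap f y := map_mul (M := CobarSym V)
        (TensorAlgebra.lift k (TensorAlgebra.ι k ∘ₗ symBarMap (f⟦(1 : ℤ)⟧'))) x y
      rw [h, map_mul, map_mul, Module.End.mul_apply, Module.End.mul_apply, hx, hy]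
    | add x y hx hy =>
      intro z
      rw [map_add, map_add, map_add, LinearMap.add_apply, LinearMap.add_apply, map_add, hx, hy]
  have h1 : modelMap f (modelOne V) = modelOne W := by
    rw [modelOne, modelMap_inModel, modelOne, tpowMap, PiTensorProduct.map_tprod]
    congr 2
    funext i
    exact i.elim0
  rw [toModel_apply, key, h1]
  rfl

end ToModel

/-! ### Words -/

/-- The sum of the `p + 1` for the letters `p` of a word. -/
def wordLen : List ℕ → ℕ
  | [] => 0
  | p :: w => p + 1 + wordLen w

/-- The set of the positions inside the blocks of a word. -/
def wordSet : List ℕ → Finset ℕ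
  | [] => ∅
  | p :: w => consSet p (wordSet w)

/-- The letter `p` is the least number missing from `consSet p J`. -/
lemma consSet_injective {p p' : ℕ} {J J' : Finset ℕ} (h : consSet p J = consSet p' J') :
    p = p' ∧ J = J' := by
  have h1 : ∀ {p p' : ℕ} {J J' : Finset ℕ}, consSet p J = consSet p' J' → p' ≤ p := by
    intro p p' J J' h
    by_contra! hlt
    have : p ∈ consSet p J := h ▸ mem_consSet.2 (Or.inl hlt)
    rcases mem_consSet.1 this with h | ⟨j, -, h⟩ <;> omega
  have hp : p = p' := le_antisymm (h1 h.symm) (h1 h)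
  subst hp
  refine ⟨rfl, Finset.ext fun j => ?_⟩
  have h2 : ∀ J : Finset ℕ, j ∈ J ↔ p + 1 + j ∈ consSet p J := fun J => by
    rw [mem_consSet]
    constructor
    · exact fun hj => Or.inr ⟨j, hj, rfl⟩
    · rintro (h | ⟨l, hl, h⟩)
      · omega
      · rwa [show j = l by omega]
  rw [h2, h, ← h2]

lemma word_ext {w w' : List ℕ} (h : wordLen w = wordLen w') (h' : wordSet w = wordSet w') :
    w = w' := by
  induction w generalizing w' with
  | nil =>
    cases w' with
    | nil => rfl
    | cons p w' =>
      simp only [wordLen] at h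
      omega
  | cons p w ih =>
    cases w' with
    | nil =>
      simp only [wordLen] at h
      omega
    | cons p' w' =>
      obtain ⟨rfl, hJ⟩ := consSet_injective h'
      rw [ih (by simpa [wordLen] using h) hJ]

/-- The first block ends at the least position missing from `J`, and the rest follows by induction.
The bound on `J` says that the last position `n - 1` ends a block, so such a position exists when `n
> 0`. -/
lemma exists_word (n : ℕ) (J : Finset ℕ) (hJ : ∀ j ∈ J, j + 1 < n) :
    ∃ w, wordLen w = n ∧ wordSet w = J := by
  induction n using Nat.strong_induction_on generalizing J with
  | h n ih =>
    rcases Nat.eq_zero_or_pos n with rfl | hn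
    · refine ⟨[], rfl, ?_⟩
      rw [wordSet, eq_comm, Finset.eq_empty_iff_forall_notMem]
      exact fun j hj => absurd (hJ j hj) (by omega)
    · have hex : ∃ i, i ∉ J := ⟨n - 1, fun h => absurd (hJ _ h) (by omega)⟩
      set p := Nat.find hex with hp
      have hpJ : p ∉ J := Nat.find_spec hex
      have hlt : ∀ i < p, i ∈ J := fun i hi => not_not.1 (Nat.find_min hex hi)
      have hpn : p ≤ n - 1 := Nat.find_min' hex fun h => absurd (hJ _ h) (by omega)
      obtain ⟨w, hw, hw'⟩ := ih (n - (p + 1)) (by omega)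
        ((J.filter fun j => p + 1 ≤ j).image fun j => j - (p + 1)) (by
          intro j hj
          obtain ⟨i, hi, rfl⟩ := Finset.mem_image.1 hj
          have h1 := Finset.mem_filter.1 hi
          have := hJ i h1.1
          omega)
      refine ⟨p :: w, by simp only [wordLen]; omega, ?_⟩
      rw [wordSet, hw']
      ext a
      rw [mem_consSet]
      constructor
      · rintro (h | ⟨j, hj, rfl⟩)
        · exact hlt a h
        · obtain ⟨i, hi, rfl⟩ := Finset.mem_image.1 hj
          have h1 := Finset.mem_filter.1 hi
          rw [show p + 1 + (i - (p + 1)) = i by omega]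
          exact h1.1
      · intro ha
        rcases lt_trichotomy a p with h | h | h
        · exact Or.inl h
        · exact absurd (h ▸ ha) hpJ
        · exact Or.inr ⟨a - (p + 1), Finset.mem_image.2 ⟨a, Finset.mem_filter.2 ⟨ha, h⟩, rfl⟩,
            by omega⟩

section Words

variable {k : Type u} [Field k] (V : CochainComplex (ModuleCat.{v} k) ℤ)

lemma symProj_of_mem [CharZero k] {n : ℕ} {x : TPow V n} (hx : x ∈ symPow V n) :
    symProj V n x = ⟨x, hx⟩ := by
  refine Subtype.ext ?_
  change ((n.factorial : k)⁻¹ • ∑ σ : Equiv.Perm (Fin n), act V σ) x = x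
  rw [LinearMap.smul_apply, LinearMap.sum_apply, Finset.sum_congr rfl fun σ _ => hx σ,
    Finset.sum_const, Finset.card_univ, Fintype.card_perm, Fintype.card_fin,
    ← Nat.cast_smul_eq_nsmul k, smul_smul,
    inv_mul_cancel₀ (Nat.cast_ne_zero.mpr n.factorial_ne_zero), one_smul]

/-- The map to the cobar construction given by a word. -/
def fromWord : (w : List ℕ) → TPow V (wordLen w) →ₗ[k] CobarSym V
  | [] => Algebra.linearMap k (CobarSym V) ∘ₗ
      (PiTensorProduct.isEmptyEquiv (R := k) (s := fun _ : Fin 0 => Tot V) (Fin 0)).toLinearMap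
  | p :: w => LinearMap.mul' k (CobarSym V) ∘ₗ
      TensorProduct.map (TensorAlgebra.ι k ∘ₗ inSym (susp V) p ∘ₗ symProj (susp V) (p + 1) ∘ₗ
        (tpowSign (susp V) (p + 1) ^ (wordSet w).card) ∘ₗ (desuspPow V (p + 1)).symm.toLinearMap)
        (fromWord w) ∘ₗ
      (TensorPower.mulEquiv (R := k) (M := Tot V) (n := p + 1) (m := wordLen w)).symm.toLinearMap

lemma fromWord_nil (x : Fin 0 → Tot V) : fromWord V [] (PiTensorProduct.tprod k x) = 1 := by
  change algebraMap k (CobarSym V) (PiTensorProduct.isEmptyEquiv (Fin 0)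
    (PiTensorProduct.tprod k x)) = 1
  rw [PiTensorProduct.isEmptyEquiv_apply_tprod, map_one]

lemma fromWord_concat (p : ℕ) (w : List ℕ) (x : TPow V (p + 1)) (y : TPow V (wordLen w)) :
    fromWord V (p :: w) (concat V (p + 1) (wordLen w) x y) =
      TensorAlgebra.ι k (inSym (susp V) p (symProj (susp V) (p + 1)
        ((tpowSign (susp V) (p + 1) ^ (wordSet w).card) ((desuspPow V (p + 1)).symm x)))) *
      fromWord V w y := by
  change LinearMap.mul' k (CobarSym V) (TensorProduct.map _ _
    (TensorPower.mulEquiv.symm (concat V (p + 1) (wordLen w) x y))) = _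
  rw [mulEquiv_symm_concat]
  rfl

open Classical in
/-- The map from the model to the cobar construction. -/
def fromModel : Model V →ₗ[k] CobarSym V :=
  DirectSum.toModule k (ℕ × Finset ℕ) (CobarSym V) fun i =>
    if h : ∃ w, wordLen w = i.1 ∧ wordSet w = i.2 then
      fromWord V h.choose ∘ₗ (TensorPower.cast k (Tot V) h.choose_spec.1.symm).toLinearMap
    -- A filler on copies which belong to no word; these do not meet the image of `toModel`.
    else 0

lemma fromModel_inModel (w : List ℕ) (y : TPow V (wordLen w)) :
    fromModel V (inModel V (wordLen w) (wordSet w) y) = fromWord V w y := by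
  refine (DirectSum.toModule_lof k (ι := ℕ × Finset ℕ) (M := fun i => TPow V i.1)
    (wordLen w, wordSet w) y).trans ?_
  have h : ∃ w', wordLen w' = wordLen w ∧ wordSet w' = wordSet w := ⟨w, rfl, rfl⟩
  rw [dif_pos h]
  have key : ∀ (w' : List ℕ) (h : w' = w) (h' : wordLen w = wordLen w'),
      fromWord V w' (TensorPower.cast k (Tot V) h' y) = fromWord V w y := by
    rintro w' rfl h'
    rw [tpow_cast_refl]
  exact key _ (word_ext h.choose_spec.1 h.choose_spec.2) _

/-! ### Tensors invariant along blocks -/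

/-- The tensors which are fixed by the signed action of the transpositions of `j` and `j + 1`. -/
def IsInvariant {n : ℕ} (J : Finset ℕ) (y : TPow V n) : Prop :=
  ∀ (j : ℕ) (h : j + 1 < n), j ∈ J → swapAct V ⟨j, j.lt_succ_self.trans h⟩ ⟨j + 1, h⟩ y = y

/-- The part of the model given by the words. -/
def wordPart : Submodule k (Model V) :=
  Submodule.span k {z | ∃ (w : List ℕ) (y : TPow V (wordLen w)), IsInvariant V (wordSet w) y ∧
    z = inModel V (wordLen w) (wordSet w) y}

lemma tpowSign_pow_mem {n : ℕ} (l : ℕ) {x : TPow V n} (hx : x ∈ symPow V n) :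
    (tpowSign V n ^ l) x ∈ symPow V n := by
  induction l generalizing x with
  | zero => exact hx
  | succ l ih =>
    rw [pow_succ, Module.End.mul_apply]
    exact ih fun σ => by rw [act_tpowSign, hx σ]

lemma swapAct_desuspPow {n : ℕ} {i j : Fin n} (h : i ≠ j) (x : TPow (susp V) n) :
    swapAct V i j (desuspPow V n x) = desuspPow V n (act (susp V) (Equiv.swap i j) x) := by
  rw [swapAct_eq h, LinearMap.neg_apply, desuspPow_act, sgn, Equiv.Perm.sign_swap h,
    Units.val_neg, Units.val_one, Int.cast_neg, Int.cast_one]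
  exact (neg_one_smul k _).symm

/-- Each transposition to be checked acts inside the new block, where `x` is symmetric, or inside
the right tensor. None crosses the border, because `p` is missing from `consSet p J`. -/
lemma isInvariant_concat {p n : ℕ} {J : Finset ℕ} {x : TPow (susp V) (p + 1)}
    (hx : x ∈ symPow (susp V) (p + 1)) {y : TPow V n} (hy : IsInvariant V J y) :
    IsInvariant V (consSet p J) (concat V (p + 1) n (desuspPow V (p + 1) x) y) := by
  intro j h hj
  rcases mem_consSet.1 hj with hj | ⟨l, hl, rfl⟩
  · have hne : (⟨j, by omega⟩ : Fin (p + 1)) ≠ ⟨j + 1, by omega⟩ := by simp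
    refine (swapAct_castAdd_concat hne _ _).trans ?_
    rw [swapAct_desuspPow V hne, hx]
  · have hne : (⟨l, by omega⟩ : Fin n) ≠ ⟨l + 1, by omega⟩ := by simp
    refine (swapAct_natAdd_concat hne _ _).trans ?_
    rw [hy l _ hl]

lemma genOp_mem_wordPart (c : SymBar (susp V)) {z : Model V} (hz : z ∈ wordPart V) :
    genOp V c z ∈ wordPart V := by
  induction c using DirectSum.induction_on with
  | zero =>
    rw [map_zero]
    exact Submodule.zero_mem _
  | add c c' h h' =>
    rw [map_add]
    exact Submodule.add_mem _ h h'
  | of p x =>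
    induction hz using Submodule.span_induction with
    | mem z hz =>
      obtain ⟨w, y, hy, rfl⟩ := hz
      have h := (congrArg (fun f => f (inModel V (wordLen w) (wordSet w) y))
        (genOp_inSym V p x)).trans (concOp_inModel V p x.1 _ _ y)
      refine Submodule.subset_span ⟨p :: w, _, ?_, h⟩
      exact isInvariant_concat V (tpowSign_pow_mem (susp V) _ x.2) hy
    | zero =>
      rw [map_zero]
      exact Submodule.zero_mem _
    | add z z' _ _ h h' =>
      rw [map_add]
      exact Submodule.add_mem _ h h'
    | smul r z _ h =>
      rw [map_smul]
      exact Submodule.smul_mem _ r h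

lemma modelOne_mem_wordPart : modelOne V ∈ wordPart V :=
  Submodule.subset_span ⟨[], PiTensorProduct.tprod k Fin.elim0,
    fun j _ hj => absurd hj (Finset.notMem_empty j), rfl⟩

lemma cobarOp_mem_wordPart (x : CobarSym V) {z : Model V} (hz : z ∈ wordPart V) :
    cobarOp V x z ∈ wordPart V := by
  induction x using TensorAlgebra.induction generalizing z with
  | algebraMap r =>
    rw [AlgHom.commutes]
    exact Submodule.smul_mem _ r hz
  | ι c =>
    rw [cobarOp_ι]
    exact genOp_mem_wordPart V c hz
  | mul x y hx hy =>
    rw [map_mul]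
    exact hx (hy hz)
  | add x y hx hy =>
    rw [map_add]
    exact Submodule.add_mem _ (hx hz) (hy hz)

lemma toModel_mem_wordPart (x : CobarSym V) : toModel V x ∈ wordPart V :=
  cobarOp_mem_wordPart V x (modelOne_mem_wordPart V)

lemma tpowSign_pow_tpowSign_pow {n : ℕ} (l : ℕ) (x : TPow V n) :
    (tpowSign V n ^ l) ((tpowSign V n ^ l) x) = x := by
  have h : tpowSign V n * tpowSign V n = 1 := LinearMap.ext tpowSign_tpowSign
  rw [← Module.End.mul_apply, ← pow_add, ← two_mul, pow_mul, pow_two, h, one_pow]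
  rfl

/-- A generator prepends a letter to the word. The sign powers cancel, and the averaging map fixes
tensors which are already symmetric. -/
lemma fromModel_genOp [CharZero k] (c : SymBar (susp V)) {z : Model V} (hz : z ∈ wordPart V) :
    fromModel V (genOp V c z) = TensorAlgebra.ι k c * fromModel V z := by
  induction c using DirectSum.induction_on with
  | zero => simp
  | add c c' h h' => rw [map_add, LinearMap.add_apply, map_add, h, h', map_add, add_mul]
  | of p x =>
    induction hz using Submodule.span_induction with
    | mem z hz =>
      obtain ⟨w, y, hy, rfl⟩ := hz
      have h := (congrArg (fun f => f (inModel V (wordLen w) (wordSet w) y))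
        (genOp_inSym V p x)).trans (concOp_inModel V p x.1 _ _ y)
      refine (congrArg (fromModel V) h).trans ((fromModel_inModel V (p :: w) _).trans ?_)
      rw [fromWord_concat, LinearEquiv.symm_apply_apply, tpowSign_pow_tpowSign_pow,
        symProj_of_mem _ x.2, fromModel_inModel]
      rfl
    | zero => simp
    | add z z' _ _ h h' => rw [map_add, map_add, h, h', map_add, mul_add]
    | smul r z _ h => rw [map_smul, map_smul, h, map_smul, mul_smul_comm]

lemma fromModel_cobarOp [CharZero k] (x : CobarSym V) {z : Model V} (hz : z ∈ wordPart V) :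
    fromModel V (cobarOp V x z) = x * fromModel V z := by
  induction x using TensorAlgebra.induction generalizing z with
  | algebraMap r =>
    rw [AlgHom.commutes]
    exact (map_smul (fromModel V) r z).trans (Algebra.smul_def r _)
  | ι c =>
    rw [cobarOp_ι]
    exact fromModel_genOp V c hz
  | mul x y hx hy =>
    rw [map_mul, Module.End.mul_apply, hx (cobarOp_mem_wordPart V y hz), hy hz, mul_assoc]
  | add x y hx hy => rw [map_add, LinearMap.add_apply, map_add, hx hz, hy hz, add_mul]

lemma fromModel_toModel [CharZero k] (x : CobarSym V) : fromModel V (toModel V x) = x := by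
  rw [toModel_apply, fromModel_cobarOp V x (modelOne_mem_wordPart V)]
  have h : fromModel V (modelOne V) = 1 := (fromModel_inModel V [] _).trans (fromWord_nil V _)
  rw [h, mul_one]

end Words

/-! ### The image of the cobar construction in the model -/

/-- In a basis of `M`, `t` becomes a family of vectors of `N` on which the operators act separately.
This reduces invariance of a tensor along several blocks to invariance in one factor. -/
lemma TensorProduct.map_id_eq_of_fixed {k M N : Type*} [Field k] [AddCommGroup M] [Module k M]
    [AddCommGroup N] [Module k N] {ι : Type*} (s : ι → Module.End k N) (f : Module.End k N)
    (hf : ∀ y, (∀ i, s i y = y) → f y = y) (t : M ⊗[k] N)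
    (ht : ∀ i, TensorProduct.map LinearMap.id (s i) t = t) :
    TensorProduct.map LinearMap.id f t = t := by
  classical
  let b := Module.Basis.ofVectorSpace k M
  have key : ∀ (g : Module.End k N) (t : M ⊗[k] N) i,
      TensorProduct.equivFinsuppOfBasisLeft b (TensorProduct.map LinearMap.id g t) i =
        g (TensorProduct.equivFinsuppOfBasisLeft b t i) := by
    intro g t i
    induction t using TensorProduct.induction_on with
    | zero => simp
    | tmul m n => simp
    | add t t' h h' => simp only [map_add, Finsupp.add_apply, h, h']
  refine (TensorProduct.equivFinsuppOfBasisLeft b).injective (Finsupp.ext fun i => ?_)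
  rw [key]
  refine hf _ fun j => ?_
  rw [← key, ht]

lemma TensorProduct.map_eq_of_fixed_left {k M N : Type*} [Field k] [AddCommGroup M] [Module k M]
    [AddCommGroup N] [Module k N] {ι : Type*} (s : ι → Module.End k N) (f : Module.End k N)
    (hf : ∀ y, (∀ i, s i y = y) → f y = y) (t : N ⊗[k] M)
    (ht : ∀ i, TensorProduct.map (s i) LinearMap.id t = t) :
    TensorProduct.map f LinearMap.id t = t := by
  have key : ∀ (g : Module.End k N) (t : N ⊗[k] M), TensorProduct.comm k N M
      (TensorProduct.map g LinearMap.id t) =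
      TensorProduct.map LinearMap.id g (TensorProduct.comm k N M t) := fun g t =>
    (TensorProduct.map_comm LinearMap.id g t).symm
  refine (TensorProduct.comm k N M).injective ?_
  rw [key]
  refine TensorProduct.map_id_eq_of_fixed s f hf _ fun i => ?_
  rw [← key, ht]

section Image

variable {k : Type u} [Field k] (V : CochainComplex (ModuleCat.{v} k) ℤ)

lemma mem_symPow_of_adjacent {n : ℕ} {x : TPow V (n + 1)}
    (hx : ∀ i : Fin n, act V (Equiv.swap i.castSucc i.succ) x = x) : x ∈ symPow V (n + 1) := by
  intro σ
  have hσ : σ ∈ Submonoid.closure (Set.range fun i : Fin n => Equiv.swap i.castSucc i.succ) := by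
    rw [Equiv.Perm.mclosure_swap_castSucc_succ]
    trivial
  induction hσ using Submonoid.closure_induction with
  | mem s hs =>
    obtain ⟨i, rfl⟩ := hs
    exact hx i
  | one => rw [act_one, LinearMap.id_apply]
  | mul σ τ _ _ h1 h2 => rw [act_mul, LinearMap.comp_apply, h1, h2]

/-- The averaging operator for the signed action. -/
def average (p : ℕ) : Module.End k (TPow V (p + 1)) :=
  (desuspPow V (p + 1)).toLinearMap ∘ₗ (symPow (susp V) (p + 1)).subtype ∘ₗ
    symProj (susp V) (p + 1) ∘ₗ (desuspPow V (p + 1)).symm.toLinearMap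

lemma average_eq [CharZero k] (p : ℕ) (y : TPow V (p + 1))
    (hy : ∀ i : Fin p, swapAct V i.castSucc i.succ y = y) : average V p y = y := by
  have h : (desuspPow V (p + 1)).symm y ∈ symPow (susp V) (p + 1) := by
    refine mem_symPow_of_adjacent (susp V) fun i => (desuspPow V (p + 1)).injective ?_
    rw [← swapAct_desuspPow V Fin.castSucc_lt_succ.ne, LinearEquiv.apply_symm_apply, hy]
  change desuspPow V (p + 1) (symProj (susp V) (p + 1) ((desuspPow V (p + 1)).symm y)).1 = y
  rw [symProj_of_mem _ h, LinearEquiv.apply_symm_apply]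

/-- The averaging operator over the blocks of a word. -/
def blockAverage : (w : List ℕ) → Module.End k (TPow V (wordLen w))
  | [] => LinearMap.id
  | p :: w => (TensorPower.mulEquiv (R := k) (M := Tot V) (n := p + 1)
      (m := wordLen w)).toLinearMap ∘ₗ TensorProduct.map (average V p) (blockAverage w) ∘ₗ
      (TensorPower.mulEquiv (R := k) (M := Tot V) (n := p + 1) (m := wordLen w)).symm.toLinearMap

lemma blockAverage_concat (p : ℕ) (w : List ℕ) (x : TPow V (p + 1)) (y : TPow V (wordLen w)) :
    blockAverage V (p :: w) (concat V (p + 1) (wordLen w) x y) =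
      concat V (p + 1) (wordLen w) (average V p x) (blockAverage V w y) := by
  change TensorPower.mulEquiv (TensorProduct.map _ _
    (TensorPower.mulEquiv.symm (concat V (p + 1) (wordLen w) x y))) = _
  rw [mulEquiv_symm_concat]
  rfl

lemma map_swapAct_id {a b : ℕ} {i j : Fin a} (h : i ≠ j) (t : TPow V a ⊗[k] TPow V b) :
    TensorPower.mulEquiv (TensorProduct.map (swapAct V i j) LinearMap.id t) =
      swapAct V (Fin.castAdd b i) (Fin.castAdd b j) (TensorPower.mulEquiv t) := by
  induction t using TensorProduct.induction_on with
  | zero => simp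
  | add t t' h h' => rw [map_add, map_add, h, h', map_add, map_add]
  | tmul x y => exact (swapAct_castAdd_concat h x y).symm

lemma map_id_swapAct {a b : ℕ} {i j : Fin b} (h : i ≠ j) (t : TPow V a ⊗[k] TPow V b) :
    TensorPower.mulEquiv (TensorProduct.map LinearMap.id (swapAct V i j) t) =
      swapAct V (Fin.natAdd a i) (Fin.natAdd a j) (TensorPower.mulEquiv t) := by
  induction t using TensorProduct.induction_on with
  | zero => simp
  | add t t' h h' => rw [map_add, map_add, h, h', map_add, map_add]
  | tmul x y => exact (swapAct_natAdd_concat h x y).symm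

/-- The positions of the first block make the tensor invariant in the left factor; the shifted
positions do so in the right factor, where induction applies. -/
lemma blockAverage_eq [CharZero k] (w : List ℕ) (y : TPow V (wordLen w))
    (hy : IsInvariant V (wordSet w) y) : blockAverage V w y = y := by
  induction w with
  | nil => rfl
  | cons p w ih =>
    set t := (TensorPower.mulEquiv (R := k) (M := Tot V) (n := p + 1) (m := wordLen w)).symm y
      with ht
    have hty : TensorPower.mulEquiv t = y := LinearEquiv.apply_symm_apply _ y
    have h1 : TensorProduct.map (average V p) LinearMap.id t = t := by
      refine TensorProduct.map_eq_of_fixed_left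
        (fun i : Fin p => swapAct V i.castSucc i.succ) _ (average_eq V p) t fun i => ?_
      apply (TensorPower.mulEquiv (R := k) (M := Tot V)).injective
      rw [map_swapAct_id V Fin.castSucc_lt_succ.ne, hty]
      have := i.isLt
      exact hy i (by simp only [wordLen]; omega) (mem_consSet.2 (Or.inl i.isLt))
    have h2 : TensorProduct.map LinearMap.id (blockAverage V w) t = t := by
      refine TensorProduct.map_id_eq_of_fixed
        (fun i : {j // j ∈ wordSet w ∧ j + 1 < wordLen w} =>
          swapAct V ⟨i.1, i.1.lt_succ_self.trans i.2.2⟩ ⟨i.1 + 1, i.2.2⟩) _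
        (fun y hy => ih y fun j h hj => hy ⟨j, hj, h⟩) t fun i => ?_
      apply (TensorPower.mulEquiv (R := k) (M := Tot V)).injective
      rw [map_id_swapAct V (by simp), hty]
      have := i.2.2
      exact hy (p + 1 + i.1) (by simp only [wordLen]; omega)
        (mem_consSet.2 (Or.inr ⟨i.1, i.2.1, rfl⟩))
    have h3 : TensorProduct.map (average V p) (blockAverage V w) t = t := by
      have := TensorProduct.map_comp (average V p) LinearMap.id LinearMap.id (blockAverage V w)
      rw [LinearMap.comp_id, LinearMap.id_comp] at this
      rw [this, LinearMap.comp_apply, h2, h1]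
    change TensorPower.mulEquiv (TensorProduct.map (average V p) (blockAverage V w) t) = y
    rw [h3, hty]

lemma toModel_one : toModel V 1 = modelOne V := by
  rw [toModel_apply, map_one]
  rfl

/-- Each letter of `fromWord` averages its block and `toModel` concatenates the results. The two
desuspensions and the two sign powers cancel. -/
lemma toModel_fromWord (w : List ℕ) (y : TPow V (wordLen w)) :
    toModel V (fromWord V w y) =
      inModel V (wordLen w) (wordSet w) (blockAverage V w y) := by
  induction w with
  | nil =>
    suffices h : toModel V ∘ₗ fromWord V [] = inModel V 0 ∅ from LinearMap.congr_fun h y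
    refine PiTensorProduct.ext (MultilinearMap.ext fun (x : Fin 0 → Tot V) => ?_)
    refine (congrArg (toModel V) (fromWord_nil V x)).trans ?_
    rw [toModel_one, modelOne, Subsingleton.elim x Fin.elim0]
    rfl
  | cons p w ih =>
    suffices h : (toModel V ∘ₗ fromWord V (p :: w)) ∘ₗ (TensorPower.mulEquiv (R := k) (M := Tot V)
        (n := p + 1) (m := wordLen w)).toLinearMap =
        (inModel V (wordLen (p :: w)) (wordSet (p :: w)) ∘ₗ blockAverage V (p :: w)) ∘ₗ
        (TensorPower.mulEquiv (R := k) (M := Tot V) (n := p + 1) (m := wordLen w)).toLinearMap by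
      obtain ⟨t, rfl⟩ := (TensorPower.mulEquiv (R := k) (M := Tot V)
        (n := p + 1) (m := wordLen w)).surjective y
      exact LinearMap.congr_fun h t
    refine TensorProduct.ext' fun x y => ?_
    change toModel V (fromWord V (p :: w) (concat V (p + 1) (wordLen w) x y)) =
      inModel V (wordLen (p :: w)) (wordSet (p :: w))
        (blockAverage V (p :: w) (concat V (p + 1) (wordLen w) x y))
    rw [fromWord_concat, toModel_mul, ih, cobarOp_ι, genOp_inSym, concOp_inModel,
      blockAverage_concat]
    have h : ∀ (l : ℕ) (z : TPow (susp V) (p + 1)), (symProj (susp V) (p + 1)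
        ((tpowSign (susp V) (p + 1) ^ l) z)).1 =
        (tpowSign (susp V) (p + 1) ^ l) (symProj (susp V) (p + 1) z).1 := by
      intro l z
      have h1 : ∀ (σ : Equiv.Perm (Fin (p + 1))) (l : ℕ) (z : TPow (susp V) (p + 1)),
          act (susp V) σ ((tpowSign (susp V) (p + 1) ^ l) z) =
          (tpowSign (susp V) (p + 1) ^ l) (act (susp V) σ z) := by
        intro σ l
        induction l with
        | zero => exact fun z => rfl
        | succ l ih =>
          intro z
          rw [pow_succ, Module.End.mul_apply, ih, Module.End.mul_apply, act_tpowSign]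
      change (((p + 1).factorial : k)⁻¹ • ∑ σ : Equiv.Perm (Fin (p + 1)), act (susp V) σ) _ =
        (tpowSign (susp V) (p + 1) ^ l)
          ((((p + 1).factorial : k)⁻¹ • ∑ σ : Equiv.Perm (Fin (p + 1)), act (susp V) σ) z)
      rw [LinearMap.smul_apply, LinearMap.sum_apply, LinearMap.smul_apply, LinearMap.sum_apply,
        map_smul, map_sum]
      exact congrArg _ (Finset.sum_congr rfl fun σ _ => h1 σ l z)
    rw [h, tpowSign_pow_tpowSign_pow]
    rfl

/-- The image of the cobar construction contains all invariant tensors. -/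
lemma inModel_mem_range [CharZero k] {n : ℕ} {J : Finset ℕ} (hJ : ∀ j ∈ J, j + 1 < n)
    {y : TPow V n} (hy : IsInvariant V J y) :
    inModel V n J y ∈ LinearMap.range (toModel V) := by
  obtain ⟨w, rfl, rfl⟩ := exists_word n J hJ
  exact ⟨fromWord V w y, by rw [toModel_fromWord, blockAverage_eq V w y hy]⟩

lemma lt_wordLen {w : List ℕ} {j : ℕ} (hj : j ∈ wordSet w) : j + 1 < wordLen w := by
  induction w generalizing j with
  | nil => exact absurd hj (Finset.notMem_empty j)
  | cons p w ih =>
    simp only [wordLen]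
    rcases mem_consSet.1 hj with h | ⟨l, hl, rfl⟩
    · omega
    · have := ih hl
      omega

end Image

/-! ### Degrees -/

section Degrees

variable {k : Type u} [Field k] (V : CochainComplex (ModuleCat.{v} k) ℤ)

lemma parityProj_of_mem_totDeg {g : ℤ} {x : Tot V} (hx : x ∈ totDeg V g) :
    parityProj V (g : ZMod 2) x = x := by
  obtain ⟨y, rfl⟩ := hx
  rw [parityProj, DirectSum.lmap_lof, if_pos rfl, LinearMap.id_apply]

lemma signOp_mem_totDeg {g : ℤ} {x : Tot V} (hx : x ∈ totDeg V g) : signOp V x ∈ totDeg V g := by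
  rw [signOp_of_parity V (parityProj_of_mem_totDeg V hx)]
  exact Submodule.smul_mem _ _ hx

lemma twist_mem_totDeg_iff (j : ℕ) {g : ℤ} {x : Tot (susp V)} :
    twist V j x ∈ totDeg V (g + 1) ↔ x ∈ totDeg (susp V) g := by
  induction j generalizing x with
  | zero =>
    rw [← map_desusp_totDeg]
    constructor
    · rintro ⟨y, hy, h⟩
      rwa [← (desusp V).injective h]
    · exact fun h => ⟨x, h, rfl⟩
  | succ j ih =>
    rw [twist_succ, ih]
    refine ⟨fun h => ?_, signOp_mem_totDeg _⟩
    rw [← signOp_signOp x]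
    exact signOp_mem_totDeg _ h

lemma desuspPow_mem_tpowDeg {n : ℕ} {q : ℤ} {x : TPow (susp V) n}
    (hx : x ∈ tpowDeg (susp V) n q) : desuspPow V n x ∈ tpowDeg V n (q + n) := by
  induction hx using Submodule.span_induction with
  | mem x hx =>
    obtain ⟨g, w, hw, rfl, rfl⟩ := hx
    rw [desuspPow_tprod]
    refine Submodule.subset_span ⟨fun i => g i + 1, _, fun i => ?_, ?_, rfl⟩
    · exact (twist_mem_totDeg_iff V _).2 (hw i)
    · rw [Finset.sum_add_distrib]
      simp
  | zero =>
    rw [map_zero]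
    exact Submodule.zero_mem _
  | add x y _ _ h h' =>
    rw [map_add]
    exact Submodule.add_mem _ h h'
  | smul r x _ h =>
    rw [map_smul]
    exact Submodule.smul_mem _ r h

lemma desuspPow_symm_mem_tpowDeg {n : ℕ} {q : ℤ} {x : TPow V n} (hx : x ∈ tpowDeg V n q) :
    (desuspPow V n).symm x ∈ tpowDeg (susp V) n (q - n) := by
  induction hx using Submodule.span_induction with
  | mem x hx =>
    obtain ⟨g, w, hw, rfl, rfl⟩ := hx
    refine Submodule.subset_span ⟨fun i => g i - 1, fun i => (twist V (n - 1 - i)).symm (w i),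
      fun i => ?_, ?_, ?_⟩
    · rw [← twist_mem_totDeg_iff V (n - 1 - i), LinearEquiv.apply_symm_apply, sub_add_cancel]
      exact hw i
    · rw [Finset.sum_sub_distrib]
      simp
    · rw [LinearEquiv.symm_apply_eq, desuspPow_tprod]
      simp only [LinearEquiv.apply_symm_apply]
  | zero =>
    rw [map_zero]
    exact Submodule.zero_mem _
  | add x y _ _ h h' =>
    rw [map_add]
    exact Submodule.add_mem _ h h'
  | smul r x _ h =>
    rw [map_smul]
    exact Submodule.smul_mem _ r h

lemma tpowSign_pow_mem_tpowDeg {n : ℕ} (l : ℕ) {q : ℤ} {x : TPow V n} (hx : x ∈ tpowDeg V n q) :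
    (tpowSign V n ^ l) x ∈ tpowDeg V n q := by
  induction l generalizing x with
  | zero => exact hx
  | succ l ih =>
    rw [pow_succ, Module.End.mul_apply]
    refine ih ?_
    induction hx using Submodule.span_induction with
    | mem x hx =>
      obtain ⟨g, w, hw, rfl, rfl⟩ := hx
      rw [tpowSign, PiTensorProduct.map_tprod]
      exact Submodule.subset_span ⟨g, _, fun i => signOp_mem_totDeg V (hw i), rfl, rfl⟩
    | zero =>
      rw [map_zero]
      exact Submodule.zero_mem _
    | add x y _ _ h h' =>
      rw [map_add]
      exact Submodule.add_mem _ h h'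
    | smul r x _ h =>
      rw [map_smul]
      exact Submodule.smul_mem _ r h

lemma act_mem_tpowDeg {n : ℕ} (σ : Equiv.Perm (Fin n)) {q : ℤ} {x : TPow V n}
    (hx : x ∈ tpowDeg V n q) : act V σ x ∈ tpowDeg V n q := by
  induction hx using Submodule.span_induction with
  | mem x hx =>
    obtain ⟨g, w, hw, rfl, rfl⟩ := hx
    rw [act_tprod V σ _ w fun i => parityProj_of_mem_totDeg V (hw i)]
    exact Submodule.smul_mem _ _ (Submodule.subset_span
      ⟨fun i => g (σ i), _, fun i => hw (σ i), Equiv.sum_comp σ g, rfl⟩)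
  | zero =>
    rw [map_zero]
    exact Submodule.zero_mem _
  | add x y _ _ h h' =>
    rw [map_add]
    exact Submodule.add_mem _ h h'
  | smul r x _ h =>
    rw [map_smul]
    exact Submodule.smul_mem _ r h

lemma algAct_mem_tpowDeg {n : ℕ} (a : SymAlg k n) {q : ℤ} {x : TPow V n}
    (hx : x ∈ tpowDeg V n q) : algAct V a x ∈ tpowDeg V n q := by
  rw [algAct, LinearMap.sum_apply]
  exact Submodule.sum_mem _ fun σ _ => Submodule.smul_mem _ _ (act_mem_tpowDeg V σ hx)

lemma symProj_mem_tpowDeg {n : ℕ} {q : ℤ} {x : TPow V n} (hx : x ∈ tpowDeg V n q) :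
    (symProj V n x).1 ∈ tpowDeg V n q := by
  change ((n.factorial : k)⁻¹ • ∑ σ : Equiv.Perm (Fin n), act V σ) x ∈ _
  rw [LinearMap.smul_apply, LinearMap.sum_apply]
  exact Submodule.smul_mem _ _ (Submodule.sum_mem _ fun σ _ => act_mem_tpowDeg V σ hx)

lemma concat_mem_tpowDeg {a b : ℕ} {p q : ℤ} {x : TPow V a} {y : TPow V b}
    (hx : x ∈ tpowDeg V a p) (hy : y ∈ tpowDeg V b q) :
    concat V a b x y ∈ tpowDeg V (a + b) (p + q) := by
  induction hx using Submodule.span_induction with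
  | mem x hx =>
    obtain ⟨g, w, hw, rfl, rfl⟩ := hx
    induction hy using Submodule.span_induction with
    | mem y hy =>
      obtain ⟨g', w', hw', rfl, rfl⟩ := hy
      rw [concat_tprod]
      refine Submodule.subset_span ⟨Fin.append g g', _, fun i => ?_, ?_, rfl⟩
      · refine Fin.addCases (fun i => ?_) (fun i => ?_) i
        · rw [Fin.append_left, Fin.append_left]
          exact hw i
        · rw [Fin.append_right, Fin.append_right]
          exact hw' i
      · rw [Fin.sum_univ_add]
        simp
    | zero =>
      rw [map_zero]
      exact Submodule.zero_mem _
    | add x y _ _ h h' =>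
      rw [map_add]
      exact Submodule.add_mem _ h h'
    | smul r x _ h =>
      rw [map_smul]
      exact Submodule.smul_mem _ r h
  | zero =>
    rw [map_zero, LinearMap.zero_apply]
    exact Submodule.zero_mem _
  | add x y _ _ h h' =>
    rw [map_add, LinearMap.add_apply]
    exact Submodule.add_mem _ h h'
  | smul r x _ h =>
    rw [map_smul, LinearMap.smul_apply]
    exact Submodule.smul_mem _ r h

lemma tpowDeg_concat_induction {a b : ℕ} {q : ℤ} {M : Submodule k (TPow V (a + b))}
    (h : ∀ (p p' : ℤ) (x : TPow V a) (y : TPow V b), x ∈ tpowDeg V a p → y ∈ tpowDeg V b p' →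
      p + p' = q → concat V a b x y ∈ M) : tpowDeg V (a + b) q ≤ M := by
  refine Submodule.span_le.2 ?_
  rintro _ ⟨g, w, hw, rfl, rfl⟩
  have hs : w = Fin.append (fun i => w (Fin.castAdd b i)) fun i => w (Fin.natAdd a i) := by
    funext i
    refine Fin.addCases (fun i => ?_) (fun i => ?_) i <;> simp
  rw [hs, ← concat_tprod]
  exact h (∑ i, g (Fin.castAdd b i)) (∑ i, g (Fin.natAdd a i)) _ _
    (Submodule.subset_span ⟨_, _, fun i => hw _, rfl, rfl⟩)
    (Submodule.subset_span ⟨_, _, fun i => hw _, rfl, rfl⟩) (Fin.sum_univ_add g).symm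

lemma ι_mul_mem_cobarDeg {C : Type v} [AddCommMonoid C] [Module k C] {deg : ℤ → Submodule k C}
    {p q : ℤ} {c : C} (hc : c ∈ deg q) {x : TensorAlgebra k C} (hx : x ∈ cobarDeg deg p) :
    TensorAlgebra.ι k c * x ∈ cobarDeg deg (q + 1 + p) := by
  induction hx using Submodule.span_induction with
  | mem x hx =>
    obtain ⟨r, g, d, hd, rfl, rfl⟩ := hx
    refine Submodule.subset_span ⟨r + 1, Fin.cons q g, Fin.cons c d, fun i => ?_, ?_, ?_⟩
    · refine Fin.cases ?_ (fun i => ?_) i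
      · simpa using hc
      · simpa using hd i
    · rw [Fin.sum_univ_succ]
      simp
    · rw [List.ofFn_succ, List.prod_cons]
      simp
  | zero =>
    rw [mul_zero]
    exact Submodule.zero_mem _
  | add x y _ _ h h' =>
    rw [mul_add]
    exact Submodule.add_mem _ h h'
  | smul r x _ h =>
    rw [mul_smul_comm]
    exact Submodule.smul_mem _ r h

lemma inSym_mem_symBarDeg {p : ℕ} {q : ℤ} {x : symPow V (p + 1)}
    (hx : x.1 ∈ tpowDeg V (p + 1) q) : inSym V p x ∈ symBarDeg V q := by
  refine (Submodule.mem_iInf _).2 fun n => ?_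
  change (DirectSum.component k ℕ (fun m => symPow V (m + 1)) n
    (DirectSum.lof k ℕ (fun m => symPow V (m + 1)) p x)).1 ∈ tpowDeg V (n + 1) q
  by_cases h : p = n
  · subst h
    rw [DirectSum.component.lof_self]
    exact hx
  · rw [DirectSum.component.of, dif_neg h]
    exact Submodule.zero_mem _

/-- A block of degree `a` in `V^{⊗(p+1)}` has degree `a - (p + 1)` in the suspended power, so its
generator has degree `a - p`. The block contributes exactly `p` positions to `wordSet`. -/
lemma fromWord_mem_cobarSymDeg (w : List ℕ) {q : ℤ} {y : TPow V (wordLen w)}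
    (hy : y ∈ tpowDeg V (wordLen w) q) :
    fromWord V w y ∈ cobarSymDeg V (q - (wordSet w).card) := by
  induction w generalizing q with
  | nil =>
    suffices h : tpowDeg V 0 q ≤ (cobarSymDeg V q).comap (fromWord V []) by
      rw [wordSet, Finset.card_empty, Nat.cast_zero, sub_zero]
      exact h hy
    refine Submodule.span_le.2 ?_
    rintro _ ⟨g, x, -, rfl, rfl⟩
    change fromWord V [] (PiTensorProduct.tprod k x) ∈ cobarSymDeg V (∑ i, g i)
    rw [fromWord_nil]
    exact Submodule.subset_span ⟨0, Fin.elim0, Fin.elim0, fun i => i.elim0, by simp, by simp⟩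
  | cons p w ih =>
    suffices h : tpowDeg V (p + 1 + wordLen w) q ≤
      (cobarSymDeg V (q - (wordSet (p :: w)).card)).comap (fromWord V (p :: w)) from h hy
    refine tpowDeg_concat_induction V fun a b x y hx hy hq => ?_
    change fromWord V (p :: w) (concat V (p + 1) (wordLen w) x y) ∈
      cobarSymDeg V (q - (wordSet (p :: w)).card)
    have hc : (((wordSet (p :: w)).card : ℕ) : ℤ) = p + (wordSet w).card := by
      rw [wordSet, card_consSet]
      push_cast
      rfl
    rw [fromWord_concat, hc, ← hq, show a + b - (p + (wordSet w).card : ℤ) =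
      a - ((p + 1 : ℕ) : ℤ) + 1 + (b - (wordSet w).card) by push_cast; ring]
    exact ι_mul_mem_cobarDeg (inSym_mem_symBarDeg (susp V) (symProj_mem_tpowDeg (susp V)
      (tpowSign_pow_mem_tpowDeg (susp V) _ (desuspPow_symm_mem_tpowDeg V hx)))) (ih hy)

/-- The elements of degree `p` of the model. -/
def modelDeg (p : ℤ) : Submodule k (Model V) :=
  Submodule.span k {z | ∃ (n : ℕ) (J : Finset ℕ) (y : TPow V n),
    y ∈ tpowDeg V n (p + J.card) ∧ z = inModel V n J y}

lemma component_mem_of_mem_modelDeg {p : ℤ} {z : Model V} (hz : z ∈ modelDeg V p)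
    (i : ℕ × Finset ℕ) : z i ∈ tpowDeg V i.1 (p + i.2.card) := by
  suffices h : modelDeg V p ≤ (tpowDeg V i.1 (p + i.2.card)).comap
    (DirectSum.component k (ℕ × Finset ℕ) (fun i => TPow V i.1) i) from h hz
  refine Submodule.span_le.2 ?_
  rintro _ ⟨n, J, y, hy, rfl⟩
  change DirectSum.component k (ℕ × Finset ℕ) (fun i => TPow V i.1) i
    (DirectSum.lof k (ℕ × Finset ℕ) (fun i => TPow V i.1) (n, J) y) ∈
      tpowDeg V i.1 (p + i.2.card)
  by_cases h : (n, J) = i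
  · subst h
    rw [DirectSum.component.lof_self]
    exact hy
  · rw [DirectSum.component.of, dif_neg h]
    exact Submodule.zero_mem _

lemma fromModel_mem_cobarSymDeg {p : ℤ} {z : Model V} (hz : z ∈ modelDeg V p) :
    fromModel V z ∈ cobarSymDeg V p := by
  suffices h : modelDeg V p ≤ (cobarSymDeg V p).comap (fromModel V) from h hz
  refine Submodule.span_le.2 ?_
  rintro _ ⟨n, J, y, hy, rfl⟩
  change fromModel V (inModel V n J y) ∈ cobarSymDeg V p
  by_cases h : ∃ w, wordLen w = n ∧ wordSet w = J
  · obtain ⟨w, rfl, rfl⟩ := h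
    rw [fromModel_inModel]
    have := fromWord_mem_cobarSymDeg V w hy
    rwa [add_sub_cancel_right] at this
  · have h0 : fromModel V (inModel V n J y) = 0 := by
      refine (DirectSum.toModule_lof k (ι := ℕ × Finset ℕ) (M := fun i => TPow V i.1)
        (n, J) y).trans ?_
      rw [dif_neg h, LinearMap.zero_apply]
    rw [h0]
    exact Submodule.zero_mem _

lemma genOp_mem_modelDeg {p q : ℤ} {c : SymBar (susp V)} (hc : c ∈ symBarDeg (susp V) q)
    {z : Model V} (hz : z ∈ modelDeg V p) : genOp V c z ∈ modelDeg V (q + 1 + p) := by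
  classical
  have h1 : ∀ m, (c m).1 ∈ tpowDeg (susp V) (m + 1) q := fun m => (Submodule.mem_iInf _).1 hc m
  rw [← DirectSum.sum_support_of c, map_sum, LinearMap.sum_apply]
  refine Submodule.sum_mem _ fun m _ => ?_
  suffices h : modelDeg V p ≤ (modelDeg V (q + 1 + p)).comap (concOp V m (c m).1) by
    have h2 := h hz
    rw [Submodule.mem_comap, ← genOp_inSym] at h2
    exact h2
  refine Submodule.span_le.2 ?_
  rintro _ ⟨n, J, y, hy, rfl⟩
  refine Submodule.subset_span ⟨m + 1 + n, consSet m J, _, ?_, concOp_inModel V m (c m).1 n J y⟩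
  have h3 := concat_mem_tpowDeg V (desuspPow_mem_tpowDeg V
    (tpowSign_pow_mem_tpowDeg (susp V) J.card (h1 m))) hy
  rw [card_consSet]
  convert h3 using 2
  push_cast
  ring

lemma modelOne_mem_modelDeg : modelOne V ∈ modelDeg V 0 :=
  Submodule.subset_span ⟨0, ∅, _,
    Submodule.subset_span ⟨Fin.elim0, Fin.elim0, fun i => i.elim0, by simp, rfl⟩, rfl⟩

lemma toModel_mem_modelDeg {p : ℤ} {x : CobarSym V} (hx : x ∈ cobarSymDeg V p) :
    toModel V x ∈ modelDeg V p := by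
  suffices h : cobarSymDeg V p ≤ (modelDeg V p).comap (toModel V) from h hx
  refine Submodule.span_le.2 ?_
  rintro _ ⟨r, q, c, hc, rfl, rfl⟩
  change toModel V _ ∈ modelDeg V _
  clear hx
  induction r with
  | zero =>
    rw [List.ofFn_zero, List.prod_nil, toModel_one, Finset.sum_eq_zero (by simp)]
    exact modelOne_mem_modelDeg V
  | succ r ih =>
    rw [List.ofFn_succ, List.prod_cons, toModel_mul, cobarOp_ι, Fin.sum_univ_succ]
    exact genOp_mem_modelDeg V (hc 0) (ih _ _ fun i => hc i.succ)

end Degrees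

/-! ### Standard tableaux and their rows and columns -/

namespace StdTableau

variable {μ : YoungDiagram} (T : StdTableau μ)

/-- The rows and columns of the entries of a standard tableau with `n` cells. -/
def tab {n : ℕ} (h : μ.card = n) : Tab n where
  row i := T.row (Fin.cast h.symm i)
  col i := T.col (Fin.cast h.symm i)
  inj i j hr hc := by
    have := T.entry.symm.injective (Subtype.ext (Prod.ext hr hc))
    exact Fin.cast_injective h.symm this
  std i r c hr hc := by
    subst h
    have hmem : (r, c) ∈ μ := μ.up_left_mem hr hc (T.entry.symm i).2
    have hmem' : (r, T.col i) ∈ μ := μ.up_left_mem hr le_rfl (T.entry.symm i).2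
    refine ⟨T.entry ⟨(r, c), hmem⟩, ?_, ?_, ?_⟩
    · have h1 : T.entry ⟨(r, c), hmem⟩ ≤ T.entry ⟨(r, T.col i), hmem'⟩ := by
        rcases hc.eq_or_lt with e | hlt
        · exact le_of_eq (congrArg T.entry (Subtype.ext (Prod.ext rfl e)))
        · exact (T.row_lt ⟨(r, c), hmem⟩ ⟨(r, T.col i), hmem'⟩ rfl hlt).le
      have h2 : T.entry ⟨(r, T.col i), hmem'⟩ ≤ i := by
        rcases hr.eq_or_lt with e | hlt
        · refine le_of_eq ?_
          rw [← Equiv.eq_symm_apply]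
          exact Subtype.ext (Prod.ext e rfl)
        · have := T.col_lt ⟨(r, T.col i), hmem'⟩ (T.entry.symm i) rfl hlt
          rw [Equiv.apply_symm_apply] at this
          exact this.le
      exact h1.trans h2
    · change (T.entry.symm (T.entry _)).1.1 = r
      rw [Equiv.symm_apply_apply]
    · change (T.entry.symm (T.entry _)).1.2 = c
      rw [Equiv.symm_apply_apply]

lemma shape_tab {n : ℕ} (h : μ.card = n) : (T.tab h).shape = μ.cells := by
  subst h
  ext x
  rw [Tab.mem_shape, YoungDiagram.mem_cells]
  constructor
  · rintro ⟨i, h1, h2⟩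
    rw [show x = (T.entry.symm i).1 from Prod.ext h1.symm h2.symm]
    exact (T.entry.symm i).2
  · intro hx
    refine ⟨T.entry ⟨x, hx⟩, ?_, ?_⟩
    · change (T.entry.symm (T.entry _)).1.1 = x.1
      rw [Equiv.symm_apply_apply]
    · change (T.entry.symm (T.entry _)).1.2 = x.2
      rw [Equiv.symm_apply_apply]

lemma eq_of_tab_eq {n : ℕ} {μ' : YoungDiagram} {T' : StdTableau μ'} {h : μ.card = n}
    {h' : μ'.card = n} (e : T.tab h = T'.tab h') : μ = μ' :=
  YoungDiagram.ext (by rw [← T.shape_tab h, e, T'.shape_tab])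

variable (μ) in
lemma tab_injective : Function.Injective fun T : StdTableau μ => T.tab rfl := by
  intro T T' e
  have h1 : T.entry.symm = T'.entry.symm := Equiv.ext fun i => Subtype.ext
    (Prod.ext (congrFun (congrArg Tab.row e) i) (congrFun (congrArg Tab.col e) i))
  have h2 : T.entry = T'.entry := by rw [← Equiv.symm_symm T.entry, h1, Equiv.symm_symm]
  cases T
  cases T'
  cases h2
  rfl

/-- Together with `tab_injective` and `eq_of_tab_eq` this lets the group algebra results for `Tab n`
be used for tableaux of all diagrams with `n` cells at once. -/
lemma exists_tab_eq {n : ℕ} (S : Tab n) :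
    ∃ (μ : YoungDiagram) (h : μ.card = n) (T : StdTableau μ), T.tab h = S := by
  let μ : YoungDiagram := ⟨S.shape, S.isLowerSet_shape⟩
  have h : μ.card = n := S.card_shape
  let f : Fin n → {c // c ∈ μ} := fun i => ⟨(S.row i, S.col i), S.cell_mem_shape i⟩
  have hf : Function.Bijective f := by
    constructor
    · intro i j e
      have := Prod.ext_iff.1 (Subtype.ext_iff.1 e)
      exact S.inj i j this.1 this.2
    · rintro ⟨x, hx⟩
      obtain ⟨i, h1, h2⟩ := S.mem_shape.1 hx
      exact ⟨i, Subtype.ext (Prod.ext h1 h2)⟩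
  let e : Fin n ≃ {c // c ∈ μ} := Equiv.ofBijective f hf
  have key : ∀ i j, S.row i ≤ S.row j → S.col i ≤ S.col j → i ≤ j := fun i j hr hc => by
    obtain ⟨l, hl, h1, h2⟩ := S.std j _ _ hr hc
    rwa [← S.inj l i h1 h2]
  have hfe : ∀ x, ((S.row (e.symm x), S.col (e.symm x)) : ℕ × ℕ) = x.1 := fun x =>
    congrArg Subtype.val (e.apply_symm_apply x)
  have hlt : ∀ x y : {c // c ∈ μ}, x ≠ y → x.1.1 ≤ y.1.1 → x.1.2 ≤ y.1.2 →
      e.symm x < e.symm y := fun x y hxy hr hc => by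
    refine lt_of_le_of_ne (key _ _ ?_ ?_) fun h => hxy (e.symm.injective h)
    · exact (congrArg Prod.fst (hfe x)).le.trans (hr.trans (congrArg Prod.fst (hfe y)).ge)
    · exact (congrArg Prod.snd (hfe x)).le.trans (hc.trans (congrArg Prod.snd (hfe y)).ge)
  refine ⟨μ, h, ⟨e.symm.trans (finCongr h.symm), fun x y hr hc => ?_, fun x y hc hr => ?_⟩, rfl⟩
  · exact hlt x y (fun h => hc.ne (by rw [h])) hr.le hc.le
  · exact hlt x y (fun h => hr.ne (by rw [h])) hr.le hc.le

lemma young_tab (k : Type u) [Field k] : (T.tab rfl).young k = youngElt k T := rfl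

lemma mem_descents {i : Fin μ.card} : i ∈ T.descents ↔ (T.tab rfl).IsDescent i := by
  simp only [descents, Finset.mem_filter, Finset.mem_univ, true_and]
  rfl

end StdTableau

/-! ### The map from the sum over all tableaux to the model -/

section FromSum

variable {k : Type u} [Field k] (V W : CochainComplex (ModuleCat.{v} k) ℤ)

/-- The set of natural numbers given by a subset of `Fin n`. -/
def valSet {n : ℕ} (J : Finset (Fin n)) : Finset ℕ := J.map Fin.valEmbedding

lemma valSet_injective {n : ℕ} : Function.Injective (valSet (n := n)) :=
  Finset.map_injective _

lemma card_valSet {n : ℕ} (J : Finset (Fin n)) : (valSet J).card = J.card := Finset.card_map _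

lemma mem_valSet {n : ℕ} {J : Finset (Fin n)} {j : ℕ} :
    j ∈ valSet J ↔ ∃ h : j < n, (⟨j, h⟩ : Fin n) ∈ J := by
  rw [valSet, Finset.mem_map]
  constructor
  · rintro ⟨i, hi, rfl⟩
    exact ⟨i.isLt, hi⟩
  · rintro ⟨h, hj⟩
    exact ⟨_, hj, rfl⟩

lemma valSet_erase {n : ℕ} (J : Finset (Fin n)) (j : Fin n) :
    valSet (J.erase j) = (valSet J).erase j := Finset.map_erase _ _ _

lemma card_range_sdiff_valSet {n : ℕ} (J : Finset (Fin n)) (j : Fin n) :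
    (Finset.range j \ valSet J).card =
      (Finset.univ.filter fun i => i < j ∧ i ∉ J).card := by
  rw [← card_valSet]
  congr 1
  ext i
  simp only [Finset.mem_sdiff, Finset.mem_range, mem_valSet, Finset.mem_filter, Finset.mem_univ,
    true_and, Fin.lt_def]
  constructor
  · rintro ⟨h1, h2⟩
    exact ⟨h1.trans j.isLt, h1, fun h => h2 ⟨_, h⟩⟩
  · rintro ⟨h, h1, h2⟩
    exact ⟨h1, fun ⟨_, h'⟩ => h2 h'⟩

variable {μ : YoungDiagram} (T : StdTableau μ)

/-- The map of `C_T ⊗ S^T(V)` to the model. -/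
def summandToModel : Summand V T →ₗ[k] Model V :=
  TensorProduct.lift (Finsupp.linearCombination k fun J : T.Index =>
    -- The element `c_T h_T` does not depend on `J`, so this map commutes with the removal of
    -- elements of `J`.
    inModel V μ.card (valSet J.1) ∘ₗ algAct V ((T.tab rfl).blockSum k) ∘ₗ (schur V T).subtype)

lemma summandToModel_tmul (J : T.Index) (x : schur V T) :
    summandToModel V T (combBasis k T J ⊗ₜ[k] x) =
      inModel V μ.card (valSet J.1) (algAct V ((T.tab rfl).blockSum k) x.1) := by
  rw [summandToModel, TensorProduct.lift.tmul, combBasis, Finsupp.linearCombination_single,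
    one_smul]
  rfl

variable {V T} in
lemma summand_ext {M : Type*} [AddCommMonoid M] [Module k M] {f g : Summand V T →ₗ[k] M}
    (h : ∀ (J : T.Index) (x : schur V T),
      f (combBasis k T J ⊗ₜ[k] x) = g (combBasis k T J ⊗ₜ[k] x)) : f = g :=
  TensorProduct.ext (Finsupp.lhom_ext' fun J => LinearMap.ext_ring (LinearMap.ext fun x => h J x))

lemma summandD_tmul (J : T.Index) (x : schur V T) :
    summandD V T (combBasis k T J ⊗ₜ[k] x) =
      (∑ j ∈ J.1, (-1 : k) ^ (Finset.univ.filter fun i => i < j ∧ i ∉ J.1).card •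
        (combBasis k T ⟨J.1.erase j, (Finset.erase_subset j J.1).trans J.2⟩ ⊗ₜ[k] x)) +
      (-1 : k) ^ J.1.card • (combBasis k T J ⊗ₜ[k] schurD V T x) := by
  rw [summandD, LinearMap.add_apply, TensorProduct.map_tmul, TensorProduct.map_tmul, combD,
    combSign, combBasis, Finsupp.linearCombination_single, Finsupp.linearCombination_single,
    one_smul, one_smul, TensorProduct.sum_tmul, LinearMap.id_apply]
  rfl

lemma modelD_summandToModel (t : Summand V T) :
    modelD V (summandToModel V T t) = summandToModel V T (summandD V T t) := by
  suffices h : modelD V ∘ₗ summandToModel V T = summandToModel V T ∘ₗ summandD V T from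
    LinearMap.congr_fun h t
  refine summand_ext fun J x => ?_
  have hd : (schurD V T x).1 = tpowD V μ.card x.1 := rfl
  have hc : tpowD V μ.card (algAct V ((T.tab rfl).blockSum k) x.1) =
      algAct V ((T.tab rfl).blockSum k) (tpowD V μ.card x.1) :=
    LinearMap.congr_fun (tpowD_comp_algAct V _) x.1
  rw [LinearMap.comp_apply, LinearMap.comp_apply, summandToModel_tmul, modelD_inModel,
    summandD_tmul, map_add, map_sum, map_smul, summandToModel_tmul, card_valSet, hd, hc, add_comm,
    valSet, Finset.sum_map]
  congr 1
  refine Finset.sum_congr rfl fun j _ => ?_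
  rw [map_smul, summandToModel_tmul, valSet_erase, ← card_range_sdiff_valSet]
  rfl

variable {V W} in
lemma modelMap_summandToModel (f : V ⟶ W) (t : Summand V T) :
    modelMap f (summandToModel V T t) = summandToModel W T (summandMap T f t) := by
  suffices h : modelMap f ∘ₗ summandToModel V T = summandToModel W T ∘ₗ summandMap T f from
    LinearMap.congr_fun h t
  refine summand_ext fun J x => ?_
  have hd : (schurMap T f x).1 = tpowMap f μ.card x.1 := rfl
  have hc : tpowMap f μ.card (algAct V ((T.tab rfl).blockSum k) x.1) =
      algAct W ((T.tab rfl).blockSum k) (tpowMap f μ.card x.1) :=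
    LinearMap.congr_fun (tpowMap_comp_algAct f _) x.1
  rw [LinearMap.comp_apply, LinearMap.comp_apply, summandToModel_tmul, modelMap_inModel,
    summandMap, TensorProduct.map_tmul, LinearMap.id_apply, summandToModel_tmul, hd, hc]

instance : DecidableEq Shape := Classical.decEq _

instance (μ : YoungDiagram) : DecidableEq (StdTableau μ) := Classical.decEq _

/-- The map of the sum over all tableaux to the model. -/
def sumToModel : TableauSum V →ₗ[k] Model V :=
  LinearMap.coprod (LinearMap.toSpanSingleton k (Model V) (modelOne V))
    (DirectSum.toModule k Shape (Model V) fun μ =>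
      DirectSum.toModule k (StdTableau μ.1) (Model V) fun T => summandToModel V T)

/-- The inclusion of a summand. -/
def inSum (μ : Shape) (T : StdTableau μ.1) : Summand V T →ₗ[k] TableauSum V :=
  LinearMap.inr k k _ ∘ₗ DirectSum.lof k Shape (fun μ => ⨁ T : StdTableau μ.1, Summand V T) μ ∘ₗ
    DirectSum.lof k (StdTableau μ.1) (fun T => Summand V T) T

lemma inSum_apply (μ : Shape) (T : StdTableau μ.1) (t : Summand V T) :
    inSum V μ T t = (0, DirectSum.lof k Shape (fun μ => ⨁ T : StdTableau μ.1, Summand V T) μ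
      (DirectSum.lof k (StdTableau μ.1) (fun T => Summand V T) T t)) := rfl

variable {V} in
lemma tableauSum_ext {M : Type*} [AddCommMonoid M] [Module k M] {f g : TableauSum V →ₗ[k] M}
    (h0 : f (1, 0) = g (1, 0))
    (h : ∀ (μ : Shape) (T : StdTableau μ.1) (t : Summand V T),
      f (inSum V μ T t) = g (inSum V μ T t)) : f = g := by
  refine LinearMap.prod_ext (LinearMap.ext_ring h0) ?_
  refine DirectSum.linearMap_ext k fun μ => DirectSum.linearMap_ext k fun T => ?_
  exact LinearMap.ext fun t => h μ T t

lemma sumToModel_inSum (μ : Shape) (T : StdTableau μ.1) (t : Summand V T) :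
    sumToModel V (inSum V μ T t) = summandToModel V T t := by
  rw [inSum_apply, sumToModel, LinearMap.coprod_apply, map_zero, zero_add, DirectSum.toModule_lof,
    DirectSum.toModule_lof]

lemma sumToModel_one : sumToModel V (1, 0) = modelOne V := by
  rw [sumToModel, LinearMap.coprod_apply, map_zero, add_zero, LinearMap.toSpanSingleton_apply,
    one_smul]

lemma modelD_sumToModel (t : TableauSum V) :
    modelD V (sumToModel V t) = sumToModel V (tableauSumD V t) := by
  suffices h : modelD V ∘ₗ sumToModel V = sumToModel V ∘ₗ tableauSumD V from
    LinearMap.congr_fun h t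
  refine tableauSum_ext ?_ fun μ T t => ?_
  · have h0 : tableauSumD V (1, 0) = 0 := by
      rw [tableauSumD, LinearMap.prodMap_apply, map_zero]
      rfl
    rw [LinearMap.comp_apply, LinearMap.comp_apply, sumToModel_one, modelD_modelOne, h0, map_zero]
  · have h1 : tableauSumD V (inSum V μ T t) = inSum V μ T (summandD V T t) := by
      rw [inSum_apply, inSum_apply, tableauSumD, LinearMap.prodMap_apply, map_zero,
        DirectSum.lmap_lof, DirectSum.lmap_lof]
    rw [LinearMap.comp_apply, LinearMap.comp_apply, sumToModel_inSum, h1, sumToModel_inSum,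
      modelD_summandToModel]

variable {V W} in
lemma modelMap_modelOne (f : V ⟶ W) : modelMap f (modelOne V) = modelOne W := by
  rw [← toModel_one, modelMap_toModel, ← toModel_one]
  congr 1
  exact map_one (TensorAlgebra.lift k (TensorAlgebra.ι k ∘ₗ symBarMap (f⟦(1 : ℤ)⟧')))

variable {V W} in
lemma modelMap_sumToModel (f : V ⟶ W) (t : TableauSum V) :
    modelMap f (sumToModel V t) = sumToModel W (tableauSumMap f t) := by
  suffices h : modelMap f ∘ₗ sumToModel V = sumToModel W ∘ₗ tableauSumMap f from
    LinearMap.congr_fun h t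
  refine tableauSum_ext ?_ fun μ T t => ?_
  · have h0 : tableauSumMap f (1, 0) = (1, 0) := by
      rw [tableauSumMap, LinearMap.prodMap_apply, map_zero]
      rfl
    rw [LinearMap.comp_apply, LinearMap.comp_apply, sumToModel_one, h0, sumToModel_one,
      modelMap_modelOne]
  · have h1 : tableauSumMap f (inSum V μ T t) = inSum W μ T (summandMap T f t) := by
      rw [inSum_apply, inSum_apply, tableauSumMap, LinearMap.prodMap_apply, map_zero,
        DirectSum.lmap_lof, DirectSum.lmap_lof]
    rw [LinearMap.comp_apply, LinearMap.comp_apply, sumToModel_inSum, h1, sumToModel_inSum,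
      modelMap_summandToModel]

end FromSum

/-! ### Components -/

section Components

variable {k : Type u} [Field k] (V : CochainComplex (ModuleCat.{v} k) ℤ)

lemma component_inModel_of_ne {m n : ℕ} {K J : Finset ℕ} (h : (m, K) ≠ (n, J)) (y : TPow V m) :
    DirectSum.component k (ℕ × Finset ℕ) (fun i => TPow V i.1) (n, J) (inModel V m K y) = 0 := by
  rw [inModel, DirectSum.component.of, dif_neg h]

lemma card_ne_zero (μ : Shape) : μ.1.card ≠ 0 := fun h =>
  μ.2 (YoungDiagram.ext ((Finset.card_eq_zero.1 h).trans YoungDiagram.cells_bot.symm))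

/-- The component of an element of the sum in a summand. -/
def outSum (μ : Shape) (T : StdTableau μ.1) : TableauSum V →ₗ[k] Summand V T :=
  DirectSum.component k (StdTableau μ.1) (fun T => Summand V T) T ∘ₗ
    DirectSum.component k Shape (fun μ => ⨁ T : StdTableau μ.1, Summand V T) μ ∘ₗ
      LinearMap.snd k k _

lemma outSum_inSum (μ : Shape) (T : StdTableau μ.1) (t : Summand V T) :
    outSum V μ T (inSum V μ T t) = t := by
  rw [outSum, inSum_apply, LinearMap.comp_apply, LinearMap.comp_apply, LinearMap.snd_apply,
    DirectSum.component.lof_self, DirectSum.component.lof_self]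

lemma outSum_inSum_of_ne (μ : Shape) {T T' : StdTableau μ.1} (h : T' ≠ T) (t : Summand V T') :
    outSum V μ T (inSum V μ T' t) = 0 := by
  rw [outSum, inSum_apply, LinearMap.comp_apply, LinearMap.comp_apply, LinearMap.snd_apply,
    DirectSum.component.lof_self, DirectSum.component.of, dif_neg h]

lemma outSum_inSum_of_shape_ne {μ μ' : Shape} (h : μ' ≠ μ) (T : StdTableau μ.1)
    (T' : StdTableau μ'.1) (t : Summand V T') : outSum V μ T (inSum V μ' T' t) = 0 := by
  rw [outSum, inSum_apply, LinearMap.comp_apply, LinearMap.comp_apply, LinearMap.snd_apply,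
    DirectSum.component.of, dif_neg h, map_zero]

/-- The component of an element of the model in `V^{⊗0}`. -/
def scalarPart : Model V →ₗ[k] TPow V 0 :=
  DirectSum.component k (ℕ × Finset ℕ) (fun i => TPow V i.1) (0, ∅)

lemma scalarPart_sumToModel (t : TableauSum V) :
    scalarPart V (sumToModel V t) = t.1 • PiTensorProduct.tprod k Fin.elim0 := by
  suffices h : scalarPart V ∘ₗ sumToModel V = LinearMap.toSpanSingleton k (TPow V 0)
      (PiTensorProduct.tprod k Fin.elim0) ∘ₗ LinearMap.fst k k _ from LinearMap.congr_fun h t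
  refine tableauSum_ext ?_ fun μ T t => ?_
  · rw [LinearMap.comp_apply, sumToModel_one, LinearMap.comp_apply, LinearMap.fst_apply,
      LinearMap.toSpanSingleton_apply, one_smul]
    exact DirectSum.component.lof_self k (M := fun i : ℕ × Finset ℕ => TPow V i.1) (0, ∅) _
  · rw [LinearMap.comp_apply, sumToModel_inSum, LinearMap.comp_apply, LinearMap.fst_apply,
      inSum_apply, map_zero]
    suffices h : scalarPart V ∘ₗ summandToModel V T = 0 from LinearMap.congr_fun h t
    refine summand_ext fun K x => ?_
    refine (congrArg (scalarPart V) (summandToModel_tmul V T K x)).trans ?_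
    exact component_inModel_of_ne V (fun e => card_ne_zero μ (Prod.ext_iff.1 e).1) _

lemma isEmptyEquiv_smul_tprod (r : k) : PiTensorProduct.isEmptyEquiv (R := k)
    (s := fun _ : Fin 0 => Tot V) (Fin 0) (r • PiTensorProduct.tprod k Fin.elim0) = r := by
  rw [map_smul, PiTensorProduct.isEmptyEquiv_apply_tprod, smul_eq_mul, mul_one]

lemma eq_of_outSum_eq {t t' : TableauSum V} (h0 : t.1 = t'.1)
    (h : ∀ (μ : Shape) (T : StdTableau μ.1), outSum V μ T t = outSum V μ T t') : t = t' :=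
  Prod.ext h0 (DFinsupp.ext fun μ => DFinsupp.ext fun T => h μ T)

lemma sum_combBasis_tmul {μ : YoungDiagram} (T : StdTableau μ) (t : Summand V T) : ∑ J : T.Index, combBasis k T J ⊗ₜ[k]
    TensorProduct.finsuppScalarLeft k (schur V T) T.Index t J = t := by
  have h : ∀ t : Summand V T, (∑ J : T.Index, TensorProduct.mk k _ _ (combBasis k T J) ∘ₗ
      Finsupp.lapply J ∘ₗ (TensorProduct.finsuppScalarLeft k (schur V T) T.Index).toLinearMap) t =
      ∑ J : T.Index, combBasis k T J ⊗ₜ[k]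
        TensorProduct.finsuppScalarLeft k (schur V T) T.Index t J := fun t => by
    rw [LinearMap.sum_apply]
    rfl
  rw [← h]
  suffices h' : (∑ J : T.Index, TensorProduct.mk k _ _ (combBasis k T J) ∘ₗ
      Finsupp.lapply J ∘ₗ (TensorProduct.finsuppScalarLeft k (schur V T) T.Index).toLinearMap) =
      LinearMap.id from LinearMap.congr_fun h' t
  refine summand_ext fun K x => ?_
  rw [h, Finset.sum_eq_single K]
  · simp [combBasis]
  · intro J _ hJ
    simp [combBasis, Finsupp.single_eq_of_ne hJ]
  · simp

lemma mem_tableauSumDeg_iff {p : ℤ} {t : TableauSum V} : t ∈ tableauSumDeg V p ↔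
    (p ≠ 0 → t.1 = 0) ∧ ∀ (μ : Shape) (T : StdTableau μ.1), outSum V μ T t ∈ summandDeg V T p := by
  rw [tableauSumDeg, Submodule.mem_prod]
  refine and_congr ?_ ?_
  · split_ifs with h <;> simp [h]
  · simp only [Submodule.mem_iInf]
    rfl

lemma sumToModel_mem_modelDeg {p : ℤ} {t : TableauSum V} (ht : t ∈ tableauSumDeg V p) :
    sumToModel V t ∈ modelDeg V p := by
  classical
  obtain ⟨h0, h1⟩ := (mem_tableauSumDeg_iff V).1 ht
  have h2 : ∀ (μ : YoungDiagram) (T : StdTableau μ) (x : Summand V T), x ∈ summandDeg V T p →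
      summandToModel V T x ∈ modelDeg V p := by
    intro μ T x hx
    suffices h : summandDeg V T p ≤ (modelDeg V p).comap (summandToModel V T) from h hx
    refine Submodule.span_le.2 ?_
    rintro _ ⟨J, q, u, hu, hq, rfl⟩
    refine Submodule.subset_span ⟨μ.card, valSet J.1, _, ?_, summandToModel_tmul V T J u⟩
    rw [card_valSet, ← hq, neg_add_eq_sub, sub_add_cancel]
    exact algAct_mem_tpowDeg V _ hu
  rw [sumToModel, LinearMap.coprod_apply]
  refine Submodule.add_mem _ ?_ ?_
  · rw [LinearMap.toSpanSingleton_apply]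
    by_cases hp : p = 0
    · subst hp
      exact Submodule.smul_mem _ _ (modelOne_mem_modelDeg V)
    · rw [h0 hp, zero_smul]
      exact Submodule.zero_mem _
  · have h3 : ∀ μ : Shape, DirectSum.toModule k (StdTableau μ.1) (Model V)
        (fun T => summandToModel V T) (t.2 μ) ∈ modelDeg V p := by
      intro μ
      rw [← DirectSum.sum_support_of (t.2 μ), map_sum]
      refine Submodule.sum_mem _ fun T _ => ?_
      have := DirectSum.toModule_lof k (φ := fun T : StdTableau μ.1 => summandToModel V T) T
        (t.2 μ T)
      exact this.symm ▸ h2 _ _ _ (h1 μ T)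
    rw [← DirectSum.sum_support_of t.2, map_sum]
    refine Submodule.sum_mem _ fun μ _ => ?_
    have := DirectSum.toModule_lof k (φ := fun μ : Shape => DirectSum.toModule k (StdTableau μ.1)
      (Model V) (fun T => summandToModel V T)) μ (t.2 μ)
    exact this.symm ▸ h3 μ

/-- As `J` consists of descents, `T_J` is a basis vector of `C_T`, and `T_J ⊗ u e_T` is a preimage.
-/
lemma inModel_young_mem_range {n : ℕ} (hn : n ≠ 0) (T : Tab n) {J : Finset ℕ}
    (hJ : ∀ j ∈ J, ∃ h : j < n, T.IsDescent ⟨j, h⟩) (u : TPow V n) :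
    inModel V n J (algAct V (T.blockSum k) (algAct V (T.young k) u)) ∈
      LinearMap.range (sumToModel V) := by
  obtain ⟨μ, h, T, rfl⟩ := StdTableau.exists_tab_eq T
  subst h
  have hμ : μ ≠ ⊥ := by
    rintro rfl
    exact hn (by rw [YoungDiagram.card, YoungDiagram.cells_bot, Finset.card_empty])
  let J' : T.Index := ⟨T.descents.filter fun i => i.val ∈ J, Finset.filter_subset _ _⟩
  have hJ' : valSet J'.1 = J := by
    ext j
    rw [mem_valSet]
    constructor
    · rintro ⟨h, hj⟩
      exact (Finset.mem_filter.1 hj).2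
    · intro hj
      obtain ⟨h, hd⟩ := hJ j hj
      exact ⟨h, Finset.mem_filter.2 ⟨T.mem_descents.2 hd, hj⟩⟩
  refine ⟨inSum V ⟨μ, hμ⟩ T (combBasis k T J' ⊗ₜ[k] ⟨algAct V (youngElt k T) u, u, rfl⟩), ?_⟩
  rw [sumToModel_inSum, summandToModel_tmul, hJ']
  rfl

end Components

/-! ### The comparison -/

section Comparison

variable {k : Type u} [Field k] [CharZero k] (V W : CochainComplex (ModuleCat.{v} k) ℤ)

/-- The coefficient of a tableau in an element of the model. -/
def extract {n : ℕ} (S : Tab n) (J : Finset ℕ) : Model V →ₗ[k] TPow V n :=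
  algAct V (S.coblock k) ∘ₗ
    DirectSum.component k (ℕ × Finset ℕ) (fun i => TPow V i.1) (n, J)

lemma extract_inModel {n : ℕ} (S : Tab n) (J : Finset ℕ) (y : TPow V n) :
    extract V S J (inModel V n J y) = algAct V (S.coblock k) y := by
  rw [extract, LinearMap.comp_apply, inModel]
  congr 1
  exact DirectSum.component.lof_self k (M := fun i : ℕ × Finset ℕ => TPow V i.1) (n, J) y

lemma extract_inModel_of_ne {n : ℕ} (S : Tab n) (J : Finset ℕ) {m : ℕ} {K : Finset ℕ}
    (h : (m, K) ≠ (n, J)) (y : TPow V m) : extract V S J (inModel V m K y) = 0 := by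
  rw [extract, LinearMap.comp_apply, component_inModel_of_ne V h, map_zero]

variable {μ : YoungDiagram} (T : StdTableau μ)

/-- A vector of the Schur complex is `u e_T`, and `e_T c_T h_T` times the coblock of `T` is `e_T`.
-/
lemma extract_summandToModel (J : T.Index) (t : Summand V T) :
    extract V (T.tab rfl) (valSet J.1) (summandToModel V T t) =
      (TensorProduct.finsuppScalarLeft k (schur V T) T.Index t J).1 := by
  suffices h : extract V (T.tab rfl) (valSet J.1) ∘ₗ summandToModel V T =
      (schur V T).subtype ∘ₗ Finsupp.lapply J ∘ₗ
        (TensorProduct.finsuppScalarLeft k (schur V T) T.Index).toLinearMap from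
    LinearMap.congr_fun h t
  refine summand_ext fun K x => ?_
  simp only [LinearMap.comp_apply, LinearEquiv.coe_coe, Finsupp.lapply_apply,
    TensorProduct.finsuppScalarLeft_apply_tmul_apply, combBasis, Submodule.subtype_apply]
  refine (congrArg (extract V (T.tab rfl) (valSet J.1)) (summandToModel_tmul V T K x)).trans ?_
  by_cases h : K = J
  · subst h
    rw [extract_inModel, Finsupp.single_eq_same, one_smul]
    obtain ⟨u, hu⟩ := x.2
    rw [← hu, ← StdTableau.young_tab, ← algAct_mul_apply, ← algAct_mul_apply, ← mul_assoc,
      Tab.young_mul_blockSum_mul_coblock, if_pos rfl]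
  · have he : (μ.card, valSet K.1) ≠ (μ.card, valSet J.1) := fun e =>
      h (Subtype.ext (valSet_injective (Prod.ext_iff.1 e).2))
    rw [extract_inModel_of_ne V _ _ he, Finsupp.single_eq_of_ne (Ne.symm h), zero_smul]
    rfl

lemma extract_summandToModel_of_ne {n : ℕ} (S : Tab n) (J : Finset ℕ)
    (hS : ∀ h : μ.card = n, T.tab h ≠ S) (t : Summand V T) :
    extract V S J (summandToModel V T t) = 0 := by
  suffices h : extract V S J ∘ₗ summandToModel V T = 0 from LinearMap.congr_fun h t
  refine summand_ext fun K x => ?_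
  refine (congrArg (extract V S J) (summandToModel_tmul V T K x)).trans ?_
  by_cases h : (μ.card, valSet K.1) = (n, J)
  · obtain ⟨rfl, rfl⟩ := Prod.ext_iff.1 h
    obtain ⟨u, hu⟩ := x.2
    rw [extract_inModel, ← hu, ← StdTableau.young_tab, ← algAct_mul_apply, ← algAct_mul_apply,
      ← mul_assoc, Tab.young_mul_blockSum_mul_coblock, if_neg (hS rfl), algAct_zero]
    rfl
  · exact extract_inModel_of_ne V S J h _

lemma extract_sumToModel (μ : Shape) (T : StdTableau μ.1) (J : T.Index) (t : TableauSum V) :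
    extract V (T.tab rfl) (valSet J.1) (sumToModel V t) =
      (TensorProduct.finsuppScalarLeft k (schur V T) T.Index (outSum V μ T t) J).1 := by
  suffices h : extract V (T.tab rfl) (valSet J.1) ∘ₗ sumToModel V =
      (schur V T).subtype ∘ₗ Finsupp.lapply J ∘ₗ
        (TensorProduct.finsuppScalarLeft k (schur V T) T.Index).toLinearMap ∘ₗ outSum V μ T from
    LinearMap.congr_fun h t
  refine tableauSum_ext ?_ fun μ' T' t => ?_
  · simp only [LinearMap.comp_apply, LinearEquiv.coe_coe]
    have he : ((0 : ℕ), (∅ : Finset ℕ)) ≠ (μ.1.card, valSet J.1) := fun e =>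
      card_ne_zero μ (Prod.ext_iff.1 e).1.symm
    rw [sumToModel_one, modelOne, extract_inModel_of_ne V _ _ he]
    have : outSum V μ T (1, 0) = 0 := by
      rw [outSum, LinearMap.comp_apply, LinearMap.comp_apply, LinearMap.snd_apply, map_zero,
        map_zero]
    rw [this, map_zero]
    rfl
  · simp only [LinearMap.comp_apply, LinearEquiv.coe_coe]
    rw [sumToModel_inSum]
    by_cases hμ : μ' = μ
    · subst hμ
      by_cases hT : T' = T
      · subst hT
        rw [extract_summandToModel, outSum_inSum]
        rfl
      · rw [extract_summandToModel_of_ne V T' _ _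
          fun _ e => hT (StdTableau.tab_injective μ'.1 e), outSum_inSum_of_ne V μ' hT, map_zero]
        rfl
    · rw [extract_summandToModel_of_ne V T' _ _
        fun _ e => hμ (Subtype.ext (StdTableau.eq_of_tab_eq T' e)),
        outSum_inSum_of_shape_ne V hμ, map_zero]
      rfl

/-- The scalar is visible in the copy of `V^{⊗0}`, and every coefficient of a `T_J` is recovered by
`extract`. -/
lemma sumToModel_injective : Function.Injective (sumToModel V) := by
  refine fun t t' ht => eq_of_outSum_eq V ?_ fun μ T => ?_
  · rw [← isEmptyEquiv_smul_tprod V t.1, ← scalarPart_sumToModel, ht, scalarPart_sumToModel,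
      isEmptyEquiv_smul_tprod]
  · refine (TensorProduct.finsuppScalarLeft k (schur V T) T.Index).injective ?_
    refine Finsupp.ext fun J => Subtype.ext ?_
    rw [← extract_sumToModel, ht, extract_sumToModel]

/-- Coefficients are recovered by taking a component and acting with the group algebra, both of
which respect degrees. So degrees can be tested in the model. -/
lemma mem_tableauSumDeg_of_sumToModel {p : ℤ} {t : TableauSum V}
    (h : sumToModel V t ∈ modelDeg V p) : t ∈ tableauSumDeg V p := by
  refine (mem_tableauSumDeg_iff V).2 ⟨fun hp => ?_, fun μ T => ?_⟩
  · have h1 : scalarPart V (sumToModel V t) ∈ tpowDeg V 0 (p + (∅ : Finset ℕ).card) :=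
      component_mem_of_mem_modelDeg V h (0, ∅)
    -- An empty tensor has degree zero, and here `p ≠ 0`.
    have h2 : tpowDeg V 0 (p + (∅ : Finset ℕ).card) = ⊥ := by
      rw [tpowDeg, Submodule.span_eq_bot]
      rintro x ⟨g, w, -, hg, -⟩
      simp only [Finset.univ_eq_empty, Finset.sum_empty, Finset.card_empty, Nat.cast_zero,
        add_zero] at hg
      exact absurd hg.symm hp
    rw [h2, Submodule.mem_bot, scalarPart_sumToModel] at h1
    rw [← isEmptyEquiv_smul_tprod V t.1, h1, map_zero]
  · rw [← sum_combBasis_tmul V T (outSum V μ T t)]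
    refine Submodule.sum_mem _ fun J _ => Submodule.subset_span
      ⟨J, p + J.1.card, _, ?_, by ring, rfl⟩
    change (TensorProduct.finsuppScalarLeft k (schur V T) T.Index (outSum V μ T t) J).1 ∈
      tpowDeg V μ.1.card (p + J.1.card)
    rw [← extract_sumToModel, ← card_valSet]
    exact algAct_mem_tpowDeg V _ (component_mem_of_mem_modelDeg V h (μ.1.card, valSet J.1))

/-- The factor `h_T` absorbs the transpositions at descents of `T`, and `J ⊆ J_T`, so the images are
invariant for `J`. -/
lemma range_sumToModel_le : LinearMap.range (sumToModel V) ≤ LinearMap.range (toModel V) := by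
  rintro _ ⟨t, rfl⟩
  suffices h : (LinearMap.range (toModel V)).mkQ ∘ₗ sumToModel V = 0 by
    have := LinearMap.congr_fun h t
    rwa [LinearMap.comp_apply, LinearMap.zero_apply, Submodule.mkQ_apply,
      Submodule.Quotient.mk_eq_zero] at this
  refine tableauSum_ext ?_ fun μ T t => ?_
  · rw [LinearMap.comp_apply, LinearMap.zero_apply, Submodule.mkQ_apply,
      Submodule.Quotient.mk_eq_zero, sumToModel_one, ← toModel_one]
    exact ⟨1, rfl⟩
  · rw [LinearMap.comp_apply, sumToModel_inSum]
    suffices h : (LinearMap.range (toModel V)).mkQ ∘ₗ summandToModel V T = 0 from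
      LinearMap.congr_fun h t
    refine summand_ext fun J x => ?_
    rw [LinearMap.comp_apply, LinearMap.zero_apply, Submodule.mkQ_apply,
      Submodule.Quotient.mk_eq_zero, summandToModel_tmul]
    have hJ : ∀ j ∈ valSet J.1, ∃ h : j < μ.1.card, (T.tab rfl).IsDescent ⟨j, h⟩ := fun j hj => by
      obtain ⟨h, hj⟩ := mem_valSet.1 hj
      exact ⟨h, T.mem_descents.1 (J.2 hj)⟩
    refine inModel_mem_range V (fun j hj => (hJ j hj).2.1) fun j h hj => ?_
    rw [swapAct, ← algAct_mul_apply, Tab.blockSum_mul_swap (T := T.tab rfl) h (hJ j hj).2]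

/-- Invariance gives `y (1 + s_j) = 2 y`, while `1 + s_j` annihilates the coblock from the left. -/
lemma algAct_coblock_eq_zero {n : ℕ} (T : Tab n) {j : ℕ} (h : j + 1 < n)
    (hj : ¬ T.IsDescent ⟨j, j.lt_succ_self.trans h⟩) {y : TPow V n}
    (hy : swapAct V ⟨j, j.lt_succ_self.trans h⟩ ⟨j + 1, h⟩ y = y) :
    algAct V (T.coblock k) y = 0 := by
  have h1 := congrArg (fun a => algAct V a y) (Tab.one_add_swap_mul_coblock (k := k) h hj)
  simp only [algAct_mul_apply, algAct_add, algAct_one, algAct_zero, LinearMap.add_apply,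
    LinearMap.id_apply, LinearMap.zero_apply] at h1
  have h2 : algAct V (perm k (Equiv.swap (⟨j, j.lt_succ_self.trans h⟩ : Fin n) ⟨j + 1, h⟩)) y = y :=
    hy
  rw [h2, map_add, ← two_smul k] at h1
  exact (smul_eq_zero.1 h1).resolve_left two_ne_zero

/-- The identity `1 = ∑ coblock * blockSum` splits an invariant tensor into parts indexed by
tableaux. The part at `T` vanishes unless all of `J` are descents of `T`, and then it lies in the
image of `C_T ⊗ S^T(V)`. -/
lemma range_toModel_le : LinearMap.range (toModel V) ≤ LinearMap.range (sumToModel V) := by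
  rintro _ ⟨x, rfl⟩
  suffices h : wordPart V ≤ LinearMap.range (sumToModel V) from h (toModel_mem_wordPart V x)
  refine Submodule.span_le.2 ?_
  rintro _ ⟨w, y, hy, rfl⟩
  cases w with
  -- The empty word accounts for the summand `k`.
  | nil =>
    suffices h : ∀ y : TPow V 0, inModel V 0 ∅ y ∈ LinearMap.range (sumToModel V) from h y
    intro y
    refine ⟨(PiTensorProduct.isEmptyEquiv (R := k) (s := fun _ : Fin 0 => Tot V) (Fin 0) y, 0), ?_⟩
    rw [sumToModel, LinearMap.coprod_apply, map_zero, add_zero, LinearMap.toSpanSingleton_apply,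
      modelOne, ← map_smul]
    congr 1
    apply (PiTensorProduct.isEmptyEquiv (R := k) (s := fun _ : Fin 0 => Tot V) (Fin 0)).injective
    exact isEmptyEquiv_smul_tprod V _
  | cons p w =>
    have hn : wordLen (p :: w) ≠ 0 := by
      simp only [wordLen]
      omega
    have h1 : y = ∑ T : Tab (wordLen (p :: w)), algAct V (T.blockSum k)
        (algAct V (T.coblock k) y) := by
      have h := congrArg (fun a => algAct V a y)
        (Tab.sum_coblock_mul_blockSum k (n := wordLen (p :: w)))
      simp only [algAct_sum, algAct_one, LinearMap.id_apply, LinearMap.sum_apply,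
        algAct_mul_apply] at h
      exact h.symm
    rw [h1, map_sum]
    refine Submodule.sum_mem _ fun T _ => ?_
    by_cases hJ : ∀ j ∈ wordSet (p :: w), ∃ h : j < wordLen (p :: w), T.IsDescent ⟨j, h⟩
    · obtain ⟨z, hz⟩ := T.exists_coblock_eq k
      rw [hz, algAct_mul_apply]
      exact inModel_young_mem_range V hn T hJ _
    · push Not at hJ
      obtain ⟨j, hj, hd⟩ := hJ
      have hlt := lt_wordLen hj
      rw [algAct_coblock_eq_zero V T hlt (hd _) (hy j hlt hj), map_zero, map_zero]
      exact Submodule.zero_mem _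

lemma range_toModel : LinearMap.range (toModel V) = LinearMap.range (sumToModel V) :=
  le_antisymm (range_toModel_le V) (range_sumToModel_le V)

lemma toModel_injective : Function.Injective (toModel V) :=
  Function.LeftInverse.injective (fromModel_toModel V)

/-- The isomorphism of the cobar construction with the sum over all tableaux. -/
def cobarEquiv : CobarSym V ≃ₗ[k] TableauSum V :=
  (LinearEquiv.ofInjective (toModel V) (toModel_injective V)).trans
    ((LinearEquiv.ofEq _ _ (range_toModel V)).trans
      (LinearEquiv.ofInjective (sumToModel V) (sumToModel_injective V)).symm)

lemma sumToModel_cobarEquiv (x : CobarSym V) : sumToModel V (cobarEquiv V x) = toModel V x := by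
  have h := LinearEquiv.apply_symm_apply
    (LinearEquiv.ofInjective (sumToModel V) (sumToModel_injective V))
    (LinearEquiv.ofEq _ _ (range_toModel V)
      (LinearEquiv.ofInjective (toModel V) (toModel_injective V) x))
  exact congrArg Subtype.val h

lemma map_cobarSymDeg (p : ℤ) :
    (cobarSymDeg V p).map (cobarEquiv V).toLinearMap = tableauSumDeg V p := by
  refine le_antisymm ?_ fun t ht => ?_
  · rintro _ ⟨x, hx, rfl⟩
    refine mem_tableauSumDeg_of_sumToModel V ?_
    exact (sumToModel_cobarEquiv V x).symm ▸ toModel_mem_modelDeg V hx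
  · obtain ⟨x, rfl⟩ := (cobarEquiv V).surjective t
    refine ⟨x, ?_, rfl⟩
    rw [← fromModel_toModel V x, ← sumToModel_cobarEquiv]
    exact fromModel_mem_cobarSymDeg V (sumToModel_mem_modelDeg V ht)

/-- Both sides are compared after the injection into the model, where `toModel` and `sumToModel`
commute with the differentials. Naturality follows in the same way. -/
lemma cobarEquiv_cobarSymD (x : CobarSym V) :
    cobarEquiv V (cobarSymD V x) = tableauSumD V (cobarEquiv V x) :=
  sumToModel_injective V (by
    rw [sumToModel_cobarEquiv, ← modelD_toModel, ← modelD_sumToModel, sumToModel_cobarEquiv])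

variable {V W} in
lemma cobarEquiv_cobarSymMap (f : V ⟶ W) (x : CobarSym V) :
    cobarEquiv W (cobarSymMap f x) = tableauSumMap f (cobarEquiv V x) :=
  sumToModel_injective W (by
    rw [sumToModel_cobarEquiv, ← modelMap_toModel, ← modelMap_sumToModel, sumToModel_cobarEquiv])

end Comparison

end TableauDecomposition
end

theorem theorem6 {k : Type u} [Field k] [CharZero k] :
    ∃ Φ : ∀ V : CochainComplex (ModuleCat.{v} k) ℤ, CobarSym V ≃ₗ[k] TableauSum V,
      (∀ (V : CochainComplex (ModuleCat.{v} k) ℤ) (p : ℤ),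
        (cobarSymDeg V p).map (Φ V).toLinearMap = tableauSumDeg V p) ∧
      (∀ (V : CochainComplex (ModuleCat.{v} k) ℤ) (x : CobarSym V),
        Φ V (cobarSymD V x) = tableauSumD V (Φ V x)) ∧
      (∀ (V W : CochainComplex (ModuleCat.{v} k) ℤ) (f : V ⟶ W) (x : CobarSym V),
        Φ W (cobarSymMap f x) = tableauSumMap f (Φ V x)) := by
  exact ⟨fun V => cobarEquiv V, fun V p => map_cobarSymDeg V p,
    fun V x => cobarEquiv_cobarSymD V x, fun _ _ f x => cobarEquiv_cobarSymMap f x⟩
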